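/- Let $d\ge 2$, $Q>0$ and $m>0$. For a Borel set $E\subset\mathbb R^d$ let $|E|$ be its Lebesgue measure and $$P(E)=\sup\Big\{\int_E \operatorname{div}\varphi\,dx:\ \varphi\in C^1_c(\mathbb R^d;\mathbb R^d),\ |\varphi|\le 1\Big\}\in[0,+\infty]$$ its perimeter, and for a bounded set $E$ let $$I_{\log}(E)=\inf\Big\{\iint -\log|x-y|\,d\mu(x)\,d\mu(y):\ \mu \text{ a Borel probability measure on }\mathbb R^d,\ \mu(\overline E)=1\Big\},$$ where $-\log 0=+\infty$. Let $\omega_d$ be the volume of the unit ball. For $\delta>0$ let $\mathcal K_\delta$ be the class of closed sets $E\subset\mathbb R^d$ such that for every $x\in\partial E$ there are an open ball of radius $\delta$ contained in $E$ and an open ball of radius $\delta$ contained in $\mathbb R^d\setminus E$, both having $x$ on their boundary; let $\mathcal K_\delta^{co}$ be the class of connected sets in $\mathcal K_\delta$ (sets of finite measure in $\mathcal K_\delta$ are bounded). Then: (i) $\inf\{P(E)+Q^2 I_{\log}(E):\ E\subset\mathbb R^d \text{ bounded and open},\ |E|=m\}=-\infty$. (ii) For every $\delta>0$ with $m>2\omega_d\delta^d$,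 $\ \inf\{P(E)+Q^2 I_{\log}(E):\ E\in\mathcal K_\delta,\ |E|=m\}=-\infty$. (iii) For every $\delta>0$ with $m>\omega_d\delta^d$, the functional $P+Q^2I_{\log}$ has a minimizer in $\{E\in\mathcal K_\delta^{co}:\ |E|=m\}$. (iv) For every bounded connected open set $\Omega\subset\mathbb R^d$ with $C^\infty$ boundary and $|\Omega|>m$, the problem $\min\{P(E):\ E\subset\Omega \text{ Borel},\ |E|=m\}$ has a solution, and $$\inf\{P(E)+Q^2I_{\log}(E):\ E\subset\Omega \text{ open},\ |E|=m\}=\min\{P(E):\ E\subset\Omega\text{ Borel},\ |E|=m\}+Q^2I_{\log}(\Omega).$$ -/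

import Mathlib

open MeasureTheory Set

namespace ChargedDrop

noncomputable section

/-- The divergence `∑ i, ∂ᵢ φᵢ` of a vector field on `ℝᵈ`. -/
def divergence {d : ℕ} (φ : EuclideanSpace ℝ (Fin d) → EuclideanSpace ℝ (Fin d))
    (x : EuclideanSpace ℝ (Fin d)) : ℝ :=
  ∑ i, fderiv ℝ φ x (EuclideanSpace.single i 1) i

/-- The De Giorgi perimeter of a set, i.e. the total variation of its indicator function:
`P(E) = sup {∫_E div φ : φ ∈ C¹_c(ℝᵈ; ℝᵈ), |φ| ≤ 1} ∈ [0, +∞]`. -/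
def perimeter {d : ℕ} (E : Set (EuclideanSpace ℝ (Fin d))) : EReal :=
  ⨆ φ ∈ {φ : EuclideanSpace ℝ (Fin d) → EuclideanSpace ℝ (Fin d) |
      ContDiff ℝ 1 φ ∧ HasCompactSupport φ ∧ ∀ x, ‖φ x‖ ≤ 1},
    ((∫ x in E, divergence φ x : ℝ) : EReal)

/-- The logarithmic kernel `-log |x - y|`, with value `+∞` on the diagonal. -/
def logKernel {d : ℕ} (x y : EuclideanSpace ℝ (Fin d)) : EReal :=
  -ENNReal.log (edist x y)

/-- The logarithmic energy `∬ -log |x - y| dμ(x) dμ(y)` of a measure, as the integral of the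
positive part minus the integral of the negative part. The negative part has finite integral
whenever `μ` is finite and concentrated on a bounded set. -/
def logEnergy {d : ℕ} (μ : Measure (EuclideanSpace ℝ (Fin d))) : EReal :=
  ((∫⁻ p, (logKernel p.1 p.2).toENNReal ∂(μ.prod μ) : ENNReal) : EReal) -
    ((∫⁻ p, (-logKernel p.1 p.2).toENNReal ∂(μ.prod μ) : ENNReal) : EReal)

/-- The logarithmic energy of a set: the infimum of the energies of the probability measures
concentrated on its closure. -/
def Ilog {d : ℕ} (E : Set (EuclideanSpace ℝ (Fin d))) : EReal :=
  ⨅ μ ∈ {μ : Measure (EuclideanSpace ℝ (Fin d)) | IsProbabilityMeasure μ ∧ μ (closure E) = 1},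
    logEnergy μ

/-- The functional `P(E) + Q² I_log(E)`. -/
def logFunctional {d : ℕ} (Q : ℝ) (E : Set (EuclideanSpace ℝ (Fin d))) : EReal :=
  perimeter E + ((Q ^ 2 : ℝ) : EReal) * Ilog E

/-- `ω_d`, the Lebesgue measure of the unit ball of `ℝᵈ`. -/
def unitBallVolume (d : ℕ) : ℝ :=
  volume.real (Metric.ball (0 : EuclideanSpace ℝ (Fin d)) 1)

/-- At every boundary point `x` there is a ball of radius `δ` contained in `E` whose boundary
sphere passes through `x`. -/
def InternalBallCondition {d : ℕ} (δ : ℝ) (E : Set (EuclideanSpace ℝ (Fin d))) : Prop :=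
  ∀ x ∈ frontier E, ∃ y, dist x y = δ ∧ Metric.ball y δ ⊆ E

/-- At every boundary point `x` there is a ball of radius `δ` contained in the complement of `E`
whose boundary sphere passes through `x`. -/
def ExternalBallCondition {d : ℕ} (δ : ℝ) (E : Set (EuclideanSpace ℝ (Fin d))) : Prop :=
  ∀ x ∈ frontier E, ∃ y, dist x y = δ ∧ Metric.ball y δ ⊆ Eᶜ

/-- The class `K_δ` of closed sets satisfying the `δ`-ball condition. -/
def ballClass (d : ℕ) (δ : ℝ) : Set (Set (EuclideanSpace ℝ (Fin d))) :=
  {E | IsClosed E ∧ InternalBallCondition δ E ∧ ExternalBallCondition δ E}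

/-- The class `K_δ^co` of connected sets in `K_δ`. -/
def connectedBallClass (d : ℕ) (δ : ℝ) : Set (Set (EuclideanSpace ℝ (Fin d))) :=
  {E | E ∈ ballClass d δ ∧ IsConnected E}

/-- Near each of its boundary points, `Ω` is the sublevel set `{g < 0}` of a `C^∞` function `g`
with non-vanishing differential. -/
def HasSmoothBoundary {d : ℕ} (Ω : Set (EuclideanSpace ℝ (Fin d))) : Prop :=
  ∀ x ∈ frontier Ω, ∃ U : Set (EuclideanSpace ℝ (Fin d)), IsOpen U ∧ x ∈ U ∧
    ∃ g : EuclideanSpace ℝ (Fin d) → ℝ, ContDiff ℝ ((⊤ : ℕ∞) : WithTop ℕ∞) g ∧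
      (∀ z ∈ U, fderiv ℝ g z ≠ 0) ∧ Ω ∩ U = {z | g z < 0} ∩ U

/-- Bounded smooth domains. -/
def IsBoundedSmoothDomain {d : ℕ} (Ω : Set (EuclideanSpace ℝ (Fin d))) : Prop :=
  IsOpen Ω ∧ IsConnected Ω ∧ Bornology.IsBounded Ω ∧ HasSmoothBoundary Ω

/-- `E₀` solves the isoperimetric problem `min {P(E) : E ⊆ Ω, |E| = m}`, posed among
Borel sets. -/
def IsIsoperimetricSolution {d : ℕ} (Ω : Set (EuclideanSpace ℝ (Fin d))) (m : ℝ)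
    (E₀ : Set (EuclideanSpace ℝ (Fin d))) : Prop :=
  E₀ ∈ {E | MeasurableSet E ∧ E ⊆ Ω ∧ volume E = ENNReal.ofReal m} ∧
    IsMinOn perimeter {E | MeasurableSet E ∧ E ⊆ Ω ∧ volume E = ENNReal.ofReal m} E₀

end

end ChargedDrop

open ChargedDrop

/-! ### Total variation and perimeter: duality, lower semicontinuity, Minkowski content. -/

namespace ChargedDrop
open Filter Topology
open scoped ENNReal NNReal

/-! The logarithmic kernel is unbounded below at infinity and only mildly singular on the diagonal;
both facts are decisive. Splitting the volume into two equal balls at distance `R` keeps the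
perimeter fixed and drives the energy down like `-(log R) / 2`. Such pairs are admissible in (i),
and in (ii) because the volume condition makes each radius at least `δ` (`exists_far_balls`).

In (iii) connectedness forbids this. Along a connected set of large diameter one finds many disjoint
balls of radius `δ` inside the set, so the volume bounds the diameter
(`subset_closedBall_of_connected`) and a minimizing sequence can be translated into a fixed ball.
The distance functions to the sets and to their complements subconverge, tangent balls pass to the
limit, and the set where both limits vanish is null, so volume is preserved
(`exists_subseq_ballClass`). Perimeter is lower semicontinuous for convergence in measure, and
energy is lower semicontinuous by weak compactness of the charges (`Ilog_le_of_forall_open`).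

In (iv) one inequality is monotonicity of `Ilog` together with minimality of the isoperimetric set.
For the other, charge can be stored on sets of negligible perimeter: on `N` balls of radius `N⁻²`
centred at independent random points with law `μ`, the self-energies contribute `O(log N / N)`,
while the total perimeter is `O(1 / N)` because `d ≥ 2` (`exists_small_open_of_mutualEnergy_lt`). A
nearly optimal charge on `closure Ω` is first pushed into a compact subset of `Ω` along a Lipschitz
inward field, at arbitrarily small cost in energy (`exists_compact_mutualEnergy_lt`). The resulting
tiny open set is glued to an open approximation of the isoperimetric set, and the volume is
corrected with small balls (`exists_open_competitor`).

The perimeter theory used on the way (semicontinuity, half of the coarea formula, submodularity,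
compactness) is derived from the duality definition, mostly by mollification. -/

/-- `ℝᵈ` with the Euclidean norm. -/
abbrev Eucl (d : ℕ) := EuclideanSpace ℝ (Fin d)

variable {d : ℕ}

/-- The admissible vector fields in the definition of the perimeter. -/
def testFields (d : ℕ) : Set (Eucl d → Eucl d) :=
  {φ | ContDiff ℝ 1 φ ∧ HasCompactSupport φ ∧ ∀ x, ‖φ x‖ ≤ 1}

/-- The total variation of a function. -/
noncomputable def tv (f : Eucl d → ℝ) : ℝ≥0∞ :=
  ⨆ φ ∈ testFields d, ENNReal.ofReal (∫ x, f x * divergence φ x)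

lemma le_tv (f : Eucl d → ℝ) {φ : Eucl d → Eucl d} (hφ : φ ∈ testFields d) :
    ENNReal.ofReal (∫ x, f x * divergence φ x) ≤ tv f :=
  le_iSup₂ (f := fun φ _ ↦ ENNReal.ofReal (∫ x, f x * divergence φ x)) φ hφ

lemma tv_le {f : Eucl d → ℝ} {a : ℝ≥0∞}
    (h : ∀ φ ∈ testFields d, ENNReal.ofReal (∫ x, f x * divergence φ x) ≤ a) : tv f ≤ a :=
  iSup₂_le h

lemma zero_mem_testFields : (0 : Eucl d → Eucl d) ∈ testFields d :=
  ⟨contDiff_const, HasCompactSupport.zero, by simp⟩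

lemma divergence_zero : divergence (0 : Eucl d → Eucl d) = 0 := by
  ext x; simp [divergence]

lemma continuous_divergence {φ : Eucl d → Eucl d} (hφ : ContDiff ℝ 1 φ) :
    Continuous (divergence φ) := by
  have h := hφ.continuous_fderiv (by norm_num)
  unfold divergence
  fun_prop

lemma hasCompactSupport_divergence {φ : Eucl d → Eucl d} (hφ : HasCompactSupport φ) :
    HasCompactSupport (divergence φ) := by
  refine (hφ.fderiv ℝ).mono ?_
  intro x hx h
  apply hx
  simp [divergence, h]

lemma integrable_divergence {φ : Eucl d → Eucl d} (hφ : φ ∈ testFields d) :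
    Integrable (divergence φ) :=
  (continuous_divergence hφ.1).integrable_of_hasCompactSupport
    (hasCompactSupport_divergence hφ.2.1)

lemma exists_bound_divergence {φ : Eucl d → Eucl d} (hφ : φ ∈ testFields d) :
    ∃ M : ℝ, 0 ≤ M ∧ ∀ x, |divergence φ x| ≤ M := by
  obtain ⟨M, hM⟩ := (hasCompactSupport_divergence hφ.2.1).exists_bound_of_continuous
    (continuous_divergence hφ.1)
  exact ⟨M, (norm_nonneg _).trans (hM 0), hM⟩

lemma integral_indicator_mul_divergence {E : Set (Eucl d)} (hE : MeasurableSet E)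
    (φ : Eucl d → Eucl d) :
    ∫ x, E.indicator 1 x * divergence φ x = ∫ x in E, divergence φ x := by
  rw [← integral_indicator hE]
  congr 1 with x
  by_cases hx : x ∈ E <;> simp [hx]

/-- The zero field makes the supremum nonnegative, so the truncation by `ENNReal.ofReal` in `tv`
loses nothing. Perimeters are handled below through `tv`, with values in `ℝ≥0∞`. -/
lemma perimeter_eq_tv {E : Set (Eucl d)} (hE : MeasurableSet E) :
    perimeter E = (tv (E.indicator 1) : EReal) := by
  apply le_antisymm
  · refine iSup₂_le fun φ hφ ↦ ?_
    rw [← integral_indicator_mul_divergence hE]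
    refine le_trans ?_ (EReal.coe_ennreal_le_coe_ennreal_iff.2 (le_tv _ hφ))
    rw [EReal.coe_ennreal_ofReal]
    exact_mod_cast le_max_left _ _
  · have h0 : (0 : EReal) ≤ perimeter E := by
      refine le_trans ?_ (le_iSup₂ (f := fun φ _ ↦ ((∫ x in E, divergence φ x : ℝ) : EReal))
        (0 : Eucl d → Eucl d) zero_mem_testFields)
      simp [divergence_zero]
    have h1 : tv (E.indicator 1) ≤ (perimeter E).toENNReal := by
      refine tv_le fun φ hφ ↦ ?_
      rw [integral_indicator_mul_divergence hE]
      have this : ((∫ x in E, divergence φ x : ℝ) : EReal) ≤ perimeter E :=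
        le_iSup₂ (f := fun φ _ ↦ ((∫ x in E, divergence φ x : ℝ) : EReal)) φ hφ
      have h2 := EReal.toENNReal_le_toENNReal this
      simpa using h2
    calc (tv (E.indicator 1) : EReal) ≤ ((perimeter E).toENNReal : EReal) := by
          exact_mod_cast h1
      _ = perimeter E := EReal.coe_toENNReal h0

lemma tv_congr_ae {f g : Eucl d → ℝ} (h : f =ᵐ[volume] g) : tv f = tv g := by
  unfold tv
  congr 1 with φ
  congr 1 with _
  congr 1
  apply integral_congr_ae
  filter_upwards [h] with x hx
  rw [hx]

lemma tv_indicator_congr {E F : Set (Eucl d)} (h : E =ᵐ[volume] F) :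
    tv (E.indicator 1) = tv (F.indicator 1) :=
  tv_congr_ae (indicator_ae_eq_of_ae_eq_set h)

/-- Lower semicontinuity of the total variation under bounded a.e. convergence. -/
lemma tv_le_liminf {f : Eucl d → ℝ} {g : ℕ → Eucl d → ℝ}
    (hm : ∀ n, AEStronglyMeasurable (g n) volume) (hb : ∀ n x, |g n x| ≤ 1)
    (h : ∀ᵐ x, Tendsto (fun n ↦ g n x) atTop (𝓝 (f x))) :
    tv f ≤ liminf (fun n ↦ tv (g n)) atTop := by
  refine tv_le fun φ hφ ↦ ?_
  -- For a fixed field the pairing converges along the sequence; `tv` is a supremum of such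
  -- pairings, hence lower semicontinuous.
  have ht : Tendsto (fun n ↦ ∫ x, g n x * divergence φ x) atTop
      (𝓝 (∫ x, f x * divergence φ x)) := by
    refine tendsto_integral_of_dominated_convergence (fun x ↦ |divergence φ x|) ?_ ?_ ?_ ?_
    · exact fun n ↦ (hm n).mul (integrable_divergence hφ).aestronglyMeasurable
    · exact (integrable_divergence hφ).abs
    · refine fun n ↦ Eventually.of_forall fun x ↦ ?_
      rw [Real.norm_eq_abs, abs_mul]
      exact mul_le_of_le_one_left (abs_nonneg _) (hb n x)
    · filter_upwards [h] with x hx using hx.mul_const _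
  rw [← ((ENNReal.continuous_ofReal.tendsto _).comp ht).liminf_eq]
  exact liminf_le_liminf (Eventually.of_forall fun n ↦ le_tv _ hφ)

lemma abs_indicator_one_le {α : Type*} (E : Set α) (x : α) : |E.indicator (1 : α → ℝ) x| ≤ 1 := by
  by_cases hx : x ∈ E <;> simp [hx]

/-- Lower semicontinuity of the perimeter under convergence in measure. -/
lemma tv_indicator_le_liminf {E : Set (Eucl d)} {F : ℕ → Set (Eucl d)} (hE : MeasurableSet E)
    (hF : ∀ n, MeasurableSet (F n)) (h : Tendsto (fun n ↦ volume (symmDiff (F n) E)) atTop (𝓝 0)) :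
    tv (E.indicator 1) ≤ liminf (fun n ↦ tv ((F n).indicator 1)) atTop := by
  refine tv_le fun φ hφ ↦ ?_
  obtain ⟨M, hM0, hM⟩ := exists_bound_divergence hφ
  have ht : Tendsto (fun n ↦ ∫ x, (F n).indicator 1 x * divergence φ x) atTop
      (𝓝 (∫ x, E.indicator 1 x * divergence φ x)) := by
    rw [tendsto_iff_edist_tendsto_0]
    have h2 : Tendsto (fun n ↦ ENNReal.ofReal M * volume (symmDiff (F n) E)) atTop (𝓝 0) := by
      simpa using ENNReal.Tendsto.const_mul h (Or.inr ENNReal.ofReal_ne_top)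
    refine tendsto_of_tendsto_of_tendsto_of_le_of_le tendsto_const_nhds h2 (fun _ ↦ zero_le) ?_
    intro n
    have hi : ∀ A : Set (Eucl d), MeasurableSet A →
        Integrable (fun x ↦ A.indicator 1 x * divergence φ x) := fun A hA ↦ by
      refine (integrable_divergence hφ).bdd_mul (c := 1) ?_ ?_
      · exact (measurable_one.indicator hA).aestronglyMeasurable
      · exact Eventually.of_forall fun x ↦ abs_indicator_one_le A x
    dsimp only
    rw [edist_eq_enorm_sub, ← integral_sub (hi _ (hF n)) (hi _ hE)]
    calc _ ≤ ∫⁻ x, ‖(F n).indicator 1 x * divergence φ x - E.indicator 1 x * divergence φ x‖ₑ :=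
          enorm_integral_le_lintegral_enorm _
      _ ≤ ∫⁻ x, (symmDiff (F n) E).indicator (fun _ ↦ ENNReal.ofReal M) x := by
          refine lintegral_mono fun x ↦ ?_
          have hMx : ‖divergence φ x‖ₑ ≤ ENNReal.ofReal M := by
            rw [← ofReal_norm]; exact ENNReal.ofReal_le_ofReal (hM x)
          by_cases h1 : x ∈ F n <;> by_cases h2 : x ∈ E <;>
            simp [h1, h2, Set.mem_symmDiff, hMx]
      _ = _ := lintegral_indicator_const ((hF n).symmDiff hE) _
  rw [← ((ENNReal.continuous_ofReal.tendsto _).comp ht).liminf_eq]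
  exact liminf_le_liminf (Eventually.of_forall fun n ↦ le_tv _ hφ)

lemma eucl_eq_sum (x : Eucl d) : x = ∑ i, x i • EuclideanSpace.single i (1 : ℝ) := by
  have := (EuclideanSpace.basisFun (Fin d) ℝ).sum_repr x
  simpa using this.symm

lemma contDiff_coord {n : WithTop ℕ∞} {φ : Eucl d → Eucl d} (hφ : ContDiff ℝ n φ) (i : Fin d) :
    ContDiff ℝ n (fun x ↦ φ x i) :=
  (EuclideanSpace.proj (𝕜 := ℝ) i).contDiff.comp hφ

lemma hasCompactSupport_coord {φ : Eucl d → Eucl d} (hφ : HasCompactSupport φ) (i : Fin d) :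
    HasCompactSupport (fun x ↦ φ x i) :=
  hφ.comp_left (g := fun v : Eucl d ↦ v i) (by simp)

lemma fderiv_coord {φ : Eucl d → Eucl d} {x : Eucl d} (hφ : DifferentiableAt ℝ φ x) (i : Fin d)
    (v : Eucl d) : fderiv ℝ (fun x ↦ φ x i) x v = fderiv ℝ φ x v i := by
  have h : HasFDerivAt (fun y ↦ φ y i)
      ((EuclideanSpace.proj i : Eucl d →L[ℝ] ℝ).comp (fderiv ℝ φ x)) x :=
    (EuclideanSpace.proj i : Eucl d →L[ℝ] ℝ).hasFDerivAt.comp x hφ.hasFDerivAt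
  rw [h.fderiv]
  simp

/-- Integration by parts for Lipschitz functions. -/
lemma integral_mul_divergence_of_lipschitz {f : Eucl d → ℝ} {L : ℝ≥0} (hf : LipschitzWith L f)
    {φ : Eucl d → Eucl d} (hφ : φ ∈ testFields d) :
    ∫ x, f x * divergence φ x = -∫ x, fderiv ℝ f x (φ x) := by
  have hc := fun i ↦ contDiff_coord hφ.1 i
  have hs := fun i ↦ hasCompactSupport_coord hφ.2.1 i
  have key : ∀ i : Fin d, ∫ x, f x * fderiv ℝ φ x (EuclideanSpace.single i 1) i =
      -∫ x, lineDeriv ℝ f x (EuclideanSpace.single i 1) * φ x i := by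
    intro i
    obtain ⟨D, hD⟩ := (hc i).lipschitzWith_of_hasCompactSupport (hs i) (by norm_num)
    rw [hf.integral_lineDeriv_mul_eq hD (hs i), ← integral_neg]
    congr 1 with x
    rw [((hc i).differentiable (by norm_num) x).lineDeriv_eq_fderiv, map_neg,
      fderiv_coord (hφ.1.differentiable (by norm_num) x)]
    ring
  have i1 : ∀ i : Fin d, Integrable
      (fun x ↦ f x * fderiv ℝ φ x (EuclideanSpace.single i 1) i) := by
    intro i
    apply Continuous.integrable_of_hasCompactSupport
    · have h := hφ.1.continuous_fderiv (by norm_num)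
      have := hf.continuous
      fun_prop
    · refine (hφ.2.1.fderiv ℝ).mono fun x hx h ↦ hx ?_
      simp [h]
  have i2 : ∀ i : Fin d, Integrable
      (fun x ↦ lineDeriv ℝ f x (EuclideanSpace.single i 1) * φ x i) := by
    intro i
    have : Integrable (fun x ↦ φ x i) :=
      (hc i).continuous.integrable_of_hasCompactSupport (hs i)
    refine this.bdd_mul (c := L * ‖(EuclideanSpace.single i (1:ℝ) : Eucl d)‖) ?_ ?_
    · exact (hf.memLp_lineDeriv _).aestronglyMeasurable
    · exact Eventually.of_forall fun x ↦ norm_lineDeriv_le_of_lipschitz ℝ hf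
  -- By Rademacher's theorem `f` is differentiable almost everywhere, and there the line derivatives
  -- assemble into `fderiv`; elsewhere the default value `0` of `fderiv` is harmless.
  have : ∫ x, fderiv ℝ f x (φ x) =
      ∫ x, ∑ i, lineDeriv ℝ f x (EuclideanSpace.single i 1) * φ x i := by
    apply integral_congr_ae
    filter_upwards [hf.ae_differentiableAt] with x hx
    conv_lhs => rw [eucl_eq_sum (φ x), map_sum]
    refine Finset.sum_congr rfl fun i _ ↦ ?_
    rw [map_smul, hx.lineDeriv_eq_fderiv, smul_eq_mul, mul_comm]
  rw [this, integral_finsetSum _ fun i _ ↦ i2 i, ← Finset.sum_neg_distrib]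
  simp only [divergence, Finset.mul_sum]
  rw [integral_finsetSum _ fun i _ ↦ i1 i]
  exact Finset.sum_congr rfl fun i _ ↦ key i

/-- The total variation of a Lipschitz function is at most the integral of its gradient. -/
lemma tv_le_lintegral_fderiv {f : Eucl d → ℝ} {L : ℝ≥0} (hf : LipschitzWith L f) :
    tv f ≤ ∫⁻ x, ‖fderiv ℝ f x‖ₑ := by
  refine tv_le fun φ hφ ↦ ?_
  rw [integral_mul_divergence_of_lipschitz hf hφ]
  calc ENNReal.ofReal (-∫ x, fderiv ℝ f x (φ x)) ≤ ‖-∫ x, fderiv ℝ f x (φ x)‖ₑ := by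
        rw [← ofReal_norm]; exact ENNReal.ofReal_le_ofReal (le_abs_self _)
    _ ≤ ∫⁻ x, ‖fderiv ℝ f x (φ x)‖ₑ := by
        rw [enorm_neg]; exact enorm_integral_le_lintegral_enorm _
    _ ≤ _ := by
        refine lintegral_mono fun x ↦ ?_
        rw [← ofReal_norm, ← ofReal_norm]
        apply ENNReal.ofReal_le_ofReal
        calc _ ≤ ‖fderiv ℝ f x‖ * ‖φ x‖ := (fderiv ℝ f x).le_opNorm _
          _ ≤ _ := mul_le_of_le_one_right (norm_nonneg _) (hφ.2.2 x)

/-- If `f` is Lipschitz with values in `[0,1]`, its gradient vanishes where `f ∈ {0, 1}`. -/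
lemma tv_le_of_lipschitz_unit {f : Eucl d → ℝ} {L : ℝ≥0} (hf : LipschitzWith L f)
    (h01 : ∀ x, f x ∈ Icc (0 : ℝ) 1) :
    tv f ≤ ∫⁻ x in {x | f x ∈ Ioo (0 : ℝ) 1}, ‖fderiv ℝ f x‖ₑ := by
  refine (tv_le_lintegral_fderiv hf).trans (le_of_eq ?_)
  have hms : MeasurableSet {x | f x ∈ Ioo (0 : ℝ) 1} :=
    (isOpen_Ioo.preimage hf.continuous).measurableSet
  rw [← lintegral_indicator hms]
  congr 1 with x
  by_cases hx : x ∈ {x | f x ∈ Ioo (0 : ℝ) 1}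
  · rw [indicator_of_mem hx]
  · rw [indicator_of_notMem hx]
    have : fderiv ℝ f x = 0 := by
      rcases eq_or_lt_of_le (h01 x).1 with h | h
      · exact IsLocalMin.fderiv_eq_zero (Eventually.of_forall fun y ↦ by rw [← h]; exact (h01 y).1)
      rcases eq_or_lt_of_le (h01 x).2 with h' | h'
      · exact IsLocalMax.fderiv_eq_zero (Eventually.of_forall fun y ↦ by rw [h']; exact (h01 y).2)
      · exact absurd ⟨h, h'⟩ hx
    rw [this, ← ofReal_norm]; simp

/-- The perimeter of an open set is bounded by its inner Minkowski content. -/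
lemma tv_indicator_le_minkowski {U : Set (Eucl d)} (hU : IsOpen U) (hne : (Uᶜ).Nonempty) {C : ℝ≥0∞}
    {h : ℕ → ℝ} (hpos : ∀ n, 0 < h n) (hlim : Tendsto h atTop (𝓝 0))
    (hC : ∀ n, volume {x | 0 < Metric.infDist x Uᶜ ∧ Metric.infDist x Uᶜ < h n} ≤
      C * ENNReal.ofReal (h n)) : tv (U.indicator 1) ≤ C := by
  -- A ramp rising from `0` on `Uᶜ` to `1` at depth `h n`. Its slope is at most `1 / h n` and its
  -- gradient lives in the boundary layer, so its variation is at most `C`; the ramps tend to the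
  -- indicator of `U`.
  let g : ℕ → Eucl d → ℝ := fun n x ↦ min 1 ((h n)⁻¹ * Metric.infDist x Uᶜ)
  have hg01 : ∀ n x, g n x ∈ Icc (0 : ℝ) 1 := fun n x ↦
    ⟨le_min zero_le_one (mul_nonneg (inv_nonneg.2 (hpos n).le) Metric.infDist_nonneg), min_le_left _ _⟩
  have hLip : ∀ n, LipschitzWith (Real.toNNReal (h n)⁻¹) (g n) := by
    intro n
    have h1 : LipschitzWith (Real.toNNReal (h n)⁻¹) (fun x ↦ (h n)⁻¹ * Metric.infDist x Uᶜ) := by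
      refine LipschitzWith.of_dist_le_mul fun x y ↦ ?_
      rw [Real.coe_toNNReal _ (inv_nonneg.2 (hpos n).le), Real.dist_eq, ← mul_sub, abs_mul,
        abs_of_pos (inv_pos.2 (hpos n)), ← Real.dist_eq]
      gcongr
      · exact (inv_pos.2 (hpos n)).le
      · simpa using (Metric.lipschitz_infDist_pt Uᶜ).dist_le_mul x y
    simpa using h1.const_min 1
  have hcl : IsClosed Uᶜ := hU.isClosed_compl
  calc tv (U.indicator 1) ≤ liminf (fun n ↦ tv (g n)) atTop := by
        refine tv_le_liminf (fun n ↦ (hLip n).continuous.aestronglyMeasurable) ?_ ?_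
        · intro n x
          rw [abs_of_nonneg (hg01 n x).1]; exact (hg01 n x).2
        · refine Eventually.of_forall fun x ↦ ?_
          by_cases hx : x ∈ U
          · have hd : 0 < Metric.infDist x Uᶜ :=
              (hcl.notMem_iff_infDist_pos hne).1 (by simpa using hx)
            apply tendsto_const_nhds.congr'
            filter_upwards [hlim.eventually (gt_mem_nhds hd)] with n hn
            simp only [g, hx, indicator_of_mem, Pi.one_apply]
            rw [min_eq_left]
            rw [inv_mul_eq_div, one_le_div (hpos n)]; exact hn.le
          · have hd : Metric.infDist x Uᶜ = 0 := Metric.infDist_zero_of_mem hx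
            simp [g, hx, hd]
    _ ≤ liminf (fun _ ↦ C) (atTop : Filter ℕ) := by
        refine liminf_le_liminf (Eventually.of_forall fun n ↦ ?_)
        refine (tv_le_of_lipschitz_unit (hLip n) (hg01 n)).trans ?_
        calc _ ≤ ∫⁻ x in {x | g n x ∈ Ioo (0 : ℝ) 1}, ENNReal.ofReal (h n)⁻¹ := by
              refine lintegral_mono fun x ↦ ?_
              rw [← ofReal_norm]
              apply ENNReal.ofReal_le_ofReal
              have := norm_fderiv_le_of_lipschitz ℝ (hLip n) (x₀ := x)
              rwa [Real.coe_toNNReal _ (inv_nonneg.2 (hpos n).le)] at this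
          _ = ENNReal.ofReal (h n)⁻¹ * volume {x | g n x ∈ Ioo (0 : ℝ) 1} := by simp
          _ ≤ ENNReal.ofReal (h n)⁻¹ * (C * ENNReal.ofReal (h n)) := by
              gcongr
              refine le_trans (measure_mono fun x hx ↦ ?_) (hC n)
              simp only [g, mem_ofPred_eq, mem_Ioo, lt_min_iff, min_lt_iff, lt_irrefl, false_or] at hx ⊢
              obtain ⟨⟨_, h1⟩, h2⟩ := hx
              refine ⟨pos_of_mul_pos_right h1 (inv_pos.2 (hpos n)).le, ?_⟩
              rwa [inv_mul_lt_iff₀ (hpos n), mul_one] at h2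
          _ = C := by
              rw [mul_comm, mul_assoc, ← ENNReal.ofReal_mul (hpos n).le, mul_inv_cancel₀ (hpos n).ne']
              simp
    _ = C := by simp

end ChargedDrop

/-! ### Mollification of indicators, and half of the coarea formula. -/

namespace ChargedDrop
open Filter Topology
open scoped ENNReal NNReal Convolution

variable {d : ℕ}

lemma liminf_add_liminf_le_of_le {a b : ℕ → ℝ≥0∞} {c : ℝ≥0∞} (h : ∀ n, a n + b n ≤ c) :
    liminf a atTop + liminf b atTop ≤ c := by
  rw [liminf_eq_iSup_iInf_of_nat, liminf_eq_iSup_iInf_of_nat, ENNReal.iSup_add_iSup_of_monotone]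
  · refine iSup_le fun n ↦ le_trans (add_le_add ?_ ?_) (h n)
    · exact iInf₂_le n le_rfl
    · exact iInf₂_le n le_rfl
  · exact fun n m hnm ↦ le_iInf₂ fun i hi ↦ iInf₂_le i (hnm.trans hi)
  · exact fun n m hnm ↦ le_iInf₂ fun i hi ↦ iInf₂_le i (hnm.trans hi)

/-- A smooth bump function of radius `1 / (k + 1)`. -/
noncomputable def mollifier (d k : ℕ) : ContDiffBump (0 : Eucl d) where
  rIn := (2 * (k + 1 : ℝ))⁻¹
  rOut := ((k : ℝ) + 1)⁻¹
  rIn_pos := by positivity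
  rIn_lt_rOut := by
    have : (0 : ℝ) < k + 1 := by positivity
    exact inv_strictAnti₀ this (by linarith)

/-- The normalized mollifier. -/
noncomputable def rho (d k : ℕ) : Eucl d → ℝ := (mollifier d k).normed volume

lemma rho_nonneg (k : ℕ) (x : Eucl d) : 0 ≤ rho d k x := (mollifier d k).nonneg_normed x

lemma integral_rho (k : ℕ) : ∫ x, rho d k x = 1 := (mollifier d k).integral_normed

lemma contDiff_rho (k : ℕ) {n : ℕ∞} : ContDiff ℝ n (rho d k) := (mollifier d k).contDiff_normed

lemma hasCompactSupport_rho (k : ℕ) : HasCompactSupport (rho d k) :=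
  (mollifier d k).hasCompactSupport_normed

lemma continuous_rho (k : ℕ) : Continuous (rho d k) := (contDiff_rho k (n := 0)).continuous

lemma integrable_rho (k : ℕ) : Integrable (rho d k) :=
  (continuous_rho k).integrable_of_hasCompactSupport (hasCompactSupport_rho k)

lemma lintegral_rho (k : ℕ) : ∫⁻ x, ENNReal.ofReal (rho d k x) = 1 := by
  rw [← ofReal_integral_eq_lintegral_ofReal (integrable_rho k)
    (Eventually.of_forall (rho_nonneg k)), integral_rho, ENNReal.ofReal_one]

lemma norm_lt_of_rho_ne_zero {k : ℕ} {x : Eucl d} (h : rho d k x ≠ 0) :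
    ‖x‖ < ((k : ℝ) + 1)⁻¹ := by
  have : x ∈ Function.support ((mollifier d k).normed volume) := h
  rw [ContDiffBump.support_normed_eq] at this
  simpa [mollifier] using this

/-- The mollification of the indicator function of a set. -/
noncomputable def mollify (k : ℕ) (E : Set (Eucl d)) : Eucl d → ℝ :=
  rho d k ⋆[ContinuousLinearMap.lsmul ℝ ℝ, volume] E.indicator 1

lemma mollify_apply (k : ℕ) (E : Set (Eucl d)) (x : Eucl d) :
    mollify k E x = ∫ t, rho d k t * E.indicator 1 (x - t) := by
  simp [mollify, convolution_def]

lemma locallyIntegrable_indicator_one {E : Set (Eucl d)} (hE : MeasurableSet E) :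
    LocallyIntegrable (E.indicator (1 : Eucl d → ℝ)) volume :=
  (locallyIntegrable_const (1 : ℝ)).indicator hE

lemma contDiff_mollify (k : ℕ) {E : Set (Eucl d)} (hE : MeasurableSet E) {n : ℕ∞} :
    ContDiff ℝ n (mollify k E) :=
  (hasCompactSupport_rho k).contDiff_convolution_left _ (contDiff_rho k)
    (locallyIntegrable_indicator_one hE)

lemma continuous_mollify (k : ℕ) {E : Set (Eucl d)} (hE : MeasurableSet E) :
    Continuous (mollify k E) := (contDiff_mollify k hE (n := 0)).continuous

lemma hasCompactSupport_mollify (k : ℕ) {E : Set (Eucl d)} (hE : Bornology.IsBounded E) :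
    HasCompactSupport (mollify k E) := by
  refine HasCompactSupport.convolution _ (hasCompactSupport_rho k) ?_
  exact HasCompactSupport.intro hE.isCompact_closure fun x hx ↦
    indicator_of_notMem (fun h ↦ hx (subset_closure h)) _

lemma integrable_rho_mul_indicator (k : ℕ) {E : Set (Eucl d)} (hE : MeasurableSet E) (x : Eucl d) :
    Integrable (fun t ↦ rho d k t * E.indicator 1 (x - t)) := by
  refine (integrable_rho k).mul_bdd (c := 1) ?_ ?_
  · exact ((measurable_one.indicator hE).comp (measurable_const.sub measurable_id)).aestronglyMeasurable
  · exact Eventually.of_forall fun t ↦ abs_indicator_one_le E _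

lemma mollify_mem_Icc (k : ℕ) {E : Set (Eucl d)} (hE : MeasurableSet E) (x : Eucl d) :
    mollify k E x ∈ Icc (0 : ℝ) 1 := by
  rw [mollify_apply]
  constructor
  · refine integral_nonneg fun t ↦ mul_nonneg (rho_nonneg k t) ?_
    exact indicator_nonneg (fun _ _ ↦ zero_le_one) _
  · rw [← integral_rho (d := d) k]
    refine integral_mono (integrable_rho_mul_indicator k hE x) (integrable_rho k) fun t ↦ ?_
    exact mul_le_of_le_one_right (rho_nonneg k t) ((le_abs_self _).trans (abs_indicator_one_le E _))

/-- Lebesgue differentiation; the fixed ratio `rOut = 2 * rIn` keeps the bump averages comparable to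
averages over balls. -/
lemma ae_tendsto_mollify {E : Set (Eucl d)} (hE : MeasurableSet E) :
    ∀ᵐ x, Tendsto (fun k ↦ mollify k E x) atTop (𝓝 (E.indicator 1 x)) := by
  refine ContDiffBump.ae_convolution_tendsto_right_of_locallyIntegrable (φ := mollifier d)
    (K := 2) ?_ ?_ (locallyIntegrable_indicator_one hE)
  · have := tendsto_one_div_add_atTop_nhds_zero_nat (𝕜 := ℝ)
    simpa [mollifier] using this
  · refine Eventually.of_forall fun k ↦ le_of_eq ?_
    simp only [mollifier]
    field_simp

lemma testFields_translate {φ : Eucl d → Eucl d} (hφ : φ ∈ testFields d) (t : Eucl d) :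
    (fun x ↦ φ (x + t)) ∈ testFields d :=
  ⟨hφ.1.comp (contDiff_id.add contDiff_const),
    hφ.2.1.comp_homeomorph (Homeomorph.addRight t), fun _ ↦ hφ.2.2 _⟩

lemma divergence_translate (φ : Eucl d → Eucl d) (t x : Eucl d) :
    divergence (fun x ↦ φ (x + t)) x = divergence φ (x + t) := by
  simp only [divergence, fderiv_comp_add_right]

/-- Mollification does not increase the total variation. -/
lemma tv_mollify_le (k : ℕ) {E : Set (Eucl d)} (hE : MeasurableSet E) :
    tv (mollify k E) ≤ tv (E.indicator 1) := by
  refine tv_le fun φ hφ ↦ ?_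
  by_cases htop : tv (E.indicator 1) = ⊤
  · rw [htop]; exact le_top
  have hdiv := integrable_divergence hφ
  have hint : Integrable (Function.uncurry fun x t ↦
      rho d k t * E.indicator 1 (x - t) * divergence φ x) (volume.prod volume) := by
    have h1 : Integrable (fun p : Eucl d × Eucl d ↦ divergence φ p.1 * rho d k p.2)
        (volume.prod volume) := hdiv.mul_prod (integrable_rho k)
    have h2 := h1.mul_bdd (g := fun p : Eucl d × Eucl d ↦ E.indicator 1 (p.1 - p.2)) (c := 1)
      ((measurable_one.indicator hE).comp
        (measurable_fst.sub measurable_snd)).aestronglyMeasurable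
      (Eventually.of_forall fun t ↦ abs_indicator_one_le E _)
    refine h2.congr (Eventually.of_forall fun p ↦ ?_)
    simp only [Function.uncurry]; ring
  -- By Fubini, pairing the mollification with `φ` averages, with weight `rho`, the pairings of the
  -- indicator with translates of `φ`. Each translate is again a test field.
  have e1 : ∫ x, mollify k E x * divergence φ x =
      ∫ t, rho d k t * ∫ x, E.indicator 1 x * divergence φ (x + t) := by
    calc _ = ∫ x, ∫ t, rho d k t * E.indicator 1 (x - t) * divergence φ x := by
          congr 1 with x; rw [mollify_apply, integral_mul_const]
      _ = ∫ t, ∫ x, rho d k t * E.indicator 1 (x - t) * divergence φ x :=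
          integral_integral_swap hint
      _ = _ := by
          congr 1 with t
          simp only [mul_assoc]
          rw [integral_const_mul]
          congr 1
          rw [← integral_sub_right_eq_self (fun x ↦ E.indicator 1 x * divergence φ (x + t)) t]
          simp
  have hle : ∀ t, ∫ x, E.indicator 1 x * divergence φ (x + t) ≤ (tv (E.indicator 1)).toReal := by
    intro t
    have := le_tv (E.indicator 1) (testFields_translate hφ t)
    simp only [divergence_translate] at this
    exact (ENNReal.ofReal_le_iff_le_toReal htop).1 this
  apply ENNReal.ofReal_le_of_le_toReal
  rw [e1]
  -- If the integrand were not integrable, the Bochner integral would be `0` and the bound would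
  -- still hold.
  by_cases hi : Integrable (fun t ↦ rho d k t * ∫ x, E.indicator 1 x * divergence φ (x + t))
  · calc _ ≤ ∫ t, rho d k t * (tv (E.indicator 1)).toReal :=
          integral_mono hi ((integrable_rho k).mul_const _) fun t ↦
            mul_le_mul_of_nonneg_left (hle t) (rho_nonneg k t)
      _ = _ := by rw [integral_mul_const, integral_rho, one_mul]
  · rw [integral_undef hi]; exact ENNReal.toReal_nonneg

/-- The total variation of a smooth function is the integral of its gradient. -/
lemma lintegral_fderiv_le_tv {f : Eucl d → ℝ} (hf : ContDiff ℝ 2 f) (hc : HasCompactSupport f) :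
    ∫⁻ x, ‖fderiv ℝ f x‖ₑ ≤ tv f := by
  let J := (InnerProductSpace.toDual ℝ (Eucl d)).symm
  let G : Eucl d → Eucl d := fun x ↦ J (fderiv ℝ f x)
  have hG : ContDiff ℝ 1 G := by
    have h1 : ContDiff ℝ 1 (fderiv ℝ f) := hf.fderiv_right (by norm_num)
    exact J.toContinuousLinearEquiv.contDiff.comp h1
  have hGn : ∀ x, ‖G x‖ = ‖fderiv ℝ f x‖ := fun x ↦ J.norm_map _
  have hGf : ∀ x, fderiv ℝ f x (G x) = ‖G x‖ ^ 2 := fun x ↦ by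
    have : fderiv ℝ f x (G x) = inner ℝ (G x) (G x) :=
      (InnerProductSpace.toDual_symm_apply (x := G x) (y := fderiv ℝ f x)).symm
    rw [this, real_inner_self_eq_norm_sq]
  have hGc : HasCompactSupport G := (hc.fderiv ℝ).comp_left (g := J) (map_zero J)
  obtain ⟨L, hL⟩ := hf.lipschitzWith_of_hasCompactSupport hc (by norm_num)
  let e : ℕ → ℝ := fun n ↦ 1 / ((n : ℝ) + 1)
  have he : ∀ n, 0 < e n := fun n ↦ by positivity
  have hes : Tendsto e atTop (𝓝 0) := tendsto_one_div_add_atTop_nhds_zero_nat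
  -- The optimal field `-∇f / |∇f|` is singular at critical points. Replacing `|∇f|` by `√(|∇f|² +
  -- e²)` gives an admissible `C¹` field, and Fatou's lemma recovers `∫ |∇f|` as `e → 0`.
  let s : ℕ → Eucl d → ℝ := fun n x ↦ (Real.sqrt (‖G x‖ ^ 2 + e n ^ 2))⁻¹
  have hpos : ∀ n x, 0 < ‖G x‖ ^ 2 + e n ^ 2 := fun n x ↦ by have := he n; positivity
  let φ : ℕ → Eucl d → Eucl d := fun n x ↦ -(s n x • G x)
  have hφ : ∀ n, φ n ∈ testFields d := by
    intro n
    refine ⟨?_, ?_, ?_⟩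
    · have h1 : ContDiff ℝ 1 (fun x ↦ ‖G x‖ ^ 2 + e n ^ 2) := (hG.norm_sq ℝ).add contDiff_const
      exact (((h1.sqrt fun x ↦ (hpos n x).ne').inv
        fun x ↦ (Real.sqrt_pos.2 (hpos n x)).ne').smul hG).neg
    · exact hGc.mono fun x hx h ↦ hx (by simp [φ, h])
    · intro x
      rw [norm_neg, norm_smul, Real.norm_of_nonneg (inv_nonneg.2 (Real.sqrt_nonneg _)),
        inv_mul_le_iff₀ (Real.sqrt_pos.2 (hpos n x)), mul_one]
      apply Real.le_sqrt_of_sq_le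
      have := sq_nonneg (e n)
      linarith
  have hval : ∀ n, ∫ x, f x * divergence (φ n) x = ∫ x, s n x * ‖G x‖ ^ 2 := by
    intro n
    rw [integral_mul_divergence_of_lipschitz hL (hφ n), ← integral_neg]
    congr 1 with x
    simp only [φ, map_neg, map_smul, hGf, smul_eq_mul, neg_neg]
  have hcont : ∀ n, Continuous (fun x ↦ s n x * ‖G x‖ ^ 2) := fun n ↦ by
    have := hG.continuous
    refine Continuous.mul (Continuous.inv₀ (by fun_prop) fun x ↦ (Real.sqrt_pos.2 (hpos n x)).ne')
      (by fun_prop)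
  have hnn : ∀ n x, 0 ≤ s n x * ‖G x‖ ^ 2 := fun n x ↦
    mul_nonneg (inv_nonneg.2 (Real.sqrt_nonneg _)) (sq_nonneg _)
  have hint : ∀ n, Integrable (fun x ↦ s n x * ‖G x‖ ^ 2) := fun n ↦
    (hcont n).integrable_of_hasCompactSupport
      (hGc.mono fun x hx h ↦ hx (by simp [h]))
  have hlim : ∀ x, Tendsto (fun n ↦ ENNReal.ofReal (s n x * ‖G x‖ ^ 2)) atTop
      (𝓝 ‖fderiv ℝ f x‖ₑ) := by
    intro x
    rw [← ofReal_norm, ← hGn]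
    refine (ENNReal.continuous_ofReal.tendsto _).comp ?_
    by_cases h0 : ‖G x‖ = 0
    · simp [h0]
    have h1 : Tendsto (fun n ↦ Real.sqrt (‖G x‖ ^ 2 + e n ^ 2)) atTop (𝓝 ‖G x‖) := by
      have : Tendsto (fun n ↦ Real.sqrt (‖G x‖ ^ 2 + e n ^ 2)) atTop
          (𝓝 (Real.sqrt (‖G x‖ ^ 2 + 0 ^ 2))) :=
        (Real.continuous_sqrt.tendsto _).comp (tendsto_const_nhds.add (hes.pow 2))
      simpa using this
    have h2 := (h1.inv₀ h0).mul_const (‖G x‖ ^ 2)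
    have h3 : ‖G x‖⁻¹ * ‖G x‖ ^ 2 = ‖G x‖ := by field_simp
    rwa [h3] at h2
  calc ∫⁻ x, ‖fderiv ℝ f x‖ₑ = ∫⁻ x, liminf (fun n ↦ ENNReal.ofReal (s n x * ‖G x‖ ^ 2)) atTop := by
        congr 1 with x; rw [(hlim x).liminf_eq]
    _ ≤ liminf (fun n ↦ ∫⁻ x, ENNReal.ofReal (s n x * ‖G x‖ ^ 2)) atTop :=
        lintegral_liminf_le fun n ↦ (hcont n).measurable.ennreal_ofReal
    _ ≤ liminf (fun _ ↦ tv f) (atTop : Filter ℕ) := by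
        refine liminf_le_liminf (Eventually.of_forall fun n ↦ ?_)
        rw [← ofReal_integral_eq_lintegral_ofReal (hint n) (Eventually.of_forall (hnn n)),
          ← hval n]
        exact le_tv _ (hφ n)
    _ = tv f := by simp

lemma lintegral_fderiv_mollify_le (k : ℕ) {E : Set (Eucl d)} (hE : MeasurableSet E)
    (hb : Bornology.IsBounded E) : ∫⁻ x, ‖fderiv ℝ (mollify k E) x‖ₑ ≤ tv (E.indicator 1) :=
  (lintegral_fderiv_le_tv (contDiff_mollify k hE (n := 2)) (hasCompactSupport_mollify k hb)).trans
    (tv_mollify_le k hE)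

/-- One half of the coarea formula: some superlevel set at a height in `(a, b)` has perimeter at
most the average. -/
lemma exists_tv_superlevel_le {u : Eucl d → ℝ} (hu : ContDiff ℝ 1 u) (hc : HasCompactSupport u)
    {a b : ℝ} (hab : a < b) :
    ∃ t ∈ Ioo a b, ENNReal.ofReal (b - a) * tv ({x | t < u x}.indicator 1) ≤
      ∫⁻ x, ‖fderiv ℝ u x‖ₑ := by
  obtain ⟨L, hL⟩ := hu.lipschitzWith_of_hasCompactSupport hc (by norm_num)
  have hucont := hu.continuous
  have hdu : Continuous fun x ↦ ‖fderiv ℝ u x‖ₑ := (hu.continuous_fderiv (by norm_num)).enorm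
  -- `q n t` is `n + 1` times the integral of `|∇u|` over the layer `t < u < t + 1 / (n + 1)`. Each
  -- `x` belongs to the layer for an interval of levels of length `1 / (n + 1)`, so integrating over
  -- `t` returns exactly `∫ |∇u|`. Ramps across the layer show that the lower limit of `q n t`
  -- bounds the perimeter of `{u > t}`.
  let S : ℕ → ℝ → Set (Eucl d) := fun n t ↦ {x | t < u x ∧ u x < t + 1 / ((n : ℝ) + 1)}
  let q : ℕ → ℝ → ℝ≥0∞ := fun n t ↦ ∫⁻ x, (S n t).indicator (fun x ↦ ENNReal.ofReal (n + 1) * ‖fderiv ℝ u x‖ₑ) x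
  have hmeas : ∀ n, Measurable (Function.uncurry fun t x ↦
      (S n t).indicator (fun x ↦ ENNReal.ofReal (n + 1) * ‖fderiv ℝ u x‖ₑ) x) := by
    intro n
    have h1 : MeasurableSet {p : ℝ × Eucl d | p.1 < u p.2 ∧ u p.2 < p.1 + 1 / ((n : ℝ) + 1)} := by
      have hu2 : Continuous fun p : ℝ × Eucl d ↦ u p.2 := hucont.comp continuous_snd
      exact (IsOpen.inter (isOpen_lt continuous_fst hu2)
        (isOpen_lt hu2 (continuous_fst.add continuous_const))).measurableSet
    have h2 : Measurable fun p : ℝ × Eucl d ↦ ENNReal.ofReal (n + 1) * ‖fderiv ℝ u p.2‖ₑ :=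
      (hdu.comp continuous_snd).measurable.const_mul _
    exact h2.indicator h1
  have hq : ∀ n, Measurable (q n) := fun n ↦ (hmeas n).lintegral_prod_right'
  have hqint : ∀ n, ∫⁻ t, q n t = ∫⁻ x, ‖fderiv ℝ u x‖ₑ := by
    intro n
    simp only [q]
    rw [lintegral_lintegral_swap (hmeas n).aemeasurable]
    congr 1 with x
    have : ∀ t, (S n t).indicator (fun x ↦ ENNReal.ofReal (n + 1) * ‖fderiv ℝ u x‖ₑ) x =
        (Ioo (u x - 1 / ((n : ℝ) + 1)) (u x)).indicator
          (fun _ ↦ ENNReal.ofReal (n + 1) * ‖fderiv ℝ u x‖ₑ) t := by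
      intro t
      have : x ∈ S n t ↔ t ∈ Ioo (u x - 1 / ((n : ℝ) + 1)) (u x) := by
        simp only [S, mem_ofPred_eq, mem_Ioo, sub_lt_iff_lt_add]; exact and_comm
      by_cases h : x ∈ S n t
      · rw [indicator_of_mem h, indicator_of_mem (this.1 h)]
      · rw [indicator_of_notMem h, indicator_of_notMem (fun h' ↦ h (this.2 h'))]
    simp only [this]
    rw [lintegral_indicator_const measurableSet_Ioo, Real.volume_Ioo, sub_sub_cancel,
      mul_right_comm, ← ENNReal.ofReal_mul (by positivity), mul_one_div_cancel (by positivity)]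
    simp
  have hle : ∀ t, tv ({x | t < u x}.indicator 1) ≤ liminf (fun n ↦ q n t) atTop := by
    intro t
    let g : ℕ → Eucl d → ℝ := fun n x ↦ max 0 (min 1 (((n : ℝ) + 1) * (u x - t)))
    have hg01 : ∀ n x, g n x ∈ Icc (0 : ℝ) 1 := fun n x ↦
      ⟨le_max_left _ _, max_le zero_le_one (min_le_left _ _)⟩
    have hLip : ∀ n, ∃ L', LipschitzWith L' (g n) := by
      intro n
      have h1 : LipschitzWith (Real.toNNReal (n + 1) * L) (fun x ↦ ((n : ℝ) + 1) * (u x - t)) := by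
        refine LipschitzWith.of_dist_le_mul fun x y ↦ ?_
        rw [NNReal.coe_mul, Real.coe_toNNReal _ (by positivity), Real.dist_eq, ← mul_sub, abs_mul,
          abs_of_pos (by positivity), sub_sub_sub_cancel_right, ← Real.dist_eq, mul_assoc]
        gcongr
        exact hL.dist_le_mul x y
      exact ⟨_, (h1.const_min 1).const_max 0⟩
    refine (tv_le_liminf (g := g) ?_ ?_ ?_).trans (liminf_le_liminf (Eventually.of_forall fun n ↦ ?_))
    · exact fun n ↦ (hLip n).choose_spec.continuous.aestronglyMeasurable
    · intro n x; rw [abs_of_nonneg (hg01 n x).1]; exact (hg01 n x).2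
    · refine Eventually.of_forall fun x ↦ ?_
      by_cases hx : t < u x
      · have h1 : Tendsto (fun n : ℕ ↦ ((n : ℝ) + 1) * (u x - t)) atTop atTop :=
          (tendsto_natCast_atTop_atTop.atTop_add tendsto_const_nhds).atTop_mul_const (sub_pos.2 hx)
        apply tendsto_const_nhds.congr'
        filter_upwards [h1.eventually_ge_atTop 1] with n hn
        simp [g, hx, min_eq_left hn]
      · have h1 : ∀ n : ℕ, ((n : ℝ) + 1) * (u x - t) ≤ 0 := fun n ↦
          mul_nonpos_of_nonneg_of_nonpos (by positivity) (by linarith)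
        have : ∀ n, g n x = 0 := fun n ↦ max_eq_left ((min_le_right _ _).trans (h1 n))
        simp [this, hx]
    · obtain ⟨L', hL'⟩ := hLip n
      refine (tv_le_of_lipschitz_unit hL' (hg01 n)).trans ?_
      have hopen : IsOpen {x | g n x ∈ Ioo (0 : ℝ) 1} := isOpen_Ioo.preimage hL'.continuous
      rw [← lintegral_indicator hopen.measurableSet]
      refine lintegral_mono fun x ↦ ?_
      by_cases hx : x ∈ {x | g n x ∈ Ioo (0 : ℝ) 1}
      · have key : ∀ y, g n y ∈ Ioo (0 : ℝ) 1 → g n y = ((n : ℝ) + 1) * (u y - t) := by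
          intro y hy
          simp only [g, mem_Ioo, lt_max_iff, lt_irrefl, false_or, max_lt_iff, zero_lt_one, true_and,
            min_lt_iff] at hy ⊢
          rw [min_eq_right hy.2.le, max_eq_right]
          exact (lt_min_iff.1 hy.1).2.le
        have hxS : x ∈ S n t := by
          have h1 := key x hx
          have h2 : g n x ∈ Ioo (0 : ℝ) 1 := hx
          rw [h1] at h2
          have hn : (0 : ℝ) < (n : ℝ) + 1 := by positivity
          refine ⟨by have := pos_of_mul_pos_right h2.1 hn.le; linarith, ?_⟩
          have := h2.2
          rw [← lt_div_iff₀' hn] at this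
          linarith
        rw [indicator_of_mem hx, indicator_of_mem hxS]
        have : g n =ᶠ[𝓝 x] fun y ↦ ((n : ℝ) + 1) * (u y - t) := by
          filter_upwards [hopen.mem_nhds hx] with y hy using key y hy
        rw [this.fderiv_eq, fderiv_const_mul ((hu.differentiable (by norm_num) x).sub_const t),
          fderiv_sub_const, enorm_smul, Real.enorm_of_nonneg (by positivity)]
      · rw [indicator_of_notMem hx]; exact zero_le
  have htot : ∫⁻ t in Ioo a b, liminf (fun n ↦ q n t) atTop ≤ ∫⁻ x, ‖fderiv ℝ u x‖ₑ :=
    calc _ ≤ ∫⁻ t, liminf (fun n ↦ q n t) atTop := setLIntegral_le_lintegral _ _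
      _ ≤ liminf (fun n ↦ ∫⁻ t, q n t) atTop := lintegral_liminf_le hq
      _ = _ := by simp [hqint]
  have hfin : ∫⁻ x, ‖fderiv ℝ u x‖ₑ ≠ ⊤ :=
    ((hu.continuous_fderiv (by norm_num)).integrable_of_hasCompactSupport
      (hc.fderiv ℝ)).hasFiniteIntegral.ne
  obtain ⟨t, ht, htle⟩ := exists_le_setLAverage (μ := volume) (s := Ioo a b)
    (f := fun t ↦ liminf (fun n ↦ q n t) atTop) (by simpa using hab) (by simp)
    (Measurable.liminf hq).aemeasurable
  refine ⟨t, ht, ?_⟩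
  rw [setLAverage_eq, Real.volume_Ioo] at htle
  have hba : ENNReal.ofReal (b - a) ≠ 0 := by simpa using hab
  calc _ ≤ ENNReal.ofReal (b - a) * ((∫⁻ t in Ioo a b, liminf (fun n ↦ q n t) atTop) /
        ENNReal.ofReal (b - a)) := by gcongr; exact (hle t).trans htle
    _ = ∫⁻ t in Ioo a b, liminf (fun n ↦ q n t) atTop :=
        ENNReal.mul_div_cancel hba ENNReal.ofReal_ne_top
    _ ≤ _ := htot

/-! ### Perimeter of intersections, unions and differences. -/

section SetOperations

variable {u v : Eucl d → ℝ}

lemma enorm_add_smul_le {p q : ℝ} (hp : 0 ≤ p) (hq : 0 ≤ q) (a b : Eucl d →L[ℝ] ℝ) :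
    ‖p • a + q • b‖ₑ ≤ ENNReal.ofReal p * ‖a‖ₑ + ENNReal.ofReal q * ‖b‖ₑ := by
  refine (enorm_add_le (p • a) (q • b)).trans ?_
  simp only [enorm_smul, Real.enorm_of_nonneg hp, Real.enorm_of_nonneg hq, le_refl]

lemma fderiv_mul_enorm_le (hu : Differentiable ℝ u) (hv : Differentiable ℝ v)
    (hu0 : ∀ x, 0 ≤ u x) (hv0 : ∀ x, 0 ≤ v x) (x : Eucl d) :
    ‖fderiv ℝ (fun x ↦ u x * v x) x‖ₑ ≤
      ENNReal.ofReal (u x) * ‖fderiv ℝ v x‖ₑ + ENNReal.ofReal (v x) * ‖fderiv ℝ u x‖ₑ := by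
  rw [show fderiv ℝ (fun x ↦ u x * v x) x = u x • fderiv ℝ v x + v x • fderiv ℝ u x from
    fderiv_mul (hu x) (hv x)]
  exact enorm_add_smul_le (hu0 x) (hv0 x) _ _

lemma ofReal_mul_add_one_sub {p : ℝ} (hp : p ∈ Icc (0 : ℝ) 1) (a : ℝ≥0∞) :
    ENNReal.ofReal p * a + ENNReal.ofReal (1 - p) * a = a := by
  rw [← add_mul, ← ENNReal.ofReal_add hp.1 (by linarith [hp.2])]
  simp

/-- Submodularity of the perimeter. -/
lemma tv_inter_add_tv_union_le {A B : Set (Eucl d)} (hA : MeasurableSet A) (hB : MeasurableSet B)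
    (hAb : Bornology.IsBounded A) (hBb : Bornology.IsBounded B) :
    tv ((A ∩ B).indicator 1) + tv ((A ∪ B).indicator 1) ≤
      tv (A.indicator 1) + tv (B.indicator 1) := by
  -- The products `uv` and `u + v - uv` are smooth substitutes for `min` and `max`. Their gradients
  -- are at most `u|∇v| + v|∇u|` and `(1 - u)|∇v| + (1 - v)|∇u|`, and these bounds add up exactly to
  -- `|∇u| + |∇v|`.
  let u := fun k ↦ mollify k A
  let v := fun k ↦ mollify k B
  have hu01 : ∀ k x, u k x ∈ Icc (0 : ℝ) 1 := fun k ↦ mollify_mem_Icc k hA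
  have hv01 : ∀ k x, v k x ∈ Icc (0 : ℝ) 1 := fun k ↦ mollify_mem_Icc k hB
  have hu : ∀ k, ContDiff ℝ 1 (u k) := fun k ↦ contDiff_mollify k hA (n := 1)
  have hv : ∀ k, ContDiff ℝ 1 (v k) := fun k ↦ contDiff_mollify k hB (n := 1)
  have huc : ∀ k, HasCompactSupport (u k) := fun k ↦ hasCompactSupport_mollify k hAb
  have hvc : ∀ k, HasCompactSupport (v k) := fun k ↦ hasCompactSupport_mollify k hBb
  have hud : ∀ k, Differentiable ℝ (u k) := fun k ↦ (hu k).differentiable (by norm_num)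
  have hvd : ∀ k, Differentiable ℝ (v k) := fun k ↦ (hv k).differentiable (by norm_num)
  have hi : tv ((A ∩ B).indicator 1) ≤ liminf (fun k ↦ tv (fun x ↦ u k x * v k x)) atTop := by
    refine tv_le_liminf (fun k ↦ ((hu k).continuous.mul (hv k).continuous).aestronglyMeasurable)
      (fun k x ↦ ?_) ?_
    · rw [abs_of_nonneg (mul_nonneg (hu01 k x).1 (hv01 k x).1)]
      exact mul_le_one₀ (hu01 k x).2 (hv01 k x).1 (hv01 k x).2
    · filter_upwards [ae_tendsto_mollify hA, ae_tendsto_mollify hB] with x h1 h2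
      have h3 := h1.mul h2
      rwa [show (A.indicator 1 x * B.indicator 1 x : ℝ) = (A ∩ B).indicator 1 x by
        by_cases ha : x ∈ A <;> by_cases hb : x ∈ B <;> simp [ha, hb]] at h3
  have ht : tv ((A ∪ B).indicator 1) ≤
      liminf (fun k ↦ tv (fun x ↦ u k x + v k x - u k x * v k x)) atTop := by
    refine tv_le_liminf (fun k ↦ (((hu k).continuous.add (hv k).continuous).sub
      ((hu k).continuous.mul (hv k).continuous)).aestronglyMeasurable) (fun k x ↦ ?_) ?_
    · have h1 := hu01 k x
      have h2 := hv01 k x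
      have h3 := mul_nonneg (sub_nonneg.2 h1.2) (sub_nonneg.2 h2.2)
      have h4 := mul_nonneg h1.1 (sub_nonneg.2 h2.2)
      rw [abs_le]
      constructor <;> nlinarith [h1.1, h2.1, h1.2, h2.2]
    · filter_upwards [ae_tendsto_mollify hA, ae_tendsto_mollify hB] with x h1 h2
      have h3 := (h1.add h2).sub (h1.mul h2)
      rwa [show (A.indicator 1 x + B.indicator 1 x - A.indicator 1 x * B.indicator 1 x : ℝ) =
        (A ∪ B).indicator 1 x by
        by_cases ha : x ∈ A <;> by_cases hb : x ∈ B <;> simp [ha, hb]] at h3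
  refine (add_le_add hi ht).trans (liminf_add_liminf_le_of_le fun k ↦ ?_)
  have hcd1 : ContDiff ℝ 1 (fun x ↦ u k x * v k x) := (hu k).mul (hv k)
  have hcd2 : ContDiff ℝ 1 (fun x ↦ u k x + v k x - u k x * v k x) :=
    ((hu k).add (hv k)).sub hcd1
  have hcs1 : HasCompactSupport (fun x ↦ u k x * v k x) := (huc k).mul_right
  have hcs2 : HasCompactSupport (fun x ↦ u k x + v k x - u k x * v k x) :=
    ((huc k).add (hvc k)).sub hcs1
  obtain ⟨L1, hL1⟩ := hcd1.lipschitzWith_of_hasCompactSupport hcs1 (by norm_num)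
  obtain ⟨L2, hL2⟩ := hcd2.lipschitzWith_of_hasCompactSupport hcs2 (by norm_num)
  have hmu : Measurable fun x ↦ ‖fderiv ℝ (u k) x‖ₑ :=
    ((hu k).continuous_fderiv (by norm_num)).enorm.measurable
  calc _ ≤ (∫⁻ x, ‖fderiv ℝ (fun x ↦ u k x * v k x) x‖ₑ) +
        ∫⁻ x, ‖fderiv ℝ (fun x ↦ u k x + v k x - u k x * v k x) x‖ₑ :=
        add_le_add (tv_le_lintegral_fderiv hL1) (tv_le_lintegral_fderiv hL2)
    _ = ∫⁻ x, (‖fderiv ℝ (fun x ↦ u k x * v k x) x‖ₑ +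
          ‖fderiv ℝ (fun x ↦ u k x + v k x - u k x * v k x) x‖ₑ) :=
        (lintegral_add_left (hcd1.continuous_fderiv (by norm_num)).enorm.measurable _).symm
    _ ≤ ∫⁻ x, (‖fderiv ℝ (u k) x‖ₑ + ‖fderiv ℝ (v k) x‖ₑ) := by
        refine lintegral_mono fun x ↦ ?_
        have e2 : fderiv ℝ (fun x ↦ u k x + v k x - u k x * v k x) x =
            (1 - u k x) • fderiv ℝ (v k) x + (1 - v k x) • fderiv ℝ (u k) x := by
          have h1 : fderiv ℝ (fun x ↦ u k x + v k x - u k x * v k x) x =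
              (fderiv ℝ (u k) x + fderiv ℝ (v k) x) -
                (u k x • fderiv ℝ (v k) x + v k x • fderiv ℝ (u k) x) :=
            (((hud k x).hasFDerivAt.add (hvd k x).hasFDerivAt).sub
              ((hud k x).hasFDerivAt.mul (hvd k x).hasFDerivAt)).fderiv
          rw [h1]; module
        rw [e2]
        refine (add_le_add (fderiv_mul_enorm_le (hud k) (hvd k) (fun x ↦ (hu01 k x).1)
          (fun x ↦ (hv01 k x).1) x) (enorm_add_smul_le (sub_nonneg.2 (hu01 k x).2)
            (sub_nonneg.2 (hv01 k x).2) _ _)).trans (le_of_eq ?_)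
        rw [add_add_add_comm, ofReal_mul_add_one_sub (hu01 k x), ofReal_mul_add_one_sub (hv01 k x),
          add_comm]
    _ = _ := lintegral_add_left hmu _
    _ ≤ _ := add_le_add (lintegral_fderiv_mollify_le k hA hAb)
        (lintegral_fderiv_mollify_le k hB hBb)

lemma tv_union_le {A B : Set (Eucl d)} (hA : MeasurableSet A) (hB : MeasurableSet B)
    (hAb : Bornology.IsBounded A) (hBb : Bornology.IsBounded B) :
    tv ((A ∪ B).indicator 1) ≤ tv (A.indicator 1) + tv (B.indicator 1) :=
  le_add_self.trans (tv_inter_add_tv_union_le hA hB hAb hBb)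

/-- Pass through `u (1 - v)` for the mollified indicators; its gradient is at most `|∇u| + |∇v|`
because both factors lie in `[0, 1]`. -/
lemma tv_diff_le {A B : Set (Eucl d)} (hA : MeasurableSet A) (hB : MeasurableSet B)
    (hAb : Bornology.IsBounded A) (hBb : Bornology.IsBounded B) :
    tv ((A \ B).indicator 1) ≤ tv (A.indicator 1) + tv (B.indicator 1) := by
  let u := fun k ↦ mollify k A
  let v := fun k ↦ mollify k B
  have hu01 : ∀ k x, u k x ∈ Icc (0 : ℝ) 1 := fun k ↦ mollify_mem_Icc k hA
  have hv01 : ∀ k x, v k x ∈ Icc (0 : ℝ) 1 := fun k ↦ mollify_mem_Icc k hB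
  have hu : ∀ k, ContDiff ℝ 1 (u k) := fun k ↦ contDiff_mollify k hA (n := 1)
  have hv : ∀ k, ContDiff ℝ 1 (v k) := fun k ↦ contDiff_mollify k hB (n := 1)
  have huc : ∀ k, HasCompactSupport (u k) := fun k ↦ hasCompactSupport_mollify k hAb
  have hi : tv ((A \ B).indicator 1) ≤
      liminf (fun k ↦ tv (fun x ↦ u k x * (1 - v k x))) atTop := by
    refine tv_le_liminf (fun k ↦ ((hu k).continuous.mul
      (continuous_const.sub (hv k).continuous)).aestronglyMeasurable) (fun k x ↦ ?_) ?_
    · have h1 : 0 ≤ 1 - v k x := sub_nonneg.2 (hv01 k x).2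
      rw [abs_of_nonneg (mul_nonneg (hu01 k x).1 h1)]
      exact mul_le_one₀ (hu01 k x).2 h1 (by linarith [(hv01 k x).1])
    · filter_upwards [ae_tendsto_mollify hA, ae_tendsto_mollify hB] with x h1 h2
      have h3 := h1.mul (h2.const_sub 1)
      rwa [show (A.indicator 1 x * (1 - B.indicator 1 x) : ℝ) = (A \ B).indicator 1 x by
        by_cases ha : x ∈ A <;> by_cases hb : x ∈ B <;> simp [ha, hb]] at h3
  refine hi.trans ?_
  refine (liminf_le_liminf (v := fun _ ↦ tv (A.indicator 1) + tv (B.indicator 1))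
    (Eventually.of_forall fun k ↦ ?_)).trans (by simp)
  have hcd : ContDiff ℝ 1 (fun x ↦ 1 - v k x) := contDiff_const.sub (hv k)
  have hcd1 : ContDiff ℝ 1 (fun x ↦ u k x * (1 - v k x)) := (hu k).mul hcd
  obtain ⟨L1, hL1⟩ := hcd1.lipschitzWith_of_hasCompactSupport ((huc k).mul_right) (by norm_num)
  have hmu : Measurable fun x ↦ ‖fderiv ℝ (u k) x‖ₑ :=
    ((hu k).continuous_fderiv (by norm_num)).enorm.measurable
  calc _ ≤ ∫⁻ x, ‖fderiv ℝ (fun x ↦ u k x * (1 - v k x)) x‖ₑ := tv_le_lintegral_fderiv hL1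
    _ ≤ ∫⁻ x, (‖fderiv ℝ (u k) x‖ₑ + ‖fderiv ℝ (v k) x‖ₑ) := by
        refine lintegral_mono fun x ↦ ?_
        refine (fderiv_mul_enorm_le ((hu k).differentiable (by norm_num))
          (hcd.differentiable (by norm_num)) (fun x ↦ (hu01 k x).1)
          (fun x ↦ sub_nonneg.2 (hv01 k x).2) x).trans ?_
        have h1 : ‖fderiv ℝ (fun x ↦ 1 - v k x) x‖ₑ = ‖fderiv ℝ (v k) x‖ₑ := by
          rw [fderiv_const_sub, ← ofReal_norm, norm_neg, ofReal_norm]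
        rw [h1, add_comm]
        refine add_le_add ?_ ?_
        · refine mul_le_of_le_one_left zero_le ?_
          exact ENNReal.ofReal_le_one.2 (by linarith [(hv01 k x).1])
        · refine mul_le_of_le_one_left zero_le ?_
          exact ENNReal.ofReal_le_one.2 (hu01 k x).2
    _ = _ := lintegral_add_left hmu _
    _ ≤ _ := add_le_add (lintegral_fderiv_mollify_le k hA hAb)
        (lintegral_fderiv_mollify_le k hB hBb)

end SetOperations

end ChargedDrop

/-! ### Compactness of sets of bounded perimeter. -/

namespace ChargedDrop
open Filter Topology
open scoped ENNReal NNReal Convolution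

variable {d : ℕ}

lemma lintegral_enorm_indicator_sub {A B : Set (Eucl d)} (hA : MeasurableSet A)
    (hB : MeasurableSet B) :
    ∫⁻ x, ‖A.indicator (1 : Eucl d → ℝ) x - B.indicator 1 x‖ₑ = volume (symmDiff A B) := by
  rw [← lintegral_indicator_one (hA.symmDiff hB)]
  congr 1 with x
  by_cases h1 : x ∈ A <;> by_cases h2 : x ∈ B <;> simp [h1, h2, Set.mem_symmDiff]

/-- Integrate the derivative along the segment from `x` to `x + h`, then use Fubini and translation
invariance. -/
lemma lintegral_translate_sub_le_of_contDiff {u : Eucl d → ℝ} (hu : ContDiff ℝ 1 u) (h : Eucl d) :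
    ∫⁻ x, ‖u (x + h) - u x‖ₑ ≤ ‖h‖ₑ * ∫⁻ x, ‖fderiv ℝ u x‖ₑ := by
  have hdu := hu.continuous_fderiv (by norm_num)
  have hmeas : Measurable (Function.uncurry fun (x : Eucl d) (s : ℝ) ↦
      ‖fderiv ℝ u (x + s • h)‖ₑ * ‖h‖ₑ) := by
    have : Continuous fun p : Eucl d × ℝ ↦ fderiv ℝ u (p.1 + p.2 • h) :=
      hdu.comp (by fun_prop)
    exact this.enorm.measurable.mul_const _
  calc ∫⁻ x, ‖u (x + h) - u x‖ₑ
      ≤ ∫⁻ x, ∫⁻ s in Ioc (0 : ℝ) 1, ‖fderiv ℝ u (x + s • h)‖ₑ * ‖h‖ₑ := by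
        refine lintegral_mono fun x ↦ ?_
        have hd : ∀ s ∈ uIcc (0 : ℝ) 1,
            HasDerivAt (fun s : ℝ ↦ u (x + s • h)) (fderiv ℝ u (x + s • h) h) s := by
          intro s _
          have h1 : HasDerivAt (fun s : ℝ ↦ x + s • h) h s := by
            simpa using ((hasDerivAt_id s).smul_const h).const_add x
          exact (hu.differentiable (by norm_num) _).hasFDerivAt.comp_hasDerivAt s h1
        have hcont : Continuous fun s : ℝ ↦ fderiv ℝ u (x + s • h) h :=
          (hdu.comp (by fun_prop)).clm_apply continuous_const
        have hftc := intervalIntegral.integral_eq_sub_of_hasDerivAt hd (hcont.intervalIntegrable _ _)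
        simp only [one_smul, zero_smul, add_zero] at hftc
        rw [← hftc, intervalIntegral.integral_of_le zero_le_one]
        refine (enorm_integral_le_lintegral_enorm _).trans (lintegral_mono fun s ↦ ?_)
        rw [← ofReal_norm, ← ofReal_norm, ← ofReal_norm, ← ENNReal.ofReal_mul (norm_nonneg _)]
        exact ENNReal.ofReal_le_ofReal ((fderiv ℝ u (x + s • h)).le_opNorm h)
    _ = ∫⁻ s in Ioc (0 : ℝ) 1, ∫⁻ x, ‖fderiv ℝ u (x + s • h)‖ₑ * ‖h‖ₑ :=
        lintegral_lintegral_swap hmeas.aemeasurable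
    _ = ∫⁻ s in Ioc (0 : ℝ) 1, (∫⁻ x, ‖fderiv ℝ u x‖ₑ) * ‖h‖ₑ := by
        congr 1 with s
        have hm : Measurable fun x ↦ ‖fderiv ℝ u (x + s • h)‖ₑ :=
          (hdu.comp (continuous_id.add continuous_const)).enorm.measurable
        rw [lintegral_mul_const _ hm, lintegral_add_right_eq_self (fun x ↦ ‖fderiv ℝ u x‖ₑ)]
    _ = _ := by simp [mul_comm]

/-- The smooth estimate passes to the limit along mollifications by Fatou. This `L¹` modulus of
continuity, controlled by the perimeter, is the source of compactness. -/
lemma lintegral_translate_indicator_sub_le {E : Set (Eucl d)} (hE : MeasurableSet E)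
    (hb : Bornology.IsBounded E) (h : Eucl d) :
    ∫⁻ x, ‖E.indicator (1 : Eucl d → ℝ) (x + h) - E.indicator 1 x‖ₑ ≤
      ‖h‖ₑ * tv (E.indicator 1) := by
  have hlim := ae_tendsto_mollify hE
  have hlim' : ∀ᵐ x, Tendsto (fun k ↦ mollify k E (x + h)) atTop (𝓝 (E.indicator 1 (x + h))) :=
    (quasiMeasurePreserving_add_right volume h).ae hlim
  calc _ = ∫⁻ x, liminf (fun k ↦ ‖mollify k E (x + h) - mollify k E x‖ₑ) atTop := by
        apply lintegral_congr_ae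
        filter_upwards [hlim, hlim'] with x h1 h2
        exact ((h2.sub h1).enorm.liminf_eq).symm
    _ ≤ liminf (fun k ↦ ∫⁻ x, ‖mollify k E (x + h) - mollify k E x‖ₑ) atTop := by
        refine lintegral_liminf_le fun k ↦ ?_
        have := continuous_mollify k hE
        exact (Continuous.sub (by fun_prop) this).enorm.measurable
    _ ≤ liminf (fun _ ↦ ‖h‖ₑ * tv (E.indicator 1)) (atTop : Filter ℕ) := by
        refine liminf_le_liminf (Eventually.of_forall fun k ↦ ?_)
        refine (lintegral_translate_sub_le_of_contDiff (contDiff_mollify k hE (n := 1)) h).trans ?_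
        gcongr
        exact lintegral_fderiv_mollify_le k hE hb
    _ = _ := by simp

/-- The `L¹` distance between a set and its mollification is controlled by the perimeter. -/
lemma lintegral_mollify_sub_le (k : ℕ) {E : Set (Eucl d)} (hE : MeasurableSet E)
    (hb : Bornology.IsBounded E) :
    ∫⁻ x, ‖mollify k E x - E.indicator 1 x‖ₑ ≤
      ENNReal.ofReal ((k : ℝ) + 1)⁻¹ * tv (E.indicator 1) := by
  have hmi : Measurable (E.indicator (1 : Eucl d → ℝ)) := measurable_one.indicator hE
  have hmeas : Measurable (Function.uncurry fun (x t : Eucl d) ↦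
      ‖rho d k t * (E.indicator 1 (x - t) - E.indicator 1 x)‖ₑ) := by
    have h1 : Measurable fun p : Eucl d × Eucl d ↦ rho d k p.2 :=
      ((continuous_rho k).comp continuous_snd).measurable
    have h2 : Measurable fun p : Eucl d × Eucl d ↦ E.indicator (1 : Eucl d → ℝ) (p.1 - p.2) :=
      hmi.comp (measurable_fst.sub measurable_snd)
    exact (h1.mul (h2.sub (hmi.comp measurable_fst))).enorm
  calc _ ≤ ∫⁻ x, ∫⁻ t, ‖rho d k t * (E.indicator 1 (x - t) - E.indicator 1 x)‖ₑ := by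
        refine lintegral_mono fun x ↦ ?_
        have : mollify k E x - E.indicator 1 x =
            ∫ t, rho d k t * (E.indicator 1 (x - t) - E.indicator 1 x) := by
          simp only [mul_sub]
          rw [integral_sub (integrable_rho_mul_indicator k hE x) ((integrable_rho k).mul_const _),
            integral_mul_const, integral_rho, one_mul, mollify_apply]
        rw [this]
        exact enorm_integral_le_lintegral_enorm _
    _ = ∫⁻ t, ∫⁻ x, ‖rho d k t * (E.indicator 1 (x - t) - E.indicator 1 x)‖ₑ :=
        lintegral_lintegral_swap hmeas.aemeasurable
    _ ≤ ∫⁻ t, ENNReal.ofReal (rho d k t) *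
          (ENNReal.ofReal ((k : ℝ) + 1)⁻¹ * tv (E.indicator 1)) := by
        refine lintegral_mono fun t ↦ ?_
        simp only [enorm_mul, Real.enorm_of_nonneg (rho_nonneg k t)]
        have hm : Measurable fun x ↦
            ‖E.indicator (1 : Eucl d → ℝ) (x - t) - E.indicator 1 x‖ₑ :=
          ((hmi.comp (measurable_id.sub_const t)).sub hmi).enorm
        rw [lintegral_const_mul _ hm]
        by_cases h0 : rho d k t = 0
        · simp [h0]
        gcongr
        have := lintegral_translate_indicator_sub_le hE hb (-t)
        simp only [← sub_eq_add_neg] at this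
        refine this.trans ?_
        gcongr
        rw [← ofReal_norm, norm_neg]
        exact ENNReal.ofReal_le_ofReal (norm_lt_of_rho_ne_zero h0).le
    _ = _ := by
        rw [lintegral_mul_const _ (continuous_rho k).measurable.ennreal_ofReal, lintegral_rho,
          one_mul]

/-- Pointwise Arzelà–Ascoli: a countable family of equi-Lipschitz, pointwise bounded sequences
of functions has a common pointwise convergent subsequence, with Lipschitz limits. -/
lemma exists_subseq_tendsto_of_lipschitz {X ι : Type*} [PseudoMetricSpace X]
    [TopologicalSpace.SeparableSpace X] [Nonempty X] [Countable ι] (f : ℕ → ι → X → ℝ)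
    (L : ι → ℝ≥0) (hL : ∀ n i, LipschitzWith (L i) (f n i))
    (hb : ∀ i x, ∃ M, ∀ n, |f n i x| ≤ M) :
    ∃ φ : ℕ → ℕ, StrictMono φ ∧ ∃ g : ι → X → ℝ, (∀ i, LipschitzWith (L i) (g i)) ∧
      ∀ i x, Tendsto (fun n ↦ f (φ n) i x) atTop (𝓝 (g i x)) := by
  choose M hM using hb
  let q := TopologicalSpace.denseSeq X
  -- Compactness of a countable product of intervals, indexed by the family and a dense sequence of
  -- points, takes the place of a diagonal extraction.
  have hcomp : IsCompact (univ.pi fun p : ι × ℕ ↦ Icc (-M p.1 (q p.2)) (M p.1 (q p.2))) :=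
    isCompact_univ_pi fun p ↦ isCompact_Icc
  obtain ⟨a, -, φ, hφ, ha⟩ := hcomp.tendsto_subseq (x := fun n (p : ι × ℕ) ↦ f n p.1 (q p.2))
    (fun n p _ ↦ abs_le.1 (hM p.1 (q p.2) n))
  have hq : ∀ i j, Tendsto (fun n ↦ f (φ n) i (q j)) atTop (𝓝 (a (i, j))) := fun i j ↦
    (tendsto_pi_nhds.1 ha) (i, j)
  have hconv : ∀ i x, ∃ y, Tendsto (fun n ↦ f (φ n) i x) atTop (𝓝 y) := by
    intro i x
    apply cauchySeq_tendsto_of_complete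
    rw [Metric.cauchySeq_iff']
    intro ε hε
    have hδ : 0 < ε / (3 * ((L i : ℝ) + 1)) := by positivity
    obtain ⟨j, hj⟩ := (TopologicalSpace.denseRange_denseSeq X).exists_dist_lt x hδ
    obtain ⟨N, hN⟩ := Metric.cauchySeq_iff'.1 (hq i j).cauchySeq (ε / 3) (by positivity)
    refine ⟨N, fun n hn ↦ ?_⟩
    have hl : ∀ n, dist (f n i x) (f n i (q j)) < ε / 3 := by
      intro n
      refine ((hL n i).dist_le_mul _ _).trans_lt ?_
      have h1 : (L i : ℝ) * dist x (q j) ≤ ((L i : ℝ) + 1) * dist x (q j) := by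
        gcongr; linarith
      refine h1.trans_lt ?_
      rw [lt_div_iff₀ (by positivity)] at hj
      linarith
    calc _ ≤ dist (f (φ n) i x) (f (φ n) i (q j)) + dist (f (φ n) i (q j)) (f (φ N) i (q j)) +
          dist (f (φ N) i (q j)) (f (φ N) i x) := dist_triangle4 _ _ _ _
      _ < ε / 3 + ε / 3 + ε / 3 := by
          gcongr
          · exact hl _
          · exact hN n hn
          · rw [dist_comm]; exact hl _
      _ = ε := by ring
  choose g hg using hconv
  refine ⟨φ, hφ, g, fun i ↦ LipschitzWith.of_dist_le_mul fun x y ↦ ?_, hg⟩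
  exact le_of_tendsto ((hg i x).dist (hg i y))
    (Eventually.of_forall fun n ↦ (hL _ i).dist_le_mul x y)

/-- The constant depends on the scale and on `B` only, not on `E`: at each fixed scale,
mollifications of subsets of `B` are equi-Lipschitz. -/
lemma lipschitzWith_mollify {k : ℕ} {L : ℝ≥0} (hL : LipschitzWith L (rho d k))
    {E B : Set (Eucl d)} (hE : MeasurableSet E) (hB : Bornology.IsBounded B) (hEB : E ⊆ B) :
    LipschitzWith (L * (volume B).toNNReal) (mollify k E) := by
  have hform : ∀ x, mollify k E x = ∫ t in E, rho d k (x - t) := by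
    intro x
    rw [mollify, convolution_eq_swap, ← integral_indicator hE]
    congr 1 with t
    by_cases ht : t ∈ E <;> simp [ht]
  have hfin : volume B ≠ ⊤ := hB.measure_lt_top.ne
  have hfinE : volume E ≠ ⊤ := ((measure_mono hEB).trans_lt hfin.lt_top).ne
  have hint : ∀ x, IntegrableOn (fun t ↦ rho d k (x - t)) E := fun x ↦
    ((integrable_rho k).comp_sub_left x).integrableOn
  refine LipschitzWith.of_dist_le_mul fun x y ↦ ?_
  rw [Real.dist_eq, hform, hform, ← integral_sub (hint x) (hint y)]
  calc |∫ t in E, (rho d k (x - t) - rho d k (y - t))| ≤ (L * dist x y) * volume.real E := by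
        refine norm_setIntegral_le_of_norm_le_const (f := fun t ↦ rho d k (x - t) - rho d k (y - t))
          hfinE.lt_top fun t _ ↦ ?_
        have := hL.dist_le_mul (x - t) (y - t)
        rwa [Real.dist_eq, dist_sub_right] at this
    _ ≤ (L * dist x y) * volume.real B := by
        gcongr
    _ = _ := by
        rw [NNReal.coe_mul, Measure.real, ENNReal.coe_toNNReal_eq_toReal]; ring

lemma mollify_eq_zero_of_notMem {k : ℕ} {E B : Set (Eucl d)} (hEB : E ⊆ B) {x : Eucl d}
    (hx : x ∉ Metric.cthickening 1 B) : mollify k E x = 0 := by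
  rw [mollify_apply]
  refine integral_eq_zero_of_ae (Eventually.of_forall fun t ↦ ?_)
  by_contra hne
  have h1 : rho d k t ≠ 0 := fun h ↦ hne (by simp [h])
  have h2 : x - t ∈ E := by
    by_contra h; exact hne (by simp [h])
  refine hx (Metric.mem_cthickening_of_dist_le x (x - t) 1 B (hEB h2) ?_)
  rw [dist_eq_norm, sub_sub_cancel]
  refine (norm_lt_of_rho_ne_zero h1).le.trans ?_
  exact inv_le_one_of_one_le₀ (by linarith [(Nat.cast_nonneg k : (0 : ℝ) ≤ k)])

/-- A sequence of sets in a bounded region which is Cauchy in measure converges in measure,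
up to a subsequence. -/
lemma exists_subseq_tendsto_of_cauchy {E : ℕ → Set (Eucl d)} {B : Set (Eucl d)}
    (hE : ∀ n, MeasurableSet (E n)) (hB : Bornology.IsBounded B) (hEB : ∀ n, E n ⊆ B)
    (hc : ∀ ε > 0, ∃ N, ∀ n ≥ N, ∀ m ≥ N, volume (symmDiff (E n) (E m)) ≤ ε) :
    ∃ φ : ℕ → ℕ, StrictMono φ ∧ ∃ F : Set (Eucl d), MeasurableSet F ∧
      Tendsto (fun n ↦ volume (symmDiff (E (φ n)) F)) atTop (𝓝 0) := by
  -- Successive differences have summable measure along this subsequence. By Borel–Cantelli almost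
  -- every point lies in finitely many of them, so its membership stabilizes, and the set-theoretic
  -- `liminf` is the limit.
  obtain ⟨φ, hφ, hP⟩ := extraction_forall_of_eventually'
    (P := fun n k ↦ ∀ m ≥ k, volume (symmDiff (E k) (E m)) ≤ (2⁻¹ : ℝ≥0∞) ^ n) (fun n ↦ by
      obtain ⟨N, hN⟩ := hc ((2⁻¹ : ℝ≥0∞) ^ n) (ENNReal.pow_pos (by simp) _)
      exact ⟨N, fun k hk m hm ↦ hN k hk m (hk.trans hm)⟩)
  have hsum : ∑' n, volume (symmDiff (E (φ n)) (E (φ (n + 1)))) ≠ ⊤ := by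
    refine ne_top_of_le_ne_top ?_ (ENNReal.tsum_le_tsum fun n ↦
      hP n _ (hφ.monotone (Nat.le_succ n)))
    rw [ENNReal.tsum_geometric]
    simp
  have hae := ae_eventually_notMem hsum
  refine ⟨φ, hφ, liminf (fun n ↦ E (φ n)) atTop,
    MeasurableSet.measurableSet_liminf fun n ↦ hE _, ?_⟩
  have hmF : MeasurableSet (liminf (fun n ↦ E (φ n)) atTop) :=
    MeasurableSet.measurableSet_liminf fun n ↦ hE _
  have hFB : liminf (fun n ↦ E (φ n)) atTop ⊆ B := by
    intro x hx
    rw [mem_liminf_iff_eventually_mem] at hx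
    obtain ⟨n, hn⟩ := hx.exists
    exact hEB _ hn
  have := tendsto_measure_of_ae_tendsto_indicator (μ := volume) (A := ∅)
    (As := fun n ↦ symmDiff (E (φ n)) (liminf (fun n ↦ E (φ n)) atTop)) atTop
    MeasurableSet.empty (fun n ↦ (hE _).symmDiff hmF) (B := closure B)
    isClosed_closure.measurableSet (hB.closure.measure_lt_top.ne)
    (Eventually.of_forall fun n ↦ ?_) ?_
  · simpa using this
  · rintro x (hx | hx)
    · exact subset_closure (hEB _ hx.1)
    · exact subset_closure (hFB hx.1)
  · filter_upwards [hae] with x hx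
    obtain ⟨N, hN⟩ := eventually_atTop.1 hx
    have hconst : ∀ n ≥ N, (x ∈ E (φ n) ↔ x ∈ E (φ N)) := by
      intro n hn
      induction n, hn using Nat.le_induction with
      | base => rfl
      | succ n hn ih =>
        rw [← ih]
        have := hN n hn
        rw [Set.mem_symmDiff] at this
        tauto
    have hl : x ∈ liminf (fun n ↦ E (φ n)) atTop ↔ x ∈ E (φ N) := by
      rw [mem_liminf_iff_eventually_mem]
      constructor
      · intro h
        obtain ⟨n, h1, h2⟩ := (h.and (eventually_ge_atTop N)).exists
        exact (hconst n h2).1 h1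
      · intro h
        filter_upwards [eventually_ge_atTop N] with n hn using (hconst n hn).2 h
    filter_upwards [eventually_ge_atTop N] with n hn
    rw [Set.mem_symmDiff, hl, hconst n hn]
    simp

/-- Compactness of sets of bounded perimeter in a bounded region. -/
theorem exists_subseq_tendsto_of_tv_le {E : ℕ → Set (Eucl d)} {B : Set (Eucl d)} {C : ℝ≥0∞}
    (hC : C ≠ ⊤) (hE : ∀ n, MeasurableSet (E n)) (hB : Bornology.IsBounded B)
    (hEB : ∀ n, E n ⊆ B) (htv : ∀ n, tv ((E n).indicator 1) ≤ C) :
    ∃ φ : ℕ → ℕ, StrictMono φ ∧ ∃ F : Set (Eucl d), MeasurableSet F ∧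
      Tendsto (fun n ↦ volume (symmDiff (E (φ n)) F)) atTop (𝓝 0) := by
  have hEb : ∀ n, Bornology.IsBounded (E n) := fun n ↦ hB.subset (hEB n)
  have hlipρ : ∀ k, ∃ L, LipschitzWith L (rho d k) := fun k ↦
    (contDiff_rho k (n := 1)).lipschitzWith_of_hasCompactSupport (hasCompactSupport_rho k)
      (by norm_num)
  choose L hL using hlipρ
  -- One subsequence along which the mollifications converge at every scale `k` simultaneously.
  obtain ⟨φ, hφ, g, -, hg⟩ := exists_subseq_tendsto_of_lipschitz
    (fun n k ↦ mollify k (E n)) _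
    (fun n k ↦ lipschitzWith_mollify (hL k) (hE n) hB (hEB n))
    (fun k x ↦ ⟨1, fun n ↦ by
      have := mollify_mem_Icc k (hE n) x
      rw [abs_of_nonneg this.1]; exact this.2⟩)
  have hB'fin : volume (Metric.cthickening 1 B) ≠ ⊤ := hB.cthickening.measure_lt_top.ne
  have hgm : ∀ k, Measurable (g k) := fun k ↦
    measurable_of_tendsto_metrizable (fun n ↦ (continuous_mollify k (hE (φ n))).measurable)
      (tendsto_pi_nhds.2 fun x ↦ hg k x)
  have hL1 : ∀ k, Tendsto (fun n ↦ ∫⁻ x, ‖mollify k (E (φ n)) x - g k x‖ₑ) atTop (𝓝 0) := by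
    intro k
    have := tendsto_lintegral_of_dominated_convergence (μ := volume)
      (F := fun n x ↦ ‖mollify k (E (φ n)) x - g k x‖ₑ) (f := fun _ ↦ 0)
      ((Metric.cthickening 1 B).indicator 2)
      (fun n ↦ ((continuous_mollify k (hE _)).measurable.sub (hgm k)).enorm)
      (fun n ↦ Eventually.of_forall fun x ↦ ?_) ?_ (Eventually.of_forall fun x ↦ ?_)
    · simpa using this
    · by_cases hx : x ∈ Metric.cthickening 1 B
      · rw [indicator_of_mem hx]
        have h1 := mollify_mem_Icc k (hE (φ n)) x
        have h2 : g k x ∈ Icc (0 : ℝ) 1 := isClosed_Icc.mem_of_tendsto (hg k x)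
          (Eventually.of_forall fun n ↦ mollify_mem_Icc k (hE (φ n)) x)
        show ‖mollify k (E (φ n)) x - g k x‖ₑ ≤ 2
        rw [← ofReal_norm, Real.norm_eq_abs, ← ENNReal.ofReal_ofNat]
        apply ENNReal.ofReal_le_ofReal
        rw [abs_le]
        constructor <;> linarith [h1.1, h1.2, h2.1, h2.2]
      · have h0 : ∀ n, mollify k (E (φ n)) x = 0 := fun n ↦
          mollify_eq_zero_of_notMem (hEB _) hx
        have : g k x = 0 := tendsto_nhds_unique (hg k x) (by simp [h0])
        simp [h0, this]
    · rw [lintegral_indicator Metric.isClosed_cthickening.measurableSet]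
      simpa using ENNReal.mul_ne_top (by simp) hB'fin
    · simpa using ((hg k x).sub_const (g k x)).enorm
  -- Each indicator is within `ε / 4` of its mollification at a scale chosen uniformly in `n`,
  -- thanks to the perimeter bound; at that scale the mollifications are eventually within `ε / 4`
  -- of their limit `g k`.
  have hcau : ∀ ε > 0, ∃ N, ∀ n ≥ N, ∀ m ≥ N, volume (symmDiff (E (φ n)) (E (φ m))) ≤ ε := by
    intro ε hε
    have hε4 : 0 < ε / 4 := ENNReal.div_pos hε.ne' (by simp)
    obtain ⟨k, hk⟩ : ∃ k : ℕ, ENNReal.ofReal ((k : ℝ) + 1)⁻¹ * C ≤ ε / 4 := by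
      have h1 : Tendsto (fun k : ℕ ↦ ENNReal.ofReal ((k : ℝ) + 1)⁻¹ * C) atTop (𝓝 0) := by
        have h2 : Tendsto (fun k : ℕ ↦ ((k : ℝ) + 1)⁻¹) atTop (𝓝 0) := by
          simpa using tendsto_one_div_add_atTop_nhds_zero_nat (𝕜 := ℝ)
        have h3 := ENNReal.Tendsto.mul_const ((ENNReal.continuous_ofReal.tendsto _).comp h2)
          (Or.inr hC)
        simpa using h3
      exact (h1.eventually (ge_mem_nhds hε4)).exists
    obtain ⟨N, hN⟩ := ENNReal.tendsto_atTop_zero.1 (hL1 k) (ε / 4) hε4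
    refine ⟨N, fun n hn m hm ↦ ?_⟩
    have hmm : ∀ n, Measurable (mollify k (E n)) := fun n ↦ (continuous_mollify k (hE n)).measurable
    have hmi : ∀ n, Measurable ((E n).indicator (1 : Eucl d → ℝ)) := fun n ↦
      measurable_one.indicator (hE n)
    have hmol : ∀ n, ∫⁻ x, ‖mollify k (E n) x - (E n).indicator 1 x‖ₑ ≤ ε / 4 := fun n ↦
      ((lintegral_mollify_sub_le k (hE n) (hEb n)).trans (by gcongr; exact htv n)).trans hk
    rw [← lintegral_enorm_indicator_sub (hE _) (hE _)]
    calc _ ≤ ∫⁻ x, (‖mollify k (E (φ n)) x - (E (φ n)).indicator 1 x‖ₑ +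
          ‖mollify k (E (φ n)) x - g k x‖ₑ + (‖mollify k (E (φ m)) x - g k x‖ₑ +
          ‖mollify k (E (φ m)) x - (E (φ m)).indicator 1 x‖ₑ)) := by
          refine lintegral_mono fun x ↦ ?_
          have : (E (φ n)).indicator (1 : Eucl d → ℝ) x - (E (φ m)).indicator 1 x =
            ((mollify k (E (φ n)) x - g k x) -
              (mollify k (E (φ n)) x - (E (φ n)).indicator 1 x)) +
            ((mollify k (E (φ m)) x - (E (φ m)).indicator 1 x) -
              (mollify k (E (φ m)) x - g k x)) := by ring
          rw [this]
          refine (enorm_add_le _ _).trans (add_le_add ?_ ?_)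
          · rw [add_comm]; exact enorm_sub_le
          · rw [add_comm]; exact enorm_sub_le
      _ ≤ (ε / 4 + ε / 4) + (ε / 4 + ε / 4) := by
          have m1 : ∀ n, Measurable fun x ↦ ‖mollify k (E n) x - (E n).indicator 1 x‖ₑ :=
            fun n ↦ ((hmm n).sub (hmi n)).enorm
          have m2 : ∀ n, Measurable fun x ↦ ‖mollify k (E n) x - g k x‖ₑ :=
            fun n ↦ ((hmm n).sub (hgm k)).enorm
          have m3 : Measurable fun x ↦ ‖mollify k (E (φ n)) x - (E (φ n)).indicator 1 x‖ₑ +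
            ‖mollify k (E (φ n)) x - g k x‖ₑ := (m1 _).add (m2 _)
          rw [lintegral_add_left m3, lintegral_add_left (m1 _), lintegral_add_left (m2 _)]
          exact add_le_add (add_le_add (hmol _) (hN n hn)) (add_le_add (hN m hm) (hmol _))
      _ = ε := by
          rw [← two_mul, ← two_mul, ← mul_assoc]
          norm_num
          exact ENNReal.mul_div_cancel (by simp) (by simp)
  obtain ⟨ψ, hψ, F, hF, hlim⟩ := exists_subseq_tendsto_of_cauchy (E := fun n ↦ E (φ n))
    (fun n ↦ hE _) hB (fun n ↦ hEB _) hcau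
  exact ⟨φ ∘ ψ, hφ.comp hψ, F, hF, hlim⟩

/-! ### Adjusting volumes with balls, and existence for the isoperimetric problem. -/

section VolumeAdjustment

lemma volume_closedBall_real (x : Eucl d) {r : ℝ} (hr : 0 ≤ r) :
    volume.real (Metric.closedBall x r) = r ^ d * unitBallVolume d := by
  rw [Measure.real, Measure.addHaar_closedBall _ _ hr, ENNReal.toReal_mul,
    ENNReal.toReal_ofReal (by positivity), finrank_euclideanSpace_fin]
  rfl

/-- Between radii `s ≤ t` the volume grows by at most that of the shell, `(t ^ d - s ^ d) ω_d`. -/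
lemma continuousOn_volume_inter_closedBall (A : Set (Eucl d))
    (x : Eucl d) : ContinuousOn (fun s ↦ volume.real (A ∩ Metric.closedBall x s)) (Ici 0) := by
  have hfin : ∀ s, volume (A ∩ Metric.closedBall x s) ≠ ⊤ := fun s ↦
    ((measure_mono inter_subset_right).trans_lt measure_closedBall_lt_top).ne
  have hle : ∀ s t, 0 ≤ s → s ≤ t → volume.real (A ∩ Metric.closedBall x t) -
      volume.real (A ∩ Metric.closedBall x s) ≤ (t ^ d - s ^ d) * unitBallVolume d ∧
      volume.real (A ∩ Metric.closedBall x s) ≤ volume.real (A ∩ Metric.closedBall x t) := by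
    intro s t hs hst
    refine ⟨?_, measureReal_mono (inter_subset_inter_right _ (Metric.closedBall_subset_closedBall hst))
      (hfin t)⟩
    have hsub : A ∩ Metric.closedBall x t ⊆
        (A ∩ Metric.closedBall x s) ∪ (Metric.closedBall x t \ Metric.closedBall x s) := by
      rintro y ⟨h1, h2⟩
      by_cases h3 : y ∈ Metric.closedBall x s
      · exact Or.inl ⟨h1, h3⟩
      · exact Or.inr ⟨h2, h3⟩
    have hfin' : volume (Metric.closedBall x t \ Metric.closedBall x s) ≠ ⊤ :=
      ((measure_mono sdiff_subset).trans_lt measure_closedBall_lt_top).ne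
    have h1 := (measureReal_mono hsub (measure_union_ne_top (hfin s) hfin')).trans
      (measureReal_union_le _ _)
    rw [measureReal_sdiff (Metric.closedBall_subset_closedBall hst) Metric.isClosed_closedBall.measurableSet
      measure_closedBall_lt_top.ne, volume_closedBall_real x (hs.trans hst),
      volume_closedBall_real x hs] at h1
    linarith
  intro s hs
  have hc : ContinuousWithinAt (fun t : ℝ ↦ |t ^ d - s ^ d| * unitBallVolume d) (Ici 0) s := by
    fun_prop
  rw [ContinuousWithinAt, tendsto_iff_dist_tendsto_zero]
  have hc' : Tendsto (fun t : ℝ ↦ |t ^ d - s ^ d| * unitBallVolume d) (𝓝[Ici 0] s) (𝓝 0) := by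
    simpa [ContinuousWithinAt] using hc
  refine squeeze_zero' (Eventually.of_forall fun t ↦ dist_nonneg) ?_ hc'
  filter_upwards [self_mem_nhdsWithin] with t ht
  have hu : 0 ≤ unitBallVolume d := measureReal_nonneg
  rw [Real.dist_eq]
  rcases le_total s t with h | h
  · obtain ⟨h1, h2⟩ := hle s t hs h
    rw [abs_of_nonneg (by linarith)]
    exact h1.trans (mul_le_mul_of_nonneg_right (le_abs_self _) hu)
  · obtain ⟨h1, h2⟩ := hle t s ht h
    rw [abs_sub_comm, abs_of_nonneg (by linarith), abs_sub_comm]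
    exact h1.trans (mul_le_mul_of_nonneg_right (le_abs_self _) hu)

variable [NeZero d]

instance : Nontrivial (Eucl d) := by
  refine ⟨0, EuclideanSpace.single 0 1, fun h ↦ ?_⟩
  have := congrArg (fun v : Eucl d ↦ v 0) h
  simp at this

lemma volume_closedBall_eq_ball (x : Eucl d) (r : ℝ) :
    volume (Metric.closedBall x r) = volume (Metric.ball x r) :=
  Measure.addHaar_closedBall_eq_addHaar_ball volume x r

/-- Removing a ball of suitable radius adjusts the volume. -/
lemma exists_volume_diff_closedBall_eq {A : Set (Eucl d)}
    (hfin : volume A ≠ ⊤) (x : Eucl d) {s₁ m : ℝ} (hs : 0 ≤ s₁)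
    (h1 : volume.real (A \ Metric.closedBall x s₁) ≤ m) (h2 : m ≤ volume.real A) :
    ∃ s ∈ Icc 0 s₁, volume.real (A \ Metric.closedBall x s) = m := by
  have heq : ∀ s, volume.real (A \ Metric.closedBall x s) =
      volume.real A - volume.real (A ∩ Metric.closedBall x s) := by
    intro s
    rw [← measureReal_inter_add_sdiff (s := A) Metric.isClosed_closedBall.measurableSet hfin (t := Metric.closedBall x s)]
    ring
  have hcont : ContinuousOn (fun s ↦ volume.real (A \ Metric.closedBall x s)) (Icc 0 s₁) := by
    simp only [heq]
    exact continuousOn_const.sub ((continuousOn_volume_inter_closedBall A x).mono Icc_subset_Ici_self)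
  -- The closed ball of radius `0` is a singleton, hence null, so the intermediate value theorem
  -- starts from the full volume of `A`.
  have h0 : volume.real (A \ Metric.closedBall x 0) = volume.real A := by
    rw [heq, Metric.closedBall_zero, sub_eq_self]
    have : volume (A ∩ {x}) = 0 := measure_mono_null inter_subset_right (by simp)
    simp [Measure.real, this]
  obtain ⟨s, hs, hse⟩ := intermediate_value_Icc' hs hcont ⟨h1, by rw [h0]; exact h2⟩
  exact ⟨s, hs, hse⟩

/-- Existence for the isoperimetric problem in a bounded region. -/
theorem exists_isIsoperimetricSolution {Ω : Set (Eucl d)} (hΩ : MeasurableSet Ω)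
    (hb : Bornology.IsBounded Ω) {m : ℝ} (hm : 0 ≤ m) (hlt : ENNReal.ofReal m ≤ volume Ω) :
    ∃ E₀, IsIsoperimetricSolution Ω m E₀ := by
  have hfin : volume Ω ≠ ⊤ := hb.measure_lt_top.ne
  let S : Set (Set (Eucl d)) := {E | MeasurableSet E ∧ E ⊆ Ω ∧ volume E = ENNReal.ofReal m}
  have hne : S.Nonempty := by
    obtain ⟨R, hR⟩ := hb.subset_closedBall 0
    obtain ⟨s, -, hs⟩ := exists_volume_diff_closedBall_eq hfin 0 (s₁ := max R 0) (m := m)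
      (le_max_right _ _) (by
        rw [sdiff_eq_empty.2 (hR.trans (Metric.closedBall_subset_closedBall (le_max_left _ _)))]
        simpa using hm) ((ENNReal.ofReal_le_iff_le_toReal hfin).1 hlt)
    refine ⟨Ω \ Metric.closedBall 0 s, hΩ.diff Metric.isClosed_closedBall.measurableSet,
      sdiff_subset, ?_⟩
    rw [← hs, ofReal_measureReal ((measure_mono sdiff_subset).trans_lt hfin.lt_top).ne]
  obtain ⟨v, -, hv, hvS⟩ := exists_seq_tendsto_sInf (S := (fun E ↦ tv (E.indicator 1)) '' S)
    (hne.image _) (OrderBot.bddBelow _)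
  choose E hES hEv using hvS
  replace hEv : ∀ n, tv ((E n).indicator 1) = v n := hEv
  set I := sInf ((fun E : Set (Eucl d) ↦ tv (E.indicator 1)) '' S) with hI
  suffices ∃ F ∈ S, tv (F.indicator 1) ≤ I by
    obtain ⟨F, hF, hFI⟩ := this
    refine ⟨F, hF, fun G hG ↦ ?_⟩
    show perimeter F ≤ perimeter G
    rw [perimeter_eq_tv hF.1, perimeter_eq_tv hG.1, EReal.coe_ennreal_le_coe_ennreal_iff]
    exact hFI.trans (sInf_le ⟨G, hG, rfl⟩)
  by_cases htop : I = ⊤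
  · obtain ⟨F, hF⟩ := hne
    exact ⟨F, hF, htop ▸ le_top⟩
  have hlt' : I < I + 1 := ENNReal.lt_add_right htop one_ne_zero
  obtain ⟨N, hN⟩ := eventually_atTop.1 (hv.eventually (gt_mem_nhds hlt'))
  obtain ⟨φ, hφ, F, hF, hlim⟩ := exists_subseq_tendsto_of_tv_le (E := fun n ↦ E (n + N))
    (C := I + 1) (by simp [htop]) (fun n ↦ (hES _).1) hb (fun n ↦ (hES _).2.1)
    (fun n ↦ by rw [hEv]; exact (hN _ (Nat.le_add_left _ _)).le)
  -- The limit in measure lies in `Ω` only up to a null set; intersecting with `Ω` makes it a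
  -- genuine competitor without spoiling the convergence.
  have hFΩ : MeasurableSet (F ∩ Ω) := hF.inter hΩ
  have hlim' : Tendsto (fun n ↦ volume (symmDiff (E (φ n + N)) (F ∩ Ω))) atTop (𝓝 0) := by
    refine tendsto_of_tendsto_of_tendsto_of_le_of_le tendsto_const_nhds hlim (fun _ ↦ zero_le)
      fun n ↦ measure_mono ?_
    have := (hES (φ n + N)).2.1
    rintro x (⟨h1, h2⟩ | ⟨h1, h2⟩)
    · exact Or.inl ⟨h1, fun h ↦ h2 ⟨h, this h1⟩⟩
    · exact Or.inr ⟨h1.1, h2⟩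
  refine ⟨F ∩ Ω, ⟨hFΩ, inter_subset_right, ?_⟩, ?_⟩
  · apply le_antisymm
    · refine ge_of_tendsto (by simpa using hlim'.const_add (ENNReal.ofReal m))
        (Eventually.of_forall fun n ↦ ?_)
      rw [← (hES (φ n + N)).2.2]
      refine (measure_mono fun x hx ↦ ?_).trans (measure_union_le _ _)
      by_cases h : x ∈ E (φ n + N)
      · exact Or.inl h
      · exact Or.inr (Or.inr ⟨hx, h⟩)
    · refine ge_of_tendsto (by simpa using hlim'.const_add (volume (F ∩ Ω)))
        (Eventually.of_forall fun n ↦ ?_)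
      rw [← (hES (φ n + N)).2.2]
      refine (measure_mono fun x hx ↦ ?_).trans (measure_union_le _ _)
      by_cases h : x ∈ F ∩ Ω
      · exact Or.inl h
      · exact Or.inr (Or.inl ⟨hx, h⟩)
  · refine (tv_indicator_le_liminf hFΩ (fun n ↦ (hES _).1) hlim').trans (le_of_eq ?_)
    simp only [hEv]
    exact (hv.comp ((tendsto_add_atTop_nat N).comp hφ.tendsto_atTop)).liminf_eq

end VolumeAdjustment

end ChargedDrop

/-! ### The logarithmic kernel and energies of measures. -/

namespace ChargedDrop
open Filter Topology
open scoped ENNReal NNReal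

variable {d : ℕ}

/-- The truncated shifted kernel `(c - log |z|)⁺`. -/
noncomputable def kern (c : ℝ) (z : Eucl d) : ℝ≥0∞ :=
  if z = 0 then ⊤ else ENNReal.ofReal (c - Real.log ‖z‖)

lemma kern_zero (c : ℝ) : kern c (0 : Eucl d) = ⊤ := if_pos rfl

lemma kern_of_ne (c : ℝ) {z : Eucl d} (hz : z ≠ 0) :
    kern c z = ENNReal.ofReal (c - Real.log ‖z‖) := if_neg hz

lemma measurable_kern (c : ℝ) : Measurable (kern c : Eucl d → ℝ≥0∞) := by
  refine Measurable.ite (measurableSet_singleton 0) measurable_const ?_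
  exact (measurable_const.sub (Real.measurable_log.comp measurable_norm)).ennreal_ofReal

lemma measurable_kern_sub (c : ℝ) : Measurable fun p : Eucl d × Eucl d ↦ kern c (p.1 - p.2) :=
  (measurable_kern c).comp (measurable_fst.sub measurable_snd)

lemma kern_neg (c : ℝ) (z : Eucl d) : kern c (-z) = kern c z := by
  simp [kern]

lemma kern_le_of_le_norm (c : ℝ) {z : Eucl d} {s : ℝ} (hs : 0 < s) (hz : s ≤ ‖z‖) :
    kern c z ≤ ENNReal.ofReal (c - Real.log s) := by
  have : z ≠ 0 := fun h ↦ by simp [h] at hz; linarith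
  rw [kern_of_ne c this]
  gcongr

/-- Shrinking a distance by a factor no smaller than `a` raises the logarithmic kernel by at most
`-log a`; the bound survives taking positive parts. -/
lemma kern_mono_add {c : ℝ} {z w : Eucl d} {a : ℝ} (ha : 0 < a) (h : a * ‖z‖ ≤ ‖w‖) :
    kern c w ≤ kern c z + ENNReal.ofReal (-Real.log a) := by
  by_cases hz : z = 0
  · simp [hz, kern_zero]
  have hz' : 0 < ‖z‖ := norm_pos_iff.2 hz
  rw [kern_of_ne c hz, ]
  refine (kern_le_of_le_norm c (mul_pos ha hz') h).trans ?_
  rw [Real.log_mul ha.ne' hz'.ne']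
  refine (ENNReal.ofReal_le_ofReal ?_).trans ENNReal.ofReal_add_le
  linarith

lemma kern_smul (c : ℝ) {r : ℝ} (hr : 0 < r) (z : Eucl d) :
    kern c (r • z) ≤ ENNReal.ofReal (c - Real.log r) + kern 0 z := by
  by_cases hz : z = 0
  · simp [hz, kern_zero]
  have hz' : 0 < ‖z‖ := norm_pos_iff.2 hz
  rw [kern_of_ne c (smul_ne_zero hr.ne' hz), kern_of_ne 0 hz, norm_smul, Real.norm_of_nonneg hr.le,
    Real.log_mul hr.ne' hz'.ne']
  refine (ENNReal.ofReal_le_ofReal ?_).trans ENNReal.ofReal_add_le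
  linarith

/-- Comparison of the kernel at nearby points. -/
lemma kern_add_smul_le (c : ℝ) {r : ℝ} (hr : 0 < r) (z : Eucl d) {u : Eucl d} (hu : ‖u‖ ≤ 1) :
    kern c (z + r • u) ≤ kern c z + ENNReal.ofReal (Real.log 2) + kern 0 (r⁻¹ • z + u) := by
  -- Away from the origin a displacement of length at most `r` at most halves the norm, which costs
  -- `log 2`. Near the origin, scale out `r`: the term `c - log r` is at most `c - log ‖z‖ + log 2`
  -- since `‖z‖ < 2 r`.
  by_cases h : 2 * r ≤ ‖z‖
  · have h1 : 2⁻¹ * ‖z‖ ≤ ‖z + r • u‖ := by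
      have h2 : ‖r • u‖ ≤ r := by
        rw [norm_smul, Real.norm_of_nonneg hr.le]
        exact mul_le_of_le_one_right hr.le hu
      have h3 := norm_sub_le_norm_add z (r • u)
      linarith
    have := kern_mono_add (c := c) (by norm_num) h1
    rw [Real.log_inv, neg_neg] at this
    exact this.trans le_self_add
  · push Not at h
    have hw : z + r • u = r • (r⁻¹ • z + u) := by
      rw [smul_add, smul_inv_smul₀ hr.ne']
    rw [hw]
    refine (kern_smul c hr _).trans ?_
    gcongr
    by_cases hz : z = 0
    · simp [hz, kern_zero]
    have hz' : 0 < ‖z‖ := norm_pos_iff.2 hz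
    rw [kern_of_ne c hz]
    refine (ENNReal.ofReal_le_ofReal ?_).trans ENNReal.ofReal_add_le
    have : Real.log ‖z‖ ≤ Real.log (2 * r) := Real.log_le_log hz' h.le
    rw [Real.log_mul (by norm_num) hr.ne'] at this
    linarith

lemma measurable_logKernel : Measurable fun p : Eucl d × Eucl d ↦ logKernel p.1 p.2 := by
  unfold logKernel
  exact (ENNReal.measurable_log.comp measurable_edist).neg

lemma logKernel_of_ne {x y : Eucl d} (h : x ≠ y) :
    logKernel x y = ((-Real.log ‖x - y‖ : ℝ) : EReal) := by
  rw [logKernel, edist_dist, ENNReal.log_ofReal_of_pos (dist_pos.2 h), dist_eq_norm]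
  rfl

/-- Mutual energy of two measures for the shifted kernel. -/
noncomputable def mutualEnergy (c : ℝ) (μ ν : Measure (Eucl d)) : ℝ≥0∞ :=
  ∫⁻ x, ∫⁻ y, kern c (x - y) ∂ν ∂μ

/-- The subtraction-free form of `kern c = logKernel + c`, suited to adding integrals in `ℝ≥0∞`. -/
lemma kern_add_negPart {c : ℝ} (hc : 0 ≤ c) {x y : Eucl d} (hxy : ‖x - y‖ ≤ Real.exp c) :
    kern c (x - y) + (-logKernel x y).toENNReal =
      (logKernel x y).toENNReal + ENNReal.ofReal c := by
  by_cases h : x = y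
  · simp [h, kern_zero, logKernel]
  have hpos : 0 < ‖x - y‖ := norm_pos_iff.2 (sub_ne_zero.2 h)
  have hlog : Real.log ‖x - y‖ ≤ c := (Real.log_le_iff_le_exp hpos).2 hxy
  rw [logKernel_of_ne h, kern_of_ne c (sub_ne_zero.2 h), ← EReal.coe_neg, neg_neg,
    EReal.real_coe_toENNReal, EReal.real_coe_toENNReal]
  rcases le_total 0 (Real.log ‖x - y‖) with h0 | h0
  · rw [← ENNReal.ofReal_add (by linarith) h0, ENNReal.ofReal_of_nonpos (p := -_) (by linarith)]
    simp
  · rw [ENNReal.ofReal_of_nonpos h0, add_zero, ← ENNReal.ofReal_add (by linarith) hc]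
    congr 1; ring

/-- When distances are at most `exp c`, the shifted kernel is nonnegative and its truncation is
inactive. The energy, a difference of two integrals, becomes a single `lintegral` minus a constant.
-/
lemma logEnergy_eq {c : ℝ} (hc : 0 ≤ c) {μ : Measure (Eucl d)} [IsProbabilityMeasure μ]
    {S : Set (Eucl d)} (hS : ∀ x ∈ S, ∀ y ∈ S, ‖x - y‖ ≤ Real.exp c) (hμ : ∀ᵐ x ∂μ, x ∈ S) :
    logEnergy μ = (mutualEnergy c μ μ : EReal) - (c : EReal) := by
  have hae : ∀ᵐ p ∂(μ.prod μ), ‖p.1 - p.2‖ ≤ Real.exp c := by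
    filter_upwards [Measure.quasiMeasurePreserving_fst.ae hμ,
      Measure.quasiMeasurePreserving_snd.ae hμ] with p h1 h2 using hS _ h1 _ h2
  have hmX : mutualEnergy c μ μ = ∫⁻ p, kern c (p.1 - p.2) ∂(μ.prod μ) :=
    (lintegral_prod _ (measurable_kern_sub c).aemeasurable).symm
  have hm1 : Measurable fun p : Eucl d × Eucl d ↦ (logKernel p.1 p.2).toENNReal :=
    measurable_logKernel.ereal_toENNReal
  have hm2 : Measurable fun p : Eucl d × Eucl d ↦ (-logKernel p.1 p.2).toENNReal :=
    measurable_logKernel.neg.ereal_toENNReal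
  set A := ∫⁻ p, (logKernel p.1 p.2).toENNReal ∂(μ.prod μ) with hA
  set B := ∫⁻ p, (-logKernel p.1 p.2).toENNReal ∂(μ.prod μ) with hB
  have hsum : mutualEnergy c μ μ + B = A + ENNReal.ofReal c := by
    rw [hmX, hB, ← lintegral_add_right _ hm2, hA]
    have : ENNReal.ofReal c = ∫⁻ _, ENNReal.ofReal c ∂(μ.prod μ) := by simp
    rw [this, ← lintegral_add_right _ measurable_const]
    apply lintegral_congr_ae
    filter_upwards [hae] with p hp using kern_add_negPart hc hp
  have hBfin : B ≠ ⊤ := by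
    refine ne_top_of_le_ne_top (b := ENNReal.ofReal c) ENNReal.ofReal_ne_top ?_
    calc B ≤ ∫⁻ _, ENNReal.ofReal c ∂(μ.prod μ) := by
          apply lintegral_mono_ae
          filter_upwards [hae] with p hp
          by_cases h : p.1 = p.2
          · simp [h, logKernel]
          · rw [logKernel_of_ne h, ← EReal.coe_neg, neg_neg, EReal.real_coe_toENNReal]
            exact ENNReal.ofReal_le_ofReal ((Real.log_le_iff_le_exp
              (norm_pos_iff.2 (sub_ne_zero.2 h))).2 hp)
      _ = _ := by simp
  have hlog : logEnergy μ = (A : EReal) - (B : EReal) := rfl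
  rw [hlog]
  generalize mutualEnergy c μ μ = X at hsum
  clear_value A B
  lift B to ℝ≥0 using hBfin
  by_cases hXt : X = ⊤
  · have : A = ⊤ := by
      by_contra hA'
      rw [hXt, top_add] at hsum
      exact (ENNReal.add_ne_top.2 ⟨hA', ENNReal.ofReal_ne_top⟩) hsum.symm
    rw [this, hXt]
    simp only [EReal.coe_ennreal_top]
    rw [EReal.top_sub_coe]
    exact EReal.top_sub_coe _
  · have hAt : A ≠ ⊤ := by
      rintro rfl
      rw [top_add] at hsum
      exact (ENNReal.add_ne_top.2 ⟨hXt, ENNReal.coe_ne_top⟩) hsum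
    lift A to ℝ≥0 using hAt
    lift X to ℝ≥0 using hXt
    have h1 : (X : ℝ) + B = A + c := by
      have := congrArg ENNReal.toReal hsum
      rw [ENNReal.toReal_add ENNReal.coe_ne_top ENNReal.coe_ne_top,
        ENNReal.toReal_add ENNReal.coe_ne_top ENNReal.ofReal_ne_top,
        ENNReal.toReal_ofReal hc] at this
      simpa using this
    have h2 : (A : ℝ) - B = X - c := by linarith
    have h3 : ∀ Y : ℝ≥0, ((Y : ℝ≥0∞) : EReal) = ((Y : ℝ) : EReal) := fun Y ↦ rfl
    rw [h3, h3, h3, ← EReal.coe_sub, h2, EReal.coe_sub]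

lemma Ilog_le_mutualEnergy {c : ℝ} (hc : 0 ≤ c) {μ : Measure (Eucl d)} [IsProbabilityMeasure μ]
    {E : Set (Eucl d)} (hE : ∀ x ∈ closure E, ∀ y ∈ closure E, ‖x - y‖ ≤ Real.exp c)
    (hμ : ∀ᵐ x ∂μ, x ∈ closure E) :
    Ilog E ≤ (mutualEnergy c μ μ : EReal) - (c : EReal) := by
  rw [← logEnergy_eq hc hE hμ]
  refine iInf₂_le (f := fun μ _ ↦ logEnergy μ) μ ⟨inferInstance, ?_⟩
  rwa [← prob_compl_eq_zero_iff isClosed_closure.measurableSet]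

lemma exists_mutualEnergy_lt {c : ℝ} (hc : 0 ≤ c)
    {E : Set (Eucl d)} (hE : ∀ x ∈ closure E, ∀ y ∈ closure E, ‖x - y‖ ≤ Real.exp c)
    {a : EReal} (ha : Ilog E < a) :
    ∃ μ : Measure (Eucl d), IsProbabilityMeasure μ ∧ (∀ᵐ x ∂μ, x ∈ closure E) ∧
      (mutualEnergy c μ μ : EReal) - (c : EReal) < a := by
  obtain ⟨μ, hμ⟩ := iInf_lt_iff.1 ha
  obtain ⟨⟨hp, h1⟩, hlt⟩ := iInf_lt_iff.1 hμ
  have h2 : ∀ᵐ x ∂μ, x ∈ closure E :=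
    (prob_compl_eq_zero_iff isClosed_closure.measurableSet).2 h1
  exact ⟨μ, hp, h2, by rwa [← logEnergy_eq hc hE h2]⟩

/-- The logarithmic energy of a bounded set is bounded below. -/
lemma neg_le_Ilog {c : ℝ} (hc : 0 ≤ c)
    {E : Set (Eucl d)} (hE : ∀ x ∈ closure E, ∀ y ∈ closure E, ‖x - y‖ ≤ Real.exp c) :
    ((-c : ℝ) : EReal) ≤ Ilog E := by
  refine le_of_forall_gt fun a ha ↦ ?_
  obtain ⟨μ, _, -, h⟩ := exists_mutualEnergy_lt hc hE ha
  refine lt_of_le_of_lt ?_ h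
  rw [sub_eq_add_neg, EReal.coe_neg]
  exact le_add_of_nonneg_left (EReal.coe_ennreal_nonneg _)

lemma Ilog_anti {E F : Set (Eucl d)} (h : closure E ⊆ closure F) : Ilog F ≤ Ilog E := by
  refine le_iInf₂ fun μ hμ ↦ iInf₂_le (f := fun μ _ ↦ logEnergy μ) μ ⟨hμ.1, ?_⟩
  have := hμ.1
  exact le_antisymm prob_le_one (hμ.2 ▸ measure_mono h)

/-! ### Uniform charges on balls. -/

section UniformBall

/-- The uniform probability measure on the unit ball. -/
noncomputable def unitBallMeasure (d : ℕ) : Measure (Eucl d) :=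
  (volume (Metric.ball (0 : Eucl d) 1))⁻¹ • volume.restrict (Metric.ball 0 1)

lemma volume_unitBall_ne_zero : volume (Metric.ball (0 : Eucl d) 1) ≠ 0 :=
  (Metric.measure_ball_pos _ _ one_pos).ne'

instance : IsProbabilityMeasure (unitBallMeasure d) := by
  constructor
  rw [unitBallMeasure, Measure.smul_apply, Measure.restrict_apply_univ, smul_eq_mul]
  exact ENNReal.inv_mul_cancel volume_unitBall_ne_zero measure_ball_lt_top.ne

lemma ae_unitBallMeasure : ∀ᵐ u ∂(unitBallMeasure d), ‖u‖ < 1 := by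
  refine Measure.ae_smul_measure ?_ _
  filter_upwards [ae_restrict_mem Metric.isOpen_ball.measurableSet] with u hu
  simpa using hu

/-- The uniform probability measure on a ball. -/
noncomputable def ballMeasure (x : Eucl d) (r : ℝ) : Measure (Eucl d) :=
  (unitBallMeasure d).map fun u ↦ x + r • u

lemma measurable_ballMap (x : Eucl d) (r : ℝ) : Measurable fun u : Eucl d ↦ x + r • u := by
  fun_prop

instance (x : Eucl d) (r : ℝ) : IsProbabilityMeasure (ballMeasure x r) :=
  Measure.isProbabilityMeasure_map (measurable_ballMap x r).aemeasurable

lemma ae_ballMeasure (x : Eucl d) {r : ℝ} (hr : 0 < r) :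
    ∀ᵐ y ∂(ballMeasure x r), y ∈ Metric.ball x r := by
  refine (ae_map_iff (p := fun y ↦ y ∈ Metric.ball x r) (measurable_ballMap x r).aemeasurable
    Metric.isOpen_ball.measurableSet).2 ?_
  filter_upwards [ae_unitBallMeasure] with u hu
  rw [mem_ball_iff_norm, add_sub_cancel_left, norm_smul, Real.norm_of_nonneg hr.le]
  exact mul_lt_of_lt_one_right hr hu

/-- The self-energy constant of the unit ball. -/
noncomputable def ballConst (d : ℕ) : ℝ≥0∞ :=
  (volume (Metric.ball (0 : Eucl d) 1))⁻¹ * ∫⁻ u : Eucl d, kern 0 u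

/-- Enlarging the domain of integration from the unit ball to the whole space makes the integral
translation invariant, so the bound is uniform in `w`. -/
lemma lintegral_kern_unitBallMeasure_le (w : Eucl d) :
    ∫⁻ u, kern 0 (w + u) ∂(unitBallMeasure d) ≤ ballConst d := by
  rw [unitBallMeasure, lintegral_smul_measure, smul_eq_mul, ballConst]
  refine mul_le_mul' le_rfl ?_
  refine (setLIntegral_le_lintegral _ _).trans (le_of_eq ?_)
  exact lintegral_add_left_eq_self (fun u ↦ kern 0 u) w

lemma lintegral_kern_unitBallMeasure_sub_le (w : Eucl d) :
    ∫⁻ u, kern 0 (w - u) ∂(unitBallMeasure d) ≤ ballConst d := by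
  have : ∀ u : Eucl d, kern 0 (w - u) = kern 0 (-w + u) := fun u ↦ by
    rw [← kern_neg, neg_sub, sub_eq_neg_add]
  simp only [this]
  exact lintegral_kern_unitBallMeasure_le _

/-- Layer cake: `-log ‖u‖` exceeds `t > 0` only in the ball of radius `exp (-t)`, whose volume `ω_d
exp (-d t)` is integrable in `t`. -/
lemma ballConst_ne_top [NeZero d] : ballConst d ≠ ⊤ := by
  refine ENNReal.mul_ne_top (ENNReal.inv_ne_top.2 volume_unitBall_ne_zero) ?_
  have h1 : ∫⁻ u : Eucl d, kern 0 u = ∫⁻ u : Eucl d, ENNReal.ofReal (max 0 (-Real.log ‖u‖)) := by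
    apply lintegral_congr_ae
    have : ∀ᵐ u : Eucl d, u ≠ 0 := by
      rw [ae_iff]; simp
    filter_upwards [this] with u hu
    rw [kern_of_ne 0 hu, zero_sub]
    simp only [ENNReal.ofReal_max, ENNReal.ofReal_zero, zero_le, max_eq_right]
  rw [h1, lintegral_eq_lintegral_meas_lt (f := fun u : Eucl d ↦ max 0 (-Real.log ‖u‖)) _ (Eventually.of_forall fun u ↦ le_max_left _ _)
    (by fun_prop)]
  have hd : (0 : ℝ) < d := by exact_mod_cast Nat.pos_of_ne_zero (NeZero.ne d)
  have h2 : ∀ t ∈ Ioi (0 : ℝ), volume {u : Eucl d | t < max 0 (-Real.log ‖u‖)} ≤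
      ENNReal.ofReal (Real.exp (-d * t)) * volume (Metric.ball (0 : Eucl d) 1) := by
    intro t ht
    calc _ ≤ volume (Metric.ball (0 : Eucl d) (Real.exp (-t))) := by
          refine measure_mono fun u hu ↦ ?_
          have hu' : t < -Real.log ‖u‖ := by
            rcases lt_max_iff.1 (show t < max 0 (-Real.log ‖u‖) from hu) with h | h
            · exact absurd h (not_lt.2 (le_of_lt ht))
            · exact h
          have h0 : 0 < ‖u‖ := by
            rcases (norm_nonneg u).eq_or_lt with h | h
            · rw [← h] at hu'; simp at hu'; exact absurd hu' (not_lt.2 (le_of_lt ht))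
            · exact h
          rw [mem_ball_zero_iff]
          rw [← Real.log_lt_iff_lt_exp h0]
          linarith
      _ = _ := by
          rw [Measure.addHaar_ball_of_pos _ _ (Real.exp_pos _), finrank_euclideanSpace_fin,
            ← Real.exp_nat_mul]
          congr 3; ring
  refine ((setLIntegral_mono' measurableSet_Ioi h2).trans_lt ?_).ne
  rw [lintegral_mul_const _ (by fun_prop)]
  refine ENNReal.mul_lt_top ?_ measure_ball_lt_top
  have := (exp_neg_integrableOn_Ioi 0 hd).hasFiniteIntegral
  rw [hasFiniteIntegral_iff_ofReal (Eventually.of_forall fun t ↦ (Real.exp_pos _).le)] at this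
  exact this

lemma mutualEnergy_ballMeasure (c : ℝ) (x y : Eucl d) (r : ℝ) :
    mutualEnergy c (ballMeasure x r) (ballMeasure y r) =
      ∫⁻ u, ∫⁻ v, kern c (x + r • u - (y + r • v)) ∂(unitBallMeasure d) ∂(unitBallMeasure d) := by
  have h1 : Measurable fun x : Eucl d ↦ ∫⁻ v, kern c (x - (y + r • v)) ∂(unitBallMeasure d) := by
    apply Measurable.lintegral_prod_right
    exact (measurable_kern c).comp (measurable_fst.sub ((measurable_ballMap y r).comp measurable_snd))
  rw [mutualEnergy, ballMeasure, ballMeasure]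
  have h2 : ∀ x : Eucl d, ∫⁻ z, kern c (x - z) ∂((unitBallMeasure d).map fun v ↦ y + r • v) =
      ∫⁻ v, kern c (x - (y + r • v)) ∂(unitBallMeasure d) := fun x ↦
    lintegral_map (f := fun z ↦ kern c (x - z)) ((measurable_kern c).comp (measurable_const.sub measurable_id))
      (measurable_ballMap y r)
  simp only [h2]
  exact lintegral_map h1 (measurable_ballMap x r)

lemma mutualEnergy_ballMeasure_self_le (c : ℝ) (x : Eucl d) {r : ℝ} (hr : 0 < r) :
    mutualEnergy c (ballMeasure x r) (ballMeasure x r) ≤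
      ENNReal.ofReal (c - Real.log r) + ballConst d := by
  rw [mutualEnergy_ballMeasure]
  calc _ ≤ ∫⁻ u, ∫⁻ v, (ENNReal.ofReal (c - Real.log r) + kern 0 (u - v))
        ∂(unitBallMeasure d) ∂(unitBallMeasure d) := by
        refine lintegral_mono fun u ↦ lintegral_mono fun v ↦ ?_
        have : x + r • u - (x + r • v) = r • (u - v) := by module
        rw [this]
        exact kern_smul c hr _
    _ ≤ ∫⁻ _, (ENNReal.ofReal (c - Real.log r) + ballConst d) ∂(unitBallMeasure d) := by
        refine lintegral_mono fun u ↦ ?_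
        rw [lintegral_add_left measurable_const]
        gcongr
        · simp
        · exact lintegral_kern_unitBallMeasure_sub_le u
    _ = _ := by simp

/-- Smearing two points over small balls increases the kernel by a bounded amount. -/
lemma mutualEnergy_ballMeasure_le (c : ℝ) (x y : Eucl d) {r : ℝ} (hr : 0 < r) :
    mutualEnergy c (ballMeasure x r) (ballMeasure y r) ≤
      kern c (x - y) + 2 * (ENNReal.ofReal (Real.log 2) + ballConst d) := by
  rw [mutualEnergy_ballMeasure]
  -- The cost of smearing one of the two points; it is used once for each of them.
  have key : ∀ z : Eucl d, ∫⁻ u, kern c (z + r • u) ∂(unitBallMeasure d) ≤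
      kern c z + (ENNReal.ofReal (Real.log 2) + ballConst d) := by
    intro z
    calc _ ≤ ∫⁻ u, (kern c z + ENNReal.ofReal (Real.log 2) + kern 0 (r⁻¹ • z + u))
          ∂(unitBallMeasure d) := by
          apply lintegral_mono_ae
          filter_upwards [ae_unitBallMeasure] with u hu using kern_add_smul_le c hr z hu.le
      _ ≤ _ := by
          rw [lintegral_add_left measurable_const, ← add_assoc]
          gcongr
          · simp
          · exact lintegral_kern_unitBallMeasure_le _
  calc _ ≤ ∫⁻ u, (kern c (x - y + r • u) + (ENNReal.ofReal (Real.log 2) + ballConst d))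
        ∂(unitBallMeasure d) := by
        refine lintegral_mono fun u ↦ ?_
        have : ∀ v, kern c (x + r • u - (y + r • v)) = kern c (-(x - y + r • u) + r • v) := by
          intro v
          rw [← kern_neg]
          congr 1
          module
        simp only [this]
        refine (key _).trans_eq ?_
        rw [kern_neg]
    _ ≤ _ := by
        rw [lintegral_add_right _ measurable_const, two_mul, ← add_assoc]
        gcongr
        · exact key _
        · simp

lemma mutualEnergy_le_of_dist {c s : ℝ} (hs : 0 < s) {μ ν : Measure (Eucl d)}
    [IsProbabilityMeasure μ] [IsProbabilityMeasure ν] {A B : Set (Eucl d)}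
    (hAB : ∀ x ∈ A, ∀ y ∈ B, s ≤ ‖x - y‖) (hA : ∀ᵐ x ∂μ, x ∈ A) (hB : ∀ᵐ y ∂ν, y ∈ B) :
    mutualEnergy c μ ν ≤ ENNReal.ofReal (c - Real.log s) := by
  calc _ ≤ ∫⁻ _, ∫⁻ _, ENNReal.ofReal (c - Real.log s) ∂ν ∂μ := by
        apply lintegral_mono_ae
        filter_upwards [hA] with x hx
        apply lintegral_mono_ae
        filter_upwards [hB] with y hy using kern_le_of_le_norm c hs (hAB x hx y hy)
    _ = _ := by simp

end UniformBall

/-- The uniform convex combination of finitely many uniform measures on balls. -/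
noncomputable def multiBallMeasure {N : ℕ} (x : Fin N → Eucl d) (r : ℝ) : Measure (Eucl d) :=
  (N : ℝ≥0∞)⁻¹ • ∑ i, ballMeasure (x i) r

lemma isProbabilityMeasure_multiBallMeasure {N : ℕ} (hN : N ≠ 0) (x : Fin N → Eucl d) (r : ℝ) :
    IsProbabilityMeasure (multiBallMeasure x r) := by
  constructor
  simp only [multiBallMeasure, Measure.smul_apply, Measure.finsetSum_apply, measure_univ,
    Finset.sum_const, Finset.card_univ, Fintype.card_fin, nsmul_eq_mul, mul_one, smul_eq_mul]
  exact ENNReal.inv_mul_cancel (by simpa using hN) (by simp)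

lemma ae_multiBallMeasure {N : ℕ} (x : Fin N → Eucl d) {r : ℝ} (hr : 0 < r) :
    ∀ᵐ y ∂(multiBallMeasure x r), y ∈ ⋃ i, Metric.ball (x i) r := by
  refine Measure.ae_smul_measure ?_ _
  rw [ae_iff, Measure.finsetSum_apply]
  refine Finset.sum_eq_zero fun i _ ↦ ?_
  rw [← nonpos_iff_eq_zero, ← (ae_iff.1 (ae_ballMeasure (x i) hr))]
  exact measure_mono fun y hy h ↦ hy (mem_iUnion.2 ⟨i, h⟩)

lemma mutualEnergy_multiBallMeasure {N : ℕ} (c : ℝ) (x : Fin N → Eucl d) (r : ℝ) :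
    mutualEnergy c (multiBallMeasure x r) (multiBallMeasure x r) =
      (N : ℝ≥0∞)⁻¹ * ((N : ℝ≥0∞)⁻¹ *
        ∑ i, ∑ j, mutualEnergy c (ballMeasure (x i) r) (ballMeasure (x j) r)) := by
  simp only [mutualEnergy, multiBallMeasure, lintegral_smul_measure, lintegral_finsetSum_measure,
    smul_eq_mul]
  congr 1
  have hm : ∀ j, Measurable fun y : Eucl d ↦ ∫⁻ z, kern c (y - z) ∂(ballMeasure (x j) r) :=
    fun j ↦ (measurable_kern_sub c).lintegral_prod_right'
  rw [Finset.mul_sum]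
  refine Finset.sum_congr rfl fun i _ ↦ ?_
  rw [lintegral_const_mul _ (Finset.measurable_fun_sum _ fun j _ ↦ hm j),
    lintegral_finsetSum _ fun j _ ↦ hm j]

end ChargedDrop

/-! ### Perimeter of balls, and pairs of distant balls. -/

namespace ChargedDrop
open Filter Topology
open scoped ENNReal NNReal

variable {d : ℕ}

lemma unitBallVolume_pos : 0 < unitBallVolume d :=
  ENNReal.toReal_pos volume_unitBall_ne_zero measure_ball_lt_top.ne

lemma tv_empty : tv ((∅ : Set (Eucl d)).indicator 1) = 0 := by
  refine le_antisymm (tv_le fun φ _ ↦ ?_) zero_le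
  simp

section BallPerimeter

variable [NeZero d]

lemma volume_ball_eq (x : Eucl d) {r : ℝ} (hr : 0 ≤ r) :
    volume (Metric.ball x r) = ENNReal.ofReal (r ^ d * unitBallVolume d) := by
  rw [Measure.addHaar_ball _ _ hr, finrank_euclideanSpace_fin, ENNReal.ofReal_mul (by positivity),
    unitBallVolume, ofReal_measureReal measure_ball_lt_top.ne]

lemma exists_radius {v : ℝ} (hv : 0 < v) : ∃ r : ℝ, 0 < r ∧ r ^ d * unitBallVolume d = v := by
  have hω := unitBallVolume_pos (d := d)
  refine ⟨(v / unitBallVolume d) ^ ((d : ℝ)⁻¹), by positivity, ?_⟩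
  rw [Real.rpow_inv_natCast_pow (by positivity) (NeZero.ne d)]
  field_simp

lemma nonempty_compl_of_isBounded {U : Set (Eucl d)} (h : Bornology.IsBounded U) :
    (Uᶜ).Nonempty := by
  rw [nonempty_compl]
  rintro rfl
  exact NoncompactSpace.noncompact_univ (Metric.isCompact_of_isClosed_isBounded isClosed_univ h)

/-- By Bernoulli's inequality the shell of thickness `r a` inside the sphere has volume at most `(d
ω_d r ^ (d - 1)) (r a)`, so the Minkowski bound yields the area of the sphere. -/
lemma tv_ball_le (x : Eucl d) {r : ℝ} (hr : 0 < r) :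
    tv ((Metric.ball x r).indicator 1) ≤ ENNReal.ofReal (d * unitBallVolume d * r ^ (d - 1)) := by
  have hω := (unitBallVolume_pos (d := d)).le
  have hne : ((Metric.ball x r)ᶜ).Nonempty := nonempty_compl_of_isBounded Metric.isBounded_ball
  refine tv_indicator_le_minkowski Metric.isOpen_ball hne (h := fun n : ℕ ↦ r * (1 / ((n : ℝ) + 1)))
    (fun n ↦ by positivity)
    (by simpa using tendsto_one_div_add_atTop_nhds_zero_nat.const_mul r) fun n ↦ ?_
  set a : ℝ := 1 / ((n : ℝ) + 1) with ha
  have ha0 : 0 < a := by positivity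
  have ha1 : a ≤ 1 := by
    rw [ha, div_le_one (by positivity)]
    linarith [(Nat.cast_nonneg n : (0 : ℝ) ≤ n)]
  have hsub : {y | 0 < Metric.infDist y (Metric.ball x r)ᶜ ∧
      Metric.infDist y (Metric.ball x r)ᶜ < r * a} ⊆ Metric.ball x r \ Metric.ball x (r * (1 - a)) := by
    rintro y ⟨h1, h2⟩
    refine ⟨?_, fun h3 ↦ ?_⟩
    · by_contra h
      rw [Metric.infDist_zero_of_mem (by exact h)] at h1
      exact lt_irrefl _ h1
    · refine absurd h2 (not_lt.2 ((Metric.le_infDist hne).2 fun z hz ↦ ?_))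
      have hz' : r ≤ dist z x := not_lt.1 hz
      have h4 : dist y x < r * (1 - a) := h3
      have := dist_triangle z y x
      rw [dist_comm z y] at this
      linarith
  have h1a : 0 ≤ r * (1 - a) := mul_nonneg hr.le (by linarith)
  refine (measure_mono hsub).trans ?_
  rw [measure_sdiff (Metric.ball_subset_ball (by nlinarith)) Metric.isOpen_ball.measurableSet.nullMeasurableSet
    measure_ball_lt_top.ne, volume_ball_eq x hr.le, volume_ball_eq x h1a,
    ← ENNReal.ofReal_sub _ (by positivity), ← ENNReal.ofReal_mul (by positivity)]
  apply ENNReal.ofReal_le_ofReal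
  have hB := one_add_mul_le_pow (a := -a) (by linarith) d
  have hd : d = (d - 1) + 1 := (Nat.succ_pred_eq_of_ne_zero (NeZero.ne d)).symm
  have hr' : r ^ d = r ^ (d - 1) * r := by
    conv_lhs => rw [hd]
    exact pow_succ r (d - 1)
  rw [mul_pow, show 1 - a = 1 + -a by ring]
  have h5 : r ^ d * (1 - (1 + -a) ^ d) ≤ r ^ d * (d * a) :=
    mul_le_mul_of_nonneg_left (by linarith) (by positivity)
  calc _ = (r ^ d * (1 - (1 + -a) ^ d)) * unitBallVolume d := by ring
    _ ≤ (r ^ d * (d * a)) * unitBallVolume d := mul_le_mul_of_nonneg_right h5 hω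
    _ = _ := by rw [hr']; ring

lemma ball_ae_eq_closedBall (x : Eucl d) (r : ℝ) :
    (Metric.ball x r : Set (Eucl d)) =ᵐ[volume] Metric.closedBall x r :=
  ae_eq_of_subset_of_measure_ge Metric.ball_subset_closedBall (volume_closedBall_eq_ball x r).le
    Metric.isOpen_ball.measurableSet.nullMeasurableSet measure_closedBall_lt_top.ne

lemma tv_closedBall_le (x : Eucl d) {r : ℝ} (hr : 0 < r) :
    tv ((Metric.closedBall x r).indicator 1) ≤
      ENNReal.ofReal (d * unitBallVolume d * r ^ (d - 1)) := by
  rw [← tv_indicator_congr (ball_ae_eq_closedBall x r)]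
  exact tv_ball_le x hr

lemma tv_iUnion_ball_le {N : ℕ} (x : Fin N → Eucl d) {r : ℝ} (hr : 0 < r) :
    tv ((⋃ i, Metric.ball (x i) r).indicator 1) ≤
      N * ENNReal.ofReal (d * unitBallVolume d * r ^ (d - 1)) := by
  have key : ∀ s : Finset (Fin N), tv ((⋃ i ∈ s, Metric.ball (x i) r).indicator 1) ≤
      s.card * ENNReal.ofReal (d * unitBallVolume d * r ^ (d - 1)) := by
    classical
    intro s
    induction s using Finset.induction_on with
    | empty =>
      rw [← Finset.set_biUnion_coe, Finset.coe_empty, biUnion_empty, tv_empty]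
      exact zero_le
    | insert i s hi ih =>
      rw [Finset.set_biUnion_insert, Finset.card_insert_of_notMem hi]
      refine (tv_union_le Metric.isOpen_ball.measurableSet
        (isOpen_biUnion fun _ _ ↦ Metric.isOpen_ball).measurableSet Metric.isBounded_ball
        ((Bornology.isBounded_biUnion_finset s).2 fun _ _ ↦ Metric.isBounded_ball)).trans ?_
      push_cast
      rw [add_mul, one_mul, add_comm]
      exact add_le_add ih (tv_ball_le _ hr)
  simpa using key Finset.univ

end BallPerimeter

lemma iInf_eq_bot_of_forall_le {α : Type*} {S : Set α} {F : α → EReal}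
    (h : ∀ M : ℝ, ∃ E ∈ S, F E ≤ (M : EReal)) : (⨅ E ∈ S, F E) = ⊥ := by
  rw [EReal.eq_bot_iff_forall_lt]
  intro M
  obtain ⟨E, hE, hF⟩ := h (M - 1)
  refine (iInf₂_le (f := fun E _ ↦ F E) E hE).trans_lt (hF.trans_lt ?_)
  exact_mod_cast sub_one_lt M

lemma logFunctional_le {Q : ℝ} {E : Set (Eucl d)} {p b : ℝ}
    (hp : perimeter E ≤ (p : EReal)) (hb : Ilog E ≤ (b : EReal)) :
    logFunctional Q E ≤ ((p + Q ^ 2 * b : ℝ) : EReal) := by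
  rw [logFunctional, EReal.coe_add, EReal.coe_mul]
  gcongr

lemma closure_subset_two_closedBalls {E : Set (Eucl d)} {p : Eucl d} {r : ℝ}
    (h2 : E ⊆ Metric.closedBall 0 r ∪ Metric.closedBall p r) :
    closure E ⊆ Metric.closedBall 0 r ∪ Metric.closedBall p r :=
  closure_minimal h2 (Metric.isClosed_closedBall.union Metric.isClosed_closedBall)

/-- The tangent balls at a point of one sphere are centred on the ray from the centre through that
point. The gap `2 r + 2 δ` keeps the exterior one away from the other ball. The case `a = b` covers
a single ball. -/
lemma two_closedBalls_mem_ballClass {δ r : ℝ} (hδ : 0 < δ) (hr : δ ≤ r) {a b : Eucl d}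
    (hab : a = b ∨ 2 * r + 2 * δ < dist a b) :
    Metric.closedBall a r ∪ Metric.closedBall b r ∈ ballClass d δ := by
  have hr0 : 0 < r := hδ.trans_le hr
  -- `t = δ` gives the centre of the interior ball and `t = -δ` that of the exterior one.
  have key : ∀ a x : Eucl d, ∀ t : ℝ, dist x a = r →
      ∃ y, dist x y = |t| ∧ dist y a = |r - t| := by
    intro a x t hx
    rw [dist_eq_norm] at hx
    refine ⟨a + ((r - t) / r) • (x - a), ?_, ?_⟩
    · rw [dist_eq_norm, show x - (a + ((r - t) / r) • (x - a)) = (1 - (r - t) / r) • (x - a) by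
        module, norm_smul, hx, show 1 - (r - t) / r = t / r by field_simp; ring, Real.norm_eq_abs,
        abs_div, abs_of_pos hr0]
      field_simp
    · rw [dist_eq_norm, add_sub_cancel_left, norm_smul, hx, Real.norm_eq_abs, abs_div,
        abs_of_pos hr0]
      field_simp
  have hfr : ∀ x ∈ frontier (Metric.closedBall a r ∪ Metric.closedBall b r),
      dist x a = r ∨ dist x b = r := by
    intro x hx
    rcases frontier_union_subset _ _ hx with h | h
    · exact Or.inl (Metric.frontier_closedBall_subset_sphere h.1)
    · exact Or.inr (Metric.frontier_closedBall_subset_sphere h.2)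
  have hin : ∀ a x : Eucl d, dist x a = r → ∃ y, dist x y = δ ∧
      Metric.ball y δ ⊆ Metric.closedBall a r := by
    intro a x hx
    obtain ⟨y, h1, h2⟩ := key a x δ hx
    rw [abs_of_pos hδ] at h1
    rw [abs_of_nonneg (by linarith)] at h2
    refine ⟨y, h1, fun z hz ↦ ?_⟩
    have := dist_triangle z y a
    rw [Metric.mem_ball] at hz
    rw [Metric.mem_closedBall]
    linarith
  have hout : ∀ a b x : Eucl d, dist x a = r → (a = b ∨ 2 * r + 2 * δ < dist a b) →
      ∃ y, dist x y = δ ∧ Metric.ball y δ ⊆ (Metric.closedBall a r ∪ Metric.closedBall b r)ᶜ := by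
    intro a b x hx hab
    obtain ⟨y, h1, h2⟩ := key a x (-δ) hx
    rw [abs_neg, abs_of_pos hδ] at h1
    rw [abs_of_nonneg (by linarith)] at h2
    refine ⟨y, h1, fun z hz ↦ ?_⟩
    rw [Metric.mem_ball] at hz
    have hza : r < dist z a := by
      have := dist_triangle y z a
      rw [dist_comm y z] at this
      linarith
    rintro (h | h)
    · exact absurd (Metric.mem_closedBall.1 h) (not_le.2 hza)
    · rw [Metric.mem_closedBall] at h
      rcases hab with rfl | hab
      · linarith
      · have h3 := dist_triangle z y a
        have h4 := dist_triangle_left a b z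
        linarith
  refine ⟨Metric.isClosed_closedBall.union Metric.isClosed_closedBall, fun x hx ↦ ?_, fun x hx ↦ ?_⟩
  · rcases hfr x hx with h | h
    · obtain ⟨y, h1, h2⟩ := hin a x h
      exact ⟨y, h1, h2.trans subset_union_left⟩
    · obtain ⟨y, h1, h2⟩ := hin b x h
      exact ⟨y, h1, h2.trans subset_union_right⟩
  · rcases hfr x hx with h | h
    · exact hout a b x h hab
    · rw [union_comm]
      exact hout b a x h (by rw [eq_comm, dist_comm]; exact hab)

section TwoBalls

variable [NeZero d]

/-- Charge each ball with one half. The two self-interactions and the two cross terms each carry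
weight `1 / 4`; the former are about `-log r`, the latter at most `-log (‖p‖ - 2 r)`. -/
lemma Ilog_two_balls_le {E : Set (Eucl d)} {p : Eucl d} {r : ℝ} (hr : 0 < r) (hp : 2 * r < ‖p‖)
    (hp1 : 1 ≤ ‖p‖) (h1 : Metric.ball 0 r ∪ Metric.ball p r ⊆ E)
    (h2 : E ⊆ Metric.closedBall 0 r ∪ Metric.closedBall p r) :
    Ilog E ≤ (((ballConst d).toReal - Real.log r - Real.log (‖p‖ - 2 * r)) / 2 : ℝ) := by
  -- The logarithm of a bound for the diameter, nonnegative since `1 ≤ ‖p‖`; it cancels in the final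
  -- estimate.
  set c := Real.log (‖p‖ + 2 * r) with hc
  have hpos : 0 < ‖p‖ + 2 * r := by linarith
  have hc0 : 0 ≤ c := Real.log_nonneg (by linarith)
  have hexp : Real.exp c = ‖p‖ + 2 * r := Real.exp_log hpos
  let x : Fin 2 → Eucl d := ![0, p]
  have := isProbabilityMeasure_multiBallMeasure two_ne_zero x r
  have hdiam : ∀ y ∈ closure E, ∀ z ∈ closure E, ‖y - z‖ ≤ Real.exp c := by
    have hcl := closure_subset_two_closedBalls h2
    intro y hy z hz
    rw [hexp, ← dist_eq_norm]
    have hp' : dist (0 : Eucl d) p = ‖p‖ := by simp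
    rcases hcl hy with hy | hy <;> rcases hcl hz with hz | hz <;>
      rw [Metric.mem_closedBall] at hy hz
    · have := dist_triangle_right y z 0; linarith [norm_nonneg p]
    · have h3 : dist y z ≤ dist y 0 + dist 0 p + dist z p := by
        have := dist_triangle4 y 0 p z
        rwa [dist_comm p z] at this
      linarith
    · have h3 : dist y z ≤ dist y p + dist p 0 + dist z 0 := by
        have := dist_triangle4 y p 0 z
        rwa [dist_comm 0 z] at this
      rw [dist_comm p 0] at h3
      linarith
    · have := dist_triangle_right y z p; linarith [norm_nonneg p]
  have hae : ∀ᵐ y ∂(multiBallMeasure x r), y ∈ closure E := by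
    filter_upwards [ae_multiBallMeasure x hr] with y hy
    apply subset_closure (h1 _)
    obtain ⟨i, hi⟩ := mem_iUnion.1 hy
    fin_cases i
    · exact Or.inl hi
    · exact Or.inr hi
  refine (Ilog_le_mutualEnergy hc0 hdiam hae).trans ?_
  have hlr : 0 ≤ c - Real.log r := sub_nonneg.2 (Real.log_le_log hr (by linarith))
  have hlp : 0 ≤ c - Real.log (‖p‖ - 2 * r) :=
    sub_nonneg.2 (Real.log_le_log (by linarith) (by linarith))
  have hC := ballConst_ne_top (d := d)
  have hself : ∀ y : Eucl d, mutualEnergy c (ballMeasure y r) (ballMeasure y r) ≤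
      ENNReal.ofReal (c - Real.log r + (ballConst d).toReal) := by
    intro y
    rw [ENNReal.ofReal_add hlr ENNReal.toReal_nonneg, ENNReal.ofReal_toReal hC]
    exact mutualEnergy_ballMeasure_self_le c y hr
  have hfar : ∀ y ∈ Metric.ball (0 : Eucl d) r, ∀ z ∈ Metric.ball p r,
      ‖p‖ - 2 * r ≤ ‖y - z‖ := by
    intro y hy z hz
    rw [← dist_eq_norm]
    rw [Metric.mem_ball] at hy hz
    have := dist_triangle4 0 y z p
    have hp' : dist (0 : Eucl d) p = ‖p‖ := by simp
    rw [dist_comm 0 y] at this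
    linarith
  have hc1 : mutualEnergy c (ballMeasure 0 r) (ballMeasure p r) ≤
      ENNReal.ofReal (c - Real.log (‖p‖ - 2 * r)) :=
    mutualEnergy_le_of_dist (by linarith) hfar (ae_ballMeasure 0 hr) (ae_ballMeasure p hr)
  have hc2 : mutualEnergy c (ballMeasure p r) (ballMeasure 0 r) ≤
      ENNReal.ofReal (c - Real.log (‖p‖ - 2 * r)) :=
    mutualEnergy_le_of_dist (by linarith)
      (fun y hy z hz ↦ by rw [norm_sub_rev]; exact hfar z hz y hy)
      (ae_ballMeasure p hr) (ae_ballMeasure 0 hr)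
  have htot : mutualEnergy c (multiBallMeasure x r) (multiBallMeasure x r) ≤
      ENNReal.ofReal ((c - Real.log r + (ballConst d).toReal + (c - Real.log (‖p‖ - 2 * r))) / 2) := by
    rw [mutualEnergy_multiBallMeasure]
    simp only [Fin.sum_univ_two, x, Matrix.cons_val_zero, Matrix.cons_val_one]
    set s := c - Real.log r + (ballConst d).toReal with hs
    set t := c - Real.log (‖p‖ - 2 * r) with ht
    have hs0 : 0 ≤ s := add_nonneg hlr ENNReal.toReal_nonneg
    calc _ ≤ ((2 : ℕ) : ℝ≥0∞)⁻¹ * (((2 : ℕ) : ℝ≥0∞)⁻¹ * (ENNReal.ofReal s + ENNReal.ofReal t +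
          (ENNReal.ofReal t + ENNReal.ofReal s))) := by
          gcongr
          · exact hself 0
          · exact hself p
      _ = _ := by
          have h2 : ((2 : ℕ) : ℝ≥0∞)⁻¹ = ENNReal.ofReal (1 / 2) := by
            rw [one_div, ENNReal.ofReal_inv_of_pos two_pos]; simp
          rw [h2, ← ENNReal.ofReal_add hs0 hlp, ← ENNReal.ofReal_add hlp hs0,
            ← ENNReal.ofReal_add (by linarith) (by linarith), ← ENNReal.ofReal_mul (by norm_num),
            ← ENNReal.ofReal_mul (by norm_num)]
          congr 1; ring
  have hnn : 0 ≤ (c - Real.log r + (ballConst d).toReal + (c - Real.log (‖p‖ - 2 * r))) / 2 := by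
    have := (ENNReal.toReal_nonneg : 0 ≤ (ballConst d).toReal)
    linarith
  calc _ ≤ (((ENNReal.ofReal ((c - Real.log r + (ballConst d).toReal +
          (c - Real.log (‖p‖ - 2 * r))) / 2)) : ℝ≥0∞) : EReal) - (c : EReal) :=
        EReal.sub_le_sub (by exact_mod_cast htot) le_rfl
    _ = _ := by
        rw [EReal.coe_ennreal_ofReal, max_eq_left hnn, ← EReal.coe_sub]
        congr 1; ring

/-- Two balls far apart have arbitrarily negative energy. -/
lemma exists_far_balls {Q r : ℝ} (hQ : 0 < Q) (hr : 0 < r) (D M : ℝ) :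
    ∃ p : Eucl d, D < ‖p‖ ∧ 2 * r < ‖p‖ ∧
      ∀ E : Set (Eucl d), MeasurableSet E → Metric.ball 0 r ∪ Metric.ball p r ⊆ E →
        E ⊆ Metric.closedBall 0 r ∪ Metric.closedBall p r → logFunctional Q E ≤ (M : EReal) := by
  set P := d * unitBallVolume d * r ^ (d - 1) with hP
  have hP0 : 0 ≤ P := by have := (unitBallVolume_pos (d := d)).le; positivity
  have hlim : Tendsto (fun R : ℝ ↦ (P + P) +
      Q ^ 2 * (((ballConst d).toReal - Real.log r - Real.log (R - 2 * r)) / 2)) atTop atBot := by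
    have h1 : Tendsto (fun R : ℝ ↦ Real.log (R - 2 * r)) atTop atTop :=
      Real.tendsto_log_atTop.comp (tendsto_atTop_add_const_right _ _ tendsto_id)
    refine tendsto_atBot_add_const_left _ _ (Tendsto.const_mul_atBot (by positivity) ?_)
    refine Tendsto.atBot_div_const two_pos ?_
    exact tendsto_atBot_add_const_left _ _ (tendsto_neg_atTop_atBot.comp h1)
  obtain ⟨R, hRM, hRD, hR2, hR1⟩ := ((hlim.eventually_le_atBot M).and
    ((eventually_gt_atTop D).and ((eventually_gt_atTop (2 * r)).and (eventually_ge_atTop 1)))).exists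
  obtain ⟨p, hp⟩ := exists_norm_eq (Eucl d) (by linarith : 0 ≤ R)
  refine ⟨p, by rw [hp]; exact hRD, by rw [hp]; exact hR2, fun E hE h1 h2 ↦ ?_⟩
  have hI := Ilog_two_balls_le hr (by rw [hp]; exact hR2) (by rw [hp]; exact hR1) h1 h2
  have hper : perimeter E ≤ ((P + P : ℝ) : EReal) := by
    -- The open and the closed pair differ by a null set, so every set between them has the
    -- perimeter of the open pair. One estimate thus serves open competitors and closed ones.
    have hEae : E =ᵐ[volume] (Metric.ball 0 r ∪ Metric.ball p r : Set (Eucl d)) := by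
      have hae : (Metric.ball 0 r ∪ Metric.ball p r : Set (Eucl d)) =ᵐ[volume]
          (Metric.closedBall 0 r ∪ Metric.closedBall p r : Set (Eucl d)) :=
        (ball_ae_eq_closedBall 0 r).union (ball_ae_eq_closedBall p r)
      refine EventuallyLE.antisymm ?_ (LE.le.eventuallyLE h1)
      exact (LE.le.eventuallyLE h2).trans_eq hae.symm
    rw [perimeter_eq_tv hE, tv_indicator_congr hEae]
    have := (tv_union_le (d := d) (Metric.isOpen_ball.measurableSet (s := Metric.ball 0 r))
      (Metric.isOpen_ball.measurableSet (s := Metric.ball p r)) Metric.isBounded_ball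
      Metric.isBounded_ball).trans (add_le_add (tv_ball_le 0 hr) (tv_ball_le p hr))
    rw [← hP, ← ENNReal.ofReal_add hP0 hP0] at this
    refine (EReal.coe_ennreal_le_coe_ennreal_iff.2 this).trans ?_
    rw [EReal.coe_ennreal_ofReal, max_eq_left (by positivity)]
  refine (logFunctional_le hper hI).trans ?_
  rw [hp]
  exact_mod_cast hRM

lemma volume_two_balls {r m : ℝ} (hr : 0 < r) (hrm : r ^ d * unitBallVolume d = m / 2)
    {p : Eucl d} (hp : 2 * r < ‖p‖) :
    volume (Metric.ball 0 r ∪ Metric.ball p r) = ENNReal.ofReal m := by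
  have hdisj : Disjoint (Metric.ball (0 : Eucl d) r) (Metric.ball p r) :=
    Metric.ball_disjoint_ball (by rw [dist_zero_left]; linarith)
  have hm : 0 ≤ m / 2 := hrm ▸ mul_nonneg (by positivity) unitBallVolume_pos.le
  rw [measure_union hdisj Metric.isOpen_ball.measurableSet, volume_ball_eq _ hr.le,
    volume_ball_eq _ hr.le, hrm, ← ENNReal.ofReal_add hm hm, add_halves]

theorem iInf_open_eq_bot {Q m : ℝ} (hQ : 0 < Q) (hm : 0 < m) :
    (⨅ E ∈ {E : Set (Eucl d) |
        IsOpen E ∧ Bornology.IsBounded E ∧ volume E = ENNReal.ofReal m},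
      logFunctional Q E) = ⊥ := by
  obtain ⟨r, hr, hrm⟩ := exists_radius (d := d) (half_pos hm)
  refine iInf_eq_bot_of_forall_le fun M ↦ ?_
  obtain ⟨p, -, hp, hE⟩ := exists_far_balls (d := d) hQ hr 0 M
  have ho : IsOpen (Metric.ball 0 r ∪ Metric.ball p r) := Metric.isOpen_ball.union Metric.isOpen_ball
  exact ⟨Metric.ball 0 r ∪ Metric.ball p r, ⟨ho, Metric.isBounded_ball.union Metric.isBounded_ball,
    volume_two_balls hr hrm hp⟩, hE _ ho.measurableSet subset_rfl
      (union_subset_union Metric.ball_subset_closedBall Metric.ball_subset_closedBall)⟩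

theorem iInf_ballClass_eq_bot {Q m δ : ℝ} (hQ : 0 < Q) (hδ : 0 < δ)
    (hm : 2 * unitBallVolume d * δ ^ d < m) :
    (⨅ E ∈ {E | E ∈ ballClass d δ ∧ volume E = ENNReal.ofReal m}, logFunctional Q E) = ⊥ := by
  have hω := unitBallVolume_pos (d := d)
  have hm0 : 0 < m := lt_of_le_of_lt (by positivity) hm
  obtain ⟨r, hr, hrm⟩ := exists_radius (d := d) (half_pos hm0)
  have hδr : δ ≤ r := by
    refine (lt_of_pow_lt_pow_left₀ d hr.le (lt_of_mul_lt_mul_right ?_ hω.le)).le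
    rw [hrm]; linarith
  refine iInf_eq_bot_of_forall_le fun M ↦ ?_
  obtain ⟨p, hpD, hp, hE⟩ := exists_far_balls (d := d) hQ hr (2 * r + 2 * δ) M
  have hmem := two_closedBalls_mem_ballClass hδ hδr (a := 0) (b := p)
    (Or.inr (by rw [dist_zero_left]; exact hpD))
  refine ⟨Metric.closedBall 0 r ∪ Metric.closedBall p r, ⟨hmem, ?_⟩, hE _ hmem.1.measurableSet
      (union_subset_union Metric.ball_subset_closedBall Metric.ball_subset_closedBall) subset_rfl⟩
  rw [← volume_two_balls hr hrm hp]
  exact measure_congr ((ball_ae_eq_closedBall 0 r).union (ball_ae_eq_closedBall p r)).symm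

end TwoBalls

end ChargedDrop

/-! ### Lower semicontinuity of the logarithmic energy. -/

namespace ChargedDrop
open Filter Topology
open scoped ENNReal NNReal

variable {d : ℕ}

/-- Continuous truncations of the kernel, increasing to `kern c`. -/
noncomputable def truncKern (c : ℝ) (n : ℕ) (z : Eucl d) : ℝ :=
  max 0 (c - Real.log (max ‖z‖ (Real.exp (-n))))

lemma continuous_truncKern (c : ℝ) (n : ℕ) : Continuous (truncKern (d := d) c n) := by
  refine continuous_const.max (continuous_const.sub (Continuous.log (by fun_prop) fun z ↦ ?_))
  exact (lt_max_of_lt_right (Real.exp_pos _)).ne'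

lemma monotone_truncKern (c : ℝ) (z : Eucl d) : Monotone fun n ↦ truncKern c n z := by
  intro n k h
  refine max_le_max le_rfl (sub_le_sub_left (Real.log_le_log (lt_max_of_lt_right (Real.exp_pos _))
    (max_le_max le_rfl (Real.exp_le_exp.2 ?_))) _)
  simpa using h

lemma iSup_truncKern (c : ℝ) (z : Eucl d) : ⨆ n, ENNReal.ofReal (truncKern c n z) = kern c z := by
  refine le_antisymm (iSup_le fun n ↦ ?_) ?_
  · rw [truncKern, ENNReal.ofReal_max, ENNReal.ofReal_zero, max_eq_right zero_le]
    by_cases hz : z = 0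
    · simp [hz, kern_zero]
    · rw [kern_of_ne c hz]
      exact ENNReal.ofReal_le_ofReal (sub_le_sub_left
        (Real.log_le_log (norm_pos_iff.2 hz) (le_max_left _ _)) _)
  · by_cases hz : z = 0
    · rw [hz, kern_zero, top_le_iff]
      refine ENNReal.eq_top_of_forall_nnreal_le fun r ↦ ?_
      obtain ⟨n, hn⟩ := exists_nat_gt ((r : ℝ) - c)
      refine le_trans ?_ (le_iSup _ n)
      rw [truncKern, ENNReal.le_ofReal_iff_toReal_le ENNReal.coe_ne_top (le_max_left _ _), ENNReal.coe_toReal]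
      refine le_max_of_le_right ?_
      rw [norm_zero, max_eq_right (Real.exp_pos _).le, Real.log_exp]
      linarith
    · rw [kern_of_ne c hz]
      obtain ⟨n, hn⟩ := exists_nat_gt (-Real.log ‖z‖)
      refine le_trans (ENNReal.ofReal_le_ofReal ?_)
        (le_iSup (fun n ↦ ENNReal.ofReal (truncKern c n z)) n)
      rw [truncKern, max_eq_left (a := ‖z‖)]
      · exact le_max_right _ _
      · rw [← Real.le_log_iff_exp_le (norm_pos_iff.2 hz)]; linarith

lemma mutualEnergy_eq_lintegral_prod (c : ℝ) (μ ν : Measure (Eucl d)) [SFinite ν] :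
    mutualEnergy c μ ν = ∫⁻ p, kern c (p.1 - p.2) ∂(μ.prod ν) := by
  rw [mutualEnergy, lintegral_prod]
  exact ((measurable_kern c).comp (measurable_fst.sub measurable_snd)).aemeasurable

lemma mutualEnergy_eq_iSup (c : ℝ) (μ : Measure (Eucl d)) [SFinite μ] :
    mutualEnergy c μ μ = ⨆ n, ∫⁻ p, ENNReal.ofReal (truncKern c n (p.1 - p.2)) ∂(μ.prod μ) := by
  have hm (n : ℕ) : Measurable fun p : Eucl d × Eucl d ↦
      ENNReal.ofReal (truncKern c n (p.1 - p.2)) :=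
    ((continuous_truncKern c n).comp (continuous_fst.sub continuous_snd)).measurable.ennreal_ofReal
  rw [mutualEnergy_eq_lintegral_prod, ← lintegral_iSup hm
    fun k l hkl p ↦ ENNReal.ofReal_le_ofReal (monotone_truncKern c _ hkl)]
  exact lintegral_congr fun p ↦ (iSup_truncKern c _).symm

/-- The kernel is an increasing limit of continuous truncations. Each truncated energy is lower
semicontinuous under weak convergence of the product measures, and so is their supremum. -/
lemma mutualEnergy_le_liminf (c : ℝ) {μ : ProbabilityMeasure (Eucl d)}
    {μs : ℕ → ProbabilityMeasure (Eucl d)} (h : Tendsto μs atTop (𝓝 μ)) :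
    mutualEnergy c (μ : Measure (Eucl d)) μ ≤
      liminf (fun n ↦ mutualEnergy c (μs n : Measure (Eucl d)) (μs n)) atTop := by
  have hprod : Tendsto (fun n ↦ (μs n).prod (μs n)) atTop (𝓝 (μ.prod μ)) :=
    (ProbabilityMeasure.continuous_prod.tendsto (μ, μ)).comp (h.prodMk_nhds h)
  rw [mutualEnergy_eq_iSup]
  refine iSup_le fun k ↦ ?_
  have hcont : Continuous fun p : Eucl d × Eucl d ↦ truncKern c k (p.1 - p.2) :=
    (continuous_truncKern c k).comp (continuous_fst.sub continuous_snd)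
  have hnn : 0 ≤ fun p : Eucl d × Eucl d ↦ truncKern c k (p.1 - p.2) := fun p ↦ le_max_left _ _
  have hopen (G : Set (Eucl d × Eucl d)) (hG : IsOpen G) :
      ((μ : Measure (Eucl d)).prod μ) G ≤
        liminf (fun n ↦ ((μs n : Measure (Eucl d)).prod (μs n)) G) atTop :=
    ProbabilityMeasure.le_liminf_measure_open_of_tendsto hprod hG
  refine (lintegral_le_liminf_lintegral_of_forall_isOpen_measure_le_liminf_measure
    hcont hnn hopen).trans (liminf_le_liminf (Eventually.of_forall fun n ↦ ?_))
  rw [mutualEnergy_eq_iSup]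
  exact le_iSup (fun k ↦ ∫⁻ p, ENNReal.ofReal (truncKern c k (p.1 - p.2))
    ∂((μs n : Measure (Eucl d)).prod (μs n))) k

/-- Upper semicontinuity of a sequence of closed sets gives lower semicontinuity of `Ilog`. -/
lemma Ilog_le_of_forall_open {E : Set (Eucl d)} {F : ℕ → Set (Eucl d)} {R : ℝ}
    (hE : IsClosed E) (hER : E ⊆ Metric.closedBall 0 R) (hF : ∀ n, IsClosed (F n))
    (hFR : ∀ n, F n ⊆ Metric.closedBall 0 R)
    (hlim : ∀ W, IsOpen W → E ⊆ W → ∀ᶠ n in atTop, F n ⊆ W) {a : EReal}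
    (ha : ∀ n, Ilog (F n) < a) : Ilog E ≤ a := by
  set c : ℝ := max 0 (2 * R)
  have hc : 0 ≤ c := le_max_left _ _
  have hdiam {S : Set (Eucl d)} (hS : IsClosed S) (hSR : S ⊆ Metric.closedBall 0 R) :
      ∀ x ∈ closure S, ∀ y ∈ closure S, ‖x - y‖ ≤ Real.exp c := by
    rw [hS.closure_eq]
    intro x hx y hy
    have h1 := mem_closedBall_zero_iff.1 (hSR hx)
    have h2 := mem_closedBall_zero_iff.1 (hSR hy)
    have h3 := norm_sub_le x y
    have h4 := Real.add_one_le_exp c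
    have h5 : 2 * R ≤ c := le_max_right _ _
    linarith
  -- Nearly optimal charges for the sets `F n`. All are carried by one closed ball, so they are
  -- tight and have a weak limit point.
  choose μ hμp hμF hμa using fun n ↦ exists_mutualEnergy_lt hc (hdiam (hF n) (hFR n)) (ha n)
  let μs : ℕ → ProbabilityMeasure (Eucl d) := fun n ↦ ⟨μ n, hμp n⟩
  have hK := isCompact_setOfPred_probabilityMeasure_mass_eq_compl_isCompact_le
    (u := fun _ : ℕ ↦ (0 : ℝ≥0)) (K := fun _ ↦ Metric.closedBall (0 : Eucl d) R)
    tendsto_const_nhds (fun _ ↦ isCompact_closedBall _ _) (Or.inl inferInstance)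
  obtain ⟨ν, -, φ, hφ, hν⟩ := hK.tendsto_subseq (x := μs) fun n k ↦ by
    have h0 : (μ n) (Metric.closedBall 0 R)ᶜ = 0 := by
      rw [← mem_ae_iff]
      filter_upwards [hμF n] with x hx
      rw [(hF n).closure_eq] at hx
      exact hFR n hx
    change ((μ n) _).toNNReal ≤ 0
    rw [h0]; simp
  -- A point off `E` has a small ball which the sets `F n` eventually avoid; the portmanteau
  -- inequality leaves no limit mass there.
  have hνE : ∀ᵐ x ∂(ν : Measure (Eucl d)), x ∈ closure E := by
    rw [hE.closure_eq]
    refine measure_null_of_locally_null _ fun x hx ↦ ?_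
    obtain ⟨ε, hε, hball⟩ := Metric.isOpen_iff.1 hE.isOpen_compl x hx
    refine ⟨Metric.ball x (ε / 2), mem_nhdsWithin_of_mem_nhds (Metric.ball_mem_nhds _ (half_pos hε)),
      le_antisymm ?_ zero_le⟩
    refine (ProbabilityMeasure.le_liminf_measure_open_of_tendsto hν Metric.isOpen_ball).trans ?_
    have hW := hφ.tendsto_atTop.eventually (hlim (Metric.closedBall x (ε / 2))ᶜ
      Metric.isClosed_closedBall.isOpen_compl fun y hy hyb ↦ hball (Metric.closedBall_subset_ball
        (half_lt_self hε) hyb) hy)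
    refine le_of_eq (Tendsto.liminf_eq (tendsto_const_nhds.congr' ?_))
    filter_upwards [hW] with n hn
    refine (measure_mono_null ?_ (hμF (φ n))).symm
    intro y hy hyF
    rw [(hF _).closure_eq] at hyF
    exact hn hyF (Metric.ball_subset_closedBall hy)
  refine (Ilog_le_mutualEnergy hc (hdiam hE hER) hνE).trans ?_
  have hle := mutualEnergy_le_liminf c hν
  by_contra! hlt
  -- An intermediate `b` turns the assumed strict excess of the limit energy into a bound, uniform
  -- along the sequence, that contradicts semicontinuity.
  obtain ⟨b, hab, hb⟩ := exists_between hlt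
  refine absurd hle (not_le.2 ?_)
  have hbc : b + (c : EReal) < mutualEnergy c (ν : Measure (Eucl d)) ν := by
    have := EReal.add_lt_of_lt_sub hb
    exact this
  have hbound (n : ℕ) : ((mutualEnergy c (μ n) (μ n) : ℝ≥0∞) : EReal) ≤ b + c := by
    have := ((hμa n).trans hab).le
    exact (EReal.sub_le_iff_le_add (Or.inl (EReal.coe_ne_bot c)) (Or.inl (EReal.coe_ne_top c))).1 this
  have hb0 : 0 ≤ b + (c : EReal) := (EReal.coe_ennreal_nonneg _).trans (hbound 0)
  have h1 : liminf (fun n ↦ mutualEnergy c (((μs ∘ φ) n : ProbabilityMeasure (Eucl d)) :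
      Measure (Eucl d)) ((μs ∘ φ) n)) atTop ≤ (b + (c : EReal)).toENNReal := by
    refine liminf_le_of_le (by isBoundedDefault) fun t ht ↦ ?_
    obtain ⟨n, hn⟩ := ht.exists
    refine hn.trans ?_
    rw [← EReal.coe_ennreal_le_coe_ennreal_iff, EReal.coe_toENNReal hb0]
    exact hbound _
  refine h1.trans_lt ?_
  rw [← EReal.coe_ennreal_lt_coe_ennreal_iff, EReal.coe_toENNReal hb0]
  exact hbc

end ChargedDrop

/-! ### Diameter bound and translation invariance for connected sets with the ball condition. -/

namespace ChargedDrop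
open Filter Topology
open scoped ENNReal NNReal

variable {d : ℕ}

lemma _root_.IsPreconnected.inter_frontier_nonempty' {X : Type*} [TopologicalSpace X] {s E : Set X}
    (hs : IsPreconnected s) (h1 : (s ∩ E).Nonempty) (h2 : (s ∩ Eᶜ).Nonempty) :
    (s ∩ frontier E).Nonempty := by
  by_contra h
  rw [not_nonempty_iff_eq_empty] at h
  have hsub : s ⊆ interior E ∪ interior Eᶜ := by
    intro x hx
    by_contra hxu
    rw [mem_union, not_or] at hxu
    have : x ∈ s ∩ frontier E := ⟨hx, by rw [frontier_eq_inter_compl_interior]; exact hxu⟩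
    rw [h] at this
    exact this
  have hd : Disjoint (interior E) (interior Eᶜ) :=
    disjoint_compl_right.mono interior_subset interior_subset
  rcases hs.subset_or_subset isOpen_interior isOpen_interior hd hsub with h | h
  · obtain ⟨x, hx, hxE⟩ := h2
    exact hxE (interior_subset (h hx))
  · obtain ⟨x, hx, hxE⟩ := h1
    exact interior_subset (h hx) hxE

lemma isPreconnected_ball (x : Eucl d) (r : ℝ) : IsPreconnected (Metric.ball x r) :=
  (convex_ball x r).isPreconnected

/-- Either the ball about `x` lies in `E`, or it crosses the frontier within distance `δ`, and the
interior ball at the crossing point has its centre within `2 δ` of `x`. -/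
lemma exists_ball_subset_of_mem {δ : ℝ} (hδ : 0 < δ) {E : Set (Eucl d)} (hE : E ∈ ballClass d δ)
    {x : Eucl d} (hx : x ∈ E) : ∃ y, dist x y ≤ 2 * δ ∧ Metric.ball y δ ⊆ E := by
  by_cases h : Metric.ball x δ ⊆ E
  · exact ⟨x, by rw [dist_self]; positivity, h⟩
  · obtain ⟨z, hz, hzE⟩ := not_subset.1 h
    obtain ⟨w, hw, hwE⟩ := (isPreconnected_ball x δ).inter_frontier_nonempty'
      ⟨x, Metric.mem_ball_self hδ, hx⟩ ⟨z, hz, hzE⟩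
    obtain ⟨y, hy, hyE⟩ := hE.2.1 w hwE
    refine ⟨y, ?_, hyE⟩
    have := dist_triangle x w y
    rw [dist_comm x w] at this
    have := Metric.mem_ball.1 hw
    linarith

section Diameter

variable [NeZero d]

/-- Connected sets in `K_δ` have diameter bounded in terms of their volume. -/
lemma subset_closedBall_of_connected {δ m : ℝ} (hδ : 0 < δ) {N : ℕ}
    (hN : m < N * (δ ^ d * unitBallVolume d)) {E : Set (Eucl d)} (hE : E ∈ connectedBallClass d δ)
    (hm : volume E = ENNReal.ofReal m) {x : Eucl d} (hx : x ∈ E) :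
    E ⊆ Metric.closedBall x (6 * δ * N) := by
  intro z hz
  by_contra hzx
  rw [Metric.mem_closedBall, not_le] at hzx
  have hω : 0 < δ ^ d * unitBallVolume d := mul_pos (by positivity) unitBallVolume_pos
  -- By connectedness the distance to `x` takes every value `6 δ k` on `E`. The interior balls near
  -- these points have centres at least `6 δ - 2 · 2 δ = 2 δ` apart, so they are disjoint, and `N`
  -- of them exceed the volume `m`.
  have hpt (k : Fin N) : ∃ y, ∃ w, dist y w ≤ 2 * δ ∧ Metric.ball w δ ⊆ E ∧ dist y x = 6 * δ * k := by
    have hk : (k : ℝ) ≤ N := by exact_mod_cast k.2.le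
    obtain ⟨y, hy, hyx⟩ := hE.2.isPreconnected.intermediate_value hx hz (f := fun y ↦ dist y x)
      (by fun_prop) (⟨by rw [dist_self]; positivity, by nlinarith⟩ : 6 * δ * (k : ℝ) ∈ Icc _ _)
    obtain ⟨w, hw, hwE⟩ := exists_ball_subset_of_mem hδ hE.1 hy
    exact ⟨y, w, hw, hwE, hyx⟩
  choose y w hyw hwE hyx using hpt
  have hdist {i j : Fin N} (hij : i < j) : δ + δ ≤ dist (w i) (w j) := by
    have hij' : (i : ℝ) + 1 ≤ j := by exact_mod_cast hij
    have h1 := dist_triangle (y j) (y i) x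
    have h2 := dist_triangle4 (y j) (w j) (w i) (y i)
    have h3 := hyw i
    have h4 := hyw j
    rw [dist_comm] at h3
    rw [hyx, hyx] at h1
    rw [dist_comm (w j) (w i)] at h2
    nlinarith
  have hdisj : Pairwise (Function.onFun Disjoint fun k ↦ Metric.ball (w k) δ) := by
    intro i j hij
    apply Metric.ball_disjoint_ball
    rcases lt_or_gt_of_ne hij with h | h
    · exact hdist h
    · rw [dist_comm]; exact hdist h
  have hle : ∑' k, volume (Metric.ball (w k) δ) ≤ volume E := by
    rw [← measure_iUnion hdisj fun _ ↦ Metric.isOpen_ball.measurableSet]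
    exact measure_mono (iUnion_subset hwE)
  simp_rw [volume_ball_eq _ hδ.le, tsum_fintype, hm] at hle
  rw [Finset.sum_const, Finset.card_univ, Fintype.card_fin, nsmul_eq_mul,
    ← ENNReal.ofReal_natCast, ← ENNReal.ofReal_mul (by positivity)] at hle
  by_cases hm0 : 0 ≤ m
  · exact absurd ((ENNReal.ofReal_le_ofReal_iff hm0).1 hle) (not_le.2 hN)
  · rw [ENNReal.ofReal_of_nonpos (not_le.1 hm0).le, nonpos_iff_eq_zero,
      ENNReal.ofReal_eq_zero] at hle
    have hN0 : (N : ℝ) = 0 := le_antisymm (by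
      by_contra! h
      exact absurd hle (not_le.2 (mul_pos h hω))) (Nat.cast_nonneg N)
    have hE0 : volume E = 0 := by rw [hm, ENNReal.ofReal_of_nonpos (not_le.1 hm0).le]
    obtain ⟨y, -, hy⟩ := exists_ball_subset_of_mem hδ hE.1 hx
    exact (Metric.measure_ball_pos volume y hδ).ne' (measure_mono_null hy hE0)

end Diameter

section Translation

lemma tv_indicator_preimage_add_le (E : Set (Eucl d)) (a : Eucl d) :
    tv (((fun x ↦ x + a) ⁻¹' E).indicator 1) ≤ tv (E.indicator 1) := by
  refine tv_le fun φ hφ ↦ ?_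
  refine le_trans (le_of_eq ?_) (le_tv _ (testFields_translate hφ (-a)))
  congr 1
  refine Eq.trans ?_ (integral_add_right_eq_self _ a)
  refine integral_congr_ae (Eventually.of_forall fun x ↦ ?_)
  simp only [divergence_translate, add_neg_cancel_right]
  rfl

/-- Serves twice: with `a = 1` for translations, and with `a` close to `1` for pushing a charge
inside a smooth domain. -/
lemma mutualEnergy_map_le {c a : ℝ} (ha : 0 < a) {μ : Measure (Eucl d)} [IsProbabilityMeasure μ]
    {S : Set (Eucl d)} (hμ : ∀ᵐ x ∂μ, x ∈ S) {T : Eucl d → Eucl d} (hT : Measurable T)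
    (h : ∀ x ∈ S, ∀ y ∈ S, a * ‖x - y‖ ≤ ‖T x - T y‖) :
    mutualEnergy c (μ.map T) (μ.map T) ≤ mutualEnergy c μ μ + ENNReal.ofReal (-Real.log a) := by
  have hm (x : Eucl d) : Measurable fun y : Eucl d ↦ kern c (x - y) :=
    (measurable_kern c).comp (measurable_const.sub measurable_id)
  have hm2 : Measurable fun x : Eucl d ↦ ∫⁻ y, kern c (x - y) ∂(μ.map T) := by
    have : IsProbabilityMeasure (μ.map T) := Measure.isProbabilityMeasure_map hT.aemeasurable
    exact Measurable.lintegral_prod_right' (f := fun p : Eucl d × Eucl d ↦ kern c (p.1 - p.2))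
      ((measurable_kern c).comp (measurable_fst.sub measurable_snd))
  unfold mutualEnergy
  rw [lintegral_map hm2 hT]
  simp_rw [lintegral_map (hm _) hT]
  calc _ ≤ ∫⁻ x, ∫⁻ y, (kern c (x - y) + ENNReal.ofReal (-Real.log a)) ∂μ ∂μ := by
        refine lintegral_mono_ae ?_
        filter_upwards [hμ] with x hx
        refine lintegral_mono_ae ?_
        filter_upwards [hμ] with y hy
        exact kern_mono_add ha (h x hx y hy)
    _ = _ := by simp [lintegral_add_right]

lemma Ilog_preimage_add_le {c : ℝ} (hc : 0 ≤ c) {E : Set (Eucl d)}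
    (hE : ∀ x ∈ closure E, ∀ y ∈ closure E, ‖x - y‖ ≤ Real.exp c) (a : Eucl d) :
    Ilog ((fun x ↦ x + a) ⁻¹' E) ≤ Ilog E := by
  refine le_of_forall_gt fun b hb ↦ ?_
  obtain ⟨μ, hμ, hμE, hlt⟩ := exists_mutualEnergy_lt hc hE hb
  have hcl : closure ((fun x ↦ x + a) ⁻¹' E) = (fun x ↦ x + a) ⁻¹' closure E :=
    ((Homeomorph.addRight a).preimage_closure E).symm
  have hT : Measurable fun x : Eucl d ↦ x + -a := measurable_id.add_const _
  have : IsProbabilityMeasure (μ.map fun x ↦ x + -a) := Measure.isProbabilityMeasure_map hT.aemeasurable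
  have h1 : ∀ᵐ x ∂(μ.map fun x ↦ x + -a), x ∈ closure ((fun x ↦ x + a) ⁻¹' E) := by
    have hms : MeasurableSet {x | x ∈ closure ((fun x ↦ x + a) ⁻¹' E)} :=
      isClosed_closure.measurableSet
    rw [ae_map_iff hT.aemeasurable hms, hcl]
    filter_upwards [hμE] with x hx
    simpa using hx
  have hdiam : ∀ x ∈ closure ((fun x ↦ x + a) ⁻¹' E), ∀ y ∈ closure ((fun x ↦ x + a) ⁻¹' E),
      ‖x - y‖ ≤ Real.exp c := by
    rw [hcl]
    intro x hx y hy
    simpa using hE _ hx _ hy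
  refine (Ilog_le_mutualEnergy hc hdiam h1).trans_lt (lt_of_le_of_lt ?_ hlt)
  refine EReal.sub_le_sub ?_ le_rfl
  have := mutualEnergy_map_le (c := c) one_pos hμE hT (by simp)
  simpa using this

lemma preimage_add_mem_connectedBallClass {δ : ℝ} {E : Set (Eucl d)}
    (hE : E ∈ connectedBallClass d δ) (a : Eucl d) :
    (fun x ↦ x + a) ⁻¹' E ∈ connectedBallClass d δ := by
  obtain ⟨⟨hc, hi, he⟩, hcon⟩ := hE
  have key {F : Set (Eucl d)} {x : Eucl d} (h : ∃ y, dist (x + a) y = δ ∧ Metric.ball y δ ⊆ F) :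
      ∃ y, dist x y = δ ∧ Metric.ball y δ ⊆ (fun x ↦ x + a) ⁻¹' F := by
    obtain ⟨y, h1, h2⟩ := h
    refine ⟨y - a, ?_, fun z hz ↦ h2 ?_⟩
    · rw [← h1, dist_eq_norm, dist_eq_norm]; congr 1; abel
    · rw [Metric.mem_ball, dist_eq_norm] at hz ⊢
      rwa [show z + a - y = z - (y - a) by abel]
  have hfr : frontier ((fun x ↦ x + a) ⁻¹' E) = (fun x ↦ x + a) ⁻¹' frontier E :=
    ((Homeomorph.addRight a).preimage_frontier E).symm
  refine ⟨⟨hc.preimage (continuous_id.add continuous_const), fun x hx ↦ key (hi _ ?_),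
    fun x hx ↦ key (he _ ?_)⟩, (Homeomorph.addRight a).isConnected_preimage.2 hcon⟩
  · rw [hfr] at hx; exact hx
  · rw [hfr] at hx; exact hx

lemma logFunctional_preimage_add_le {E : Set (Eucl d)} (hE : MeasurableSet E)
    (hb : Bornology.IsBounded E) (Q : ℝ) (a : Eucl d) :
    logFunctional Q ((fun x ↦ x + a) ⁻¹' E) ≤ logFunctional Q E := by
  obtain ⟨C, hC⟩ := hb.closure.exists_norm_le
  have hdiam : ∀ x ∈ closure E, ∀ y ∈ closure E, ‖x - y‖ ≤ Real.exp (max 0 (2 * C)) := by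
    intro x hx y hy
    have h1 := hC x hx
    have h2 := hC y hy
    have h3 := norm_sub_le x y
    have h4 := Real.add_one_le_exp (max 0 (2 * C))
    have h5 := le_max_right 0 (2 * C)
    linarith
  have hE' : MeasurableSet ((fun x ↦ x + a) ⁻¹' E) := hE.preimage (measurable_id.add_const a)
  unfold logFunctional
  rw [perimeter_eq_tv hE, perimeter_eq_tv hE']
  refine add_le_add (EReal.coe_ennreal_le_coe_ennreal_iff.2 (tv_indicator_preimage_add_le E a))
    (mul_le_mul_of_nonneg_left (Ilog_preimage_add_le (le_max_left _ _) hdiam a) ?_)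
  exact_mod_cast sq_nonneg Q

end Translation

end ChargedDrop

/-! ### Compactness of `K_δ` and existence of a connected minimizer. -/

namespace ChargedDrop
open Filter Topology
open scoped ENNReal NNReal

variable {d : ℕ}

section Porous

variable [NeZero d]

/-- A set satisfying an exterior ball condition at all of its points is null. -/
lemma volume_eq_zero_of_ball {δ : ℝ} (hδ : 0 < δ) {Z : Set (Eucl d)} (hZ : MeasurableSet Z)
    (h : ∀ x ∈ Z, ∃ w, dist x w = δ ∧ Disjoint (Metric.ball w δ) Z) : volume Z = 0 := by
  -- Almost every point of `Z` is a density point, but the exterior ball forces the density ratio at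
  -- small radii to be at most `1 - 2⁻ᵈ`.
  have hae := Besicovitch.ae_tendsto_measure_inter_div_of_measurableSet (volume : Measure (Eucl d)) hZ
  rw [← compl_mem_ae_iff]
  filter_upwards [hae] with x hx hxZ
  rw [indicator_of_mem hxZ] at hx
  obtain ⟨w, hw, hwZ⟩ := h x hxZ
  have hw' : ‖w - x‖ = δ := by rw [← dist_eq_norm, dist_comm, hw]
  set q : ℝ := 1 - (1 / 2) ^ d with hq
  have hq1 : q < 1 := by have : (0 : ℝ) < (1 / 2) ^ d := by positivity
                         linarith
  have hq0 : 0 ≤ q := sub_nonneg.2 (pow_le_one₀ (by norm_num) (by norm_num))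
  have hω := unitBallVolume_pos (d := d)
  refine absurd (le_of_tendsto hx (b := ENNReal.ofReal q) ?_)
    (not_le.2 (by simpa using hq1))
  filter_upwards [Ioc_mem_nhdsGT hδ] with r hr
  have hr0 := hr.1
  -- The ball of radius `r / 2` about `z` is internally tangent at `x` to the exterior ball and fits
  -- inside the ball of radius `r` about `x`.
  set z : Eucl d := x + (r / (2 * δ)) • (w - x) with hz
  have hzx : dist z x = r / 2 := by
    rw [dist_eq_norm, hz, add_sub_cancel_left, norm_smul, hw', Real.norm_eq_abs,
      abs_of_pos (by positivity)]
    field_simp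
  have hzw : dist z w = δ - r / 2 := by
    rw [dist_eq_norm, hz, show x + (r / (2 * δ)) • (w - x) - w = (r / (2 * δ) - 1) • (w - x) by
      module, norm_smul, hw', Real.norm_eq_abs, abs_of_nonpos]
    · field_simp; ring
    · rw [sub_nonpos, div_le_one (by positivity)]; linarith [hr.2]
  have hsub1 : Metric.ball z (r / 2) ⊆ Metric.closedBall x r :=
    (Metric.ball_subset_ball' (by rw [hzx]; linarith)).trans Metric.ball_subset_closedBall
  have hsub2 : Metric.ball z (r / 2) ⊆ Metric.ball w δ :=
    Metric.ball_subset_ball' (by rw [hzw]; linarith)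
  have hsub : Z ∩ Metric.closedBall x r ⊆ Metric.closedBall x r \ Metric.ball z (r / 2) :=
    fun y hy ↦ ⟨hy.2, fun hyz ↦ hwZ.notMem_of_mem_left (hsub2 hyz) hy.1⟩
  have hvol : volume (Metric.closedBall x r) = ENNReal.ofReal (r ^ d * unitBallVolume d) := by
    rw [volume_closedBall_eq_ball, volume_ball_eq _ hr0.le]
  rw [ENNReal.div_le_iff (Metric.measure_closedBall_pos volume x hr0).ne'
    measure_closedBall_lt_top.ne]
  refine (measure_mono hsub).trans (le_of_eq ?_)
  rw [measure_sdiff hsub1 Metric.isOpen_ball.measurableSet.nullMeasurableSet measure_ball_lt_top.ne,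
    hvol, volume_ball_eq _ (by positivity), ← ENNReal.ofReal_sub _ (by positivity),
    ← ENNReal.ofReal_mul hq0]
  congr 1
  rw [hq, div_eq_mul_one_div r, mul_pow]
  ring

end Porous

lemma infDist_eq_zero_or (E : Set (Eucl d)) (x : Eucl d) :
    Metric.infDist x E = 0 ∨ Metric.infDist x Eᶜ = 0 := by
  by_cases h : x ∈ E
  · exact Or.inl (Metric.infDist_zero_of_mem h)
  · exact Or.inr (Metric.infDist_zero_of_mem h)

/-- Encodes a ball missing `E` as a lower bound on the distance function, an inequality that
survives pointwise limits. -/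
lemma sub_dist_le_infDist {E : Set (Eucl d)} (hne : E.Nonempty) {y : Eucl d} {δ : ℝ}
    (h : Metric.ball y δ ⊆ Eᶜ) (z : Eucl d) : δ - dist z y ≤ Metric.infDist z E := by
  refine (Metric.le_infDist hne).2 fun w hw ↦ ?_
  have h1 : δ ≤ dist w y := not_lt.1 fun hlt ↦ h (Metric.mem_ball.2 hlt) hw
  have := dist_triangle_left w y z
  linarith

section Compactness

variable [NeZero d]

/-- Compactness of the class `K_δ` for uniformly bounded sets. -/
theorem exists_subseq_ballClass {δ R : ℝ} (hδ : 0 < δ) {E : ℕ → Set (Eucl d)}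
    (hE : ∀ n, E n ∈ ballClass d δ) (hne : ∀ n, (E n).Nonempty)
    (hR : ∀ n, E n ⊆ Metric.closedBall 0 R) :
    ∃ φ : ℕ → ℕ, StrictMono φ ∧ ∃ F ∈ ballClass d δ, F ⊆ Metric.closedBall 0 R ∧
      (∀ W, IsOpen W → F ⊆ W → ∀ᶠ n in atTop, E (φ n) ⊆ W) ∧
      (∀ x ∈ F, Tendsto (fun n ↦ Metric.infDist x (E (φ n))) atTop (𝓝 0)) ∧
      ∀ᵐ x, ∀ᶠ n in atTop, x ∈ E (φ n) ↔ x ∈ F := by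
  have hcne (n : ℕ) : ((E n)ᶜ).Nonempty :=
    nonempty_compl_of_isBounded (Metric.isBounded_closedBall.subset (hR n))
  obtain ⟨p, hp⟩ := nonempty_compl_of_isBounded (Metric.isBounded_closedBall (x := (0 : Eucl d)) (r := R))
  -- Distances to the sets and to their complements are tracked together: the first limit defines
  -- the limit set, the second detects its interior.
  let f : ℕ → Fin 2 → Eucl d → ℝ := fun n i x ↦ Metric.infDist x (if i = 0 then E n else (E n)ᶜ)
  obtain ⟨φ, hφ, g, hgL, hg⟩ := exists_subseq_tendsto_of_lipschitz f (fun _ ↦ 1)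
    (fun n i ↦ Metric.lipschitz_infDist_pt _) fun i x ↦ by
      refine ⟨max (‖x‖ + R) (dist x p), fun n ↦ ?_⟩
      rw [abs_of_nonneg Metric.infDist_nonneg]
      fin_cases i
      · obtain ⟨e, he⟩ := hne n
        refine le_max_of_le_left ((Metric.infDist_le_dist_of_mem (y := e) (by simpa using he)).trans ?_)
        have := mem_closedBall_zero_iff.1 (hR n he)
        rw [dist_eq_norm]
        linarith [norm_sub_le x e]
      · refine le_max_of_le_right (Metric.infDist_le_dist_of_mem (y := p) ?_)
        have : p ∉ E n := fun h ↦ hp (hR n h)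
        simpa using this
  set G := fun n ↦ E (φ n) with hG
  have h0 (x : Eucl d) : Tendsto (fun n ↦ Metric.infDist x (G n)) atTop (𝓝 (g 0 x)) := by
    simpa [f] using hg 0 x
  have h1 (x : Eucl d) : Tendsto (fun n ↦ Metric.infDist x (G n)ᶜ) atTop (𝓝 (g 1 x)) := by
    simpa [f] using hg 1 x
  have hc0 : Continuous (g 0) := (hgL 0).continuous
  have hc1 : Continuous (g 1) := (hgL 1).continuous
  have hg0 (x) : 0 ≤ g 0 x := ge_of_tendsto' (h0 x) fun _ ↦ Metric.infDist_nonneg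
  have hg1 (x) : 0 ≤ g 1 x := ge_of_tendsto' (h1 x) fun _ ↦ Metric.infDist_nonneg
  have hmul (x) : g 0 x = 0 ∨ g 1 x = 0 := by
    rw [← mul_eq_zero]
    refine tendsto_nhds_unique ((h0 x).mul (h1 x)) (tendsto_const_nhds.congr fun n ↦ ?_)
    exact (mul_eq_zero.2 (infDist_eq_zero_or (G n) x)).symm
  -- interior and exterior balls at the points where both limit distances vanish
  have hball (x : Eucl d) (hx0 : g 0 x = 0) (hx1 : g 1 x = 0) : ∃ y w, dist x y = δ ∧ dist x w = δ ∧
      (∀ z, δ - dist z y ≤ g 1 z) ∧ ∀ z, δ - dist z w ≤ g 0 z := by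
    -- A ball about `x` slightly larger than both distances meets the set and its complement, hence
    -- the frontier. These frontier points tend to `x`, and the centres of their tangent balls
    -- subconverge.
    have hb (n : ℕ) : ∃ b ∈ frontier (G n), dist b x <
        Metric.infDist x (G n) + Metric.infDist x (G n)ᶜ + 1 / ((n : ℝ) + 1) := by
      have hn : 0 < 1 / ((n : ℝ) + 1) := by positivity
      have e0 : 0 ≤ Metric.infDist x (G n) := Metric.infDist_nonneg
      have e1 : 0 ≤ Metric.infDist x (G n)ᶜ := Metric.infDist_nonneg
      obtain ⟨u, hu, hxu⟩ := (Metric.infDist_lt_iff (hne (φ n))).1 (by linarith : Metric.infDist x (G n) <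
        Metric.infDist x (G n) + Metric.infDist x (G n)ᶜ + 1 / ((n : ℝ) + 1))
      obtain ⟨v, hv, hxv⟩ := (Metric.infDist_lt_iff (hcne (φ n))).1 (by linarith :
        Metric.infDist x (G n)ᶜ <
        Metric.infDist x (G n) + Metric.infDist x (G n)ᶜ + 1 / ((n : ℝ) + 1))
      obtain ⟨b, hb, hbf⟩ := (isPreconnected_ball x _).inter_frontier_nonempty'
        ⟨u, Metric.mem_ball'.2 hxu, hu⟩ ⟨v, Metric.mem_ball'.2 hxv, hv⟩
      exact ⟨b, hbf, Metric.mem_ball.1 hb⟩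
    choose b hbf hbx using hb
    choose y hy hyE using fun n ↦ (hE (φ n)).2.1 (b n) (hbf n)
    choose w hw hwE using fun n ↦ (hE (φ n)).2.2 (b n) (hbf n)
    have hbR (n : ℕ) : b n ∈ Metric.closedBall (0 : Eucl d) R :=
      hR (φ n) ((hE (φ n)).1.frontier_subset (hbf n))
    have hyR (n : ℕ) : (y n, w n) ∈ Metric.closedBall (0 : Eucl d) (R + δ) ×ˢ
        Metric.closedBall (0 : Eucl d) (R + δ) := by
      have := mem_closedBall_zero_iff.1 (hbR n)
      have e1 := norm_le_norm_add_norm_sub' (y n) (b n)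
      have e2 := norm_le_norm_add_norm_sub' (w n) (b n)
      rw [← dist_eq_norm', hy] at e1
      rw [← dist_eq_norm', hw] at e2
      exact ⟨mem_closedBall_zero_iff.2 (by linarith), mem_closedBall_zero_iff.2 (by linarith)⟩
    obtain ⟨⟨y', w'⟩, -, ψ, hψ, hlim⟩ := ((isCompact_closedBall (0 : Eucl d) (R + δ)).prod
      (isCompact_closedBall (0 : Eucl d) (R + δ))).tendsto_subseq hyR
    have hy' : Tendsto (fun n ↦ y (ψ n)) atTop (𝓝 y') := (continuous_fst.tendsto _).comp hlim
    have hw' : Tendsto (fun n ↦ w (ψ n)) atTop (𝓝 w') := (continuous_snd.tendsto _).comp hlim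
    have hbt : Tendsto b atTop (𝓝 x) := by
      rw [tendsto_iff_dist_tendsto_zero]
      refine squeeze_zero (fun _ ↦ dist_nonneg) (fun n ↦ (hbx n).le) ?_
      simpa [hx0, hx1] using ((h0 x).add (h1 x)).add tendsto_one_div_add_atTop_nhds_zero_nat
    have hbt' := hbt.comp hψ.tendsto_atTop
    refine ⟨y', w', ?_, ?_, fun z ↦ ?_, fun z ↦ ?_⟩
    · exact tendsto_nhds_unique (hbt'.dist hy') (tendsto_const_nhds.congr fun n ↦ (hy (ψ n)).symm)
    · exact tendsto_nhds_unique (hbt'.dist hw') (tendsto_const_nhds.congr fun n ↦ (hw (ψ n)).symm)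
    · refine le_of_tendsto_of_tendsto' (tendsto_const_nhds.sub (tendsto_const_nhds.dist hy'))
        ((h1 z).comp hψ.tendsto_atTop) fun n ↦ ?_
      exact sub_dist_le_infDist (hcne _) (by rw [compl_compl]; exact hyE (ψ n)) z
    · refine le_of_tendsto_of_tendsto' (tendsto_const_nhds.sub (tendsto_const_nhds.dist hw'))
        ((h0 z).comp hψ.tendsto_atTop) fun n ↦ ?_
      exact sub_dist_le_infDist (hne _) (hwE (ψ n)) z
  set F : Set (Eucl d) := {x | g 0 x = 0} with hF
  have hFc : IsClosed F := isClosed_eq hc0 continuous_const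
  -- Where `g 1` is positive it stays positive nearby, which forces `g 0 = 0` there: such a point is
  -- interior to `F`.
  have hfr (x) (hx : x ∈ frontier F) : g 0 x = 0 ∧ g 1 x = 0 := by
    refine ⟨hFc.frontier_subset hx, ?_⟩
    by_contra hne
    have hpos : 0 < g 1 x := lt_of_le_of_ne (hg1 x) (Ne.symm hne)
    refine hx.2 (mem_interior_iff_mem_nhds.2 ?_)
    filter_upwards [hc1.continuousAt.eventually (lt_mem_nhds hpos)] with z hz
    exact (hmul z).resolve_right hz.ne'
  have hupper (W : Set (Eucl d)) (hW : IsOpen W) (hFW : F ⊆ W) : ∀ᶠ n in atTop, G n ⊆ W := by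
    by_contra hcon
    obtain ⟨ψ, hψ, hψn⟩ := extraction_of_frequently_atTop (not_eventually.1 hcon)
    choose u hu huW using fun n ↦ not_subset.1 (hψn n)
    obtain ⟨x, hx, χ, hχ, hlim⟩ := ((isCompact_closedBall (0 : Eucl d) R).inter_right
      hW.isClosed_compl).tendsto_subseq fun n ↦ ⟨hR (φ (ψ n)) (hu n), huW n⟩
    refine hx.2 (hFW ?_)
    refine tendsto_nhds_unique ((h0 x).comp (hψ.tendsto_atTop.comp hχ.tendsto_atTop)) ?_
    refine squeeze_zero (fun _ ↦ Metric.infDist_nonneg)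
      (fun n ↦ Metric.infDist_le_dist_of_mem (hu (χ n))) ?_
    simpa using (tendsto_const_nhds (x := x)).dist hlim
  refine ⟨φ, hφ, F, ⟨hFc, fun x hx ↦ ?_, fun x hx ↦ ?_⟩, ?_, hupper, fun x hx ↦ ?_, ?_⟩
  · obtain ⟨y, w, hy, -, hyg, -⟩ := hball x (hfr x hx).1 (hfr x hx).2
    refine ⟨y, hy, fun z hz ↦ (hmul z).resolve_right ?_⟩
    have := hyg z
    rw [Metric.mem_ball] at hz
    exact ne_of_gt (by linarith)
  · obtain ⟨y, w, -, hw, -, hwg⟩ := hball x (hfr x hx).1 (hfr x hx).2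
    refine ⟨w, hw, fun z hz ↦ ?_⟩
    have := hwg z
    rw [Metric.mem_ball] at hz
    exact ne_of_gt (show 0 < g 0 z by linarith)
  · intro x hx
    by_contra hxR
    have hlt : R < ‖x‖ := by simpa using hxR
    have hle : ‖x‖ - R ≤ g 0 x := by
      refine ge_of_tendsto' (h0 x) fun n ↦ (Metric.le_infDist (hne _)).2 fun y hy ↦ ?_
      have := mem_closedBall_zero_iff.1 (hR _ hy)
      rw [dist_eq_norm]
      linarith [norm_sub_norm_le x y]
    have : g 0 x = 0 := hx
    linarith
  · have hx0 : g 0 x = 0 := hx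
    exact hx0 ▸ h0 x
  · have hZ : volume {x : Eucl d | g 0 x = 0 ∧ g 1 x = 0} = 0 := by
      refine volume_eq_zero_of_ball hδ
        ((isClosed_eq hc0 continuous_const).inter (isClosed_eq hc1 continuous_const)).measurableSet
        fun x hx ↦ ?_
      obtain ⟨y, w, -, hw, -, hwg⟩ := hball x hx.1 hx.2
      refine ⟨w, hw, disjoint_left.2 fun z hz hzZ ↦ ?_⟩
      have := hwg z
      rw [Metric.mem_ball] at hz
      have := hzZ.1
      linarith
    filter_upwards [compl_mem_ae_iff.2 hZ] with x hx
    by_cases hx0 : g 0 x = 0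
    · have hpos : 0 < g 1 x := lt_of_le_of_ne (hg1 x) fun h ↦ hx ⟨hx0, h.symm⟩
      filter_upwards [(h1 x).eventually (lt_mem_nhds hpos)] with n hn
      refine ⟨fun _ ↦ hx0, fun _ ↦ ?_⟩
      by_contra hxn
      rw [Metric.infDist_zero_of_mem (show x ∈ (G n)ᶜ from hxn)] at hn
      exact lt_irrefl _ hn
    · have hpos : 0 < g 0 x := lt_of_le_of_ne (hg0 x) (Ne.symm hx0)
      filter_upwards [(h0 x).eventually (lt_mem_nhds hpos)] with n hn
      refine ⟨fun hxn ↦ ?_, fun h ↦ absurd h hx0⟩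
      rw [Metric.infDist_zero_of_mem (show x ∈ G n from hxn)] at hn
      exact absurd hn (lt_irrefl _)

end Compactness

/-- A separation of `F` thickens to two disjoint open sets; eventually `E n` would lie in their
union and meet both. -/
lemma isPreconnected_of_forall_open {E : ℕ → Set (Eucl d)} {F : Set (Eucl d)} (hF : IsCompact F)
    (hE : ∀ n, IsPreconnected (E n)) (hFE : ∀ x ∈ F, ∀ W, IsOpen W → x ∈ W →
      ∀ᶠ n in atTop, (E n ∩ W).Nonempty)
    (hlim : ∀ W, IsOpen W → F ⊆ W → ∀ᶠ n in atTop, E n ⊆ W) : IsPreconnected F := by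
  rw [isPreconnected_iff_subset_of_fully_disjoint_closed hF.isClosed]
  intro u v hu hv huv hd
  by_contra! hcon
  obtain ⟨⟨a, haF, hau⟩, b, hbF, hbv⟩ := And.intro (not_subset.1 hcon.1) (not_subset.1 hcon.2)
  have hav : a ∈ v := (huv haF).resolve_left hau
  have hbu : b ∈ u := (huv hbF).resolve_right hbv
  obtain ⟨ε, hε, hth⟩ := (hd.mono (inter_subset_right (s := F)) (inter_subset_right (s := F))
    ).exists_thickenings (hF.inter_right hu) (hF.isClosed.inter hv)
  set U := Metric.thickening ε (F ∩ u)
  set V := Metric.thickening ε (F ∩ v)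
  have hU : IsOpen U := Metric.isOpen_thickening
  have hV : IsOpen V := Metric.isOpen_thickening
  have hUV : F ⊆ U ∪ V := fun x hx ↦ (huv hx).imp
    (fun h ↦ Metric.self_subset_thickening hε _ ⟨hx, h⟩)
    fun h ↦ Metric.self_subset_thickening hε _ ⟨hx, h⟩
  have h1 := hFE a haF V hV (Metric.self_subset_thickening hε _ ⟨haF, hav⟩)
  have h2 := hFE b hbF U hU (Metric.self_subset_thickening hε _ ⟨hbF, hbu⟩)
  obtain ⟨n, ⟨x, hxE, hxV⟩, ⟨y, hyE, hyU⟩, hn⟩ := (h1.and (h2.and (hlim _ (hU.union hV) hUV))).exists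
  rcases (hE n).subset_or_subset hU hV hth hn with h | h
  · exact hth.notMem_of_mem_left (h hxE) hxV
  · exact hth.notMem_of_mem_left hyU (h hyE)

section Minimizer

variable [NeZero d]

lemma isBounded_of_mem_connectedBallClass {δ m : ℝ} (hδ : 0 < δ) {E : Set (Eucl d)}
    (hE : E ∈ connectedBallClass d δ) (hm : volume E = ENNReal.ofReal m) :
    Bornology.IsBounded E := by
  have hω : 0 < δ ^ d * unitBallVolume d := mul_pos (by positivity) unitBallVolume_pos
  obtain ⟨N, hN⟩ := exists_nat_gt (m / (δ ^ d * unitBallVolume d))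
  obtain ⟨x, hx⟩ := hE.2.nonempty
  exact Metric.isBounded_closedBall.subset
    (subset_closedBall_of_connected hδ ((div_lt_iff₀ hω).1 hN) hE hm hx)

/-- The class of connected sets in `K_δ` of given volume is compact up to translations, and the
functional is lower semicontinuous along the converging subsequence. -/
lemma exists_logFunctional_le_of_tendsto {δ m Q : ℝ} (hδ : 0 < δ) (hm : 0 < m)
    {E : ℕ → Set (Eucl d)} {i : EReal}
    (hE : ∀ n, E n ∈ connectedBallClass d δ ∧ volume (E n) = ENNReal.ofReal m)
    (hlim : Tendsto (fun n ↦ logFunctional Q (E n)) atTop (𝓝 i)) :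
    ∃ F, (F ∈ connectedBallClass d δ ∧ volume F = ENNReal.ofReal m) ∧ logFunctional Q F ≤ i := by
  have hω : 0 < δ ^ d * unitBallVolume d := mul_pos (by positivity) unitBallVolume_pos
  obtain ⟨N, hN⟩ := exists_nat_gt (m / (δ ^ d * unitBallVolume d))
  rw [div_lt_iff₀ hω] at hN
  set R := 6 * δ * N
  -- Translating by a point of each set puts `0` in all of them, so the diameter bound confines them
  -- to one ball.
  choose a ha using fun n ↦ (hE n).1.2.nonempty
  set G : ℕ → Set (Eucl d) := fun n ↦ (fun x ↦ x + a n) ⁻¹' E n with hG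
  have hGc (n : ℕ) : G n ∈ connectedBallClass d δ := preimage_add_mem_connectedBallClass (hE n).1 _
  have hGv (n : ℕ) : volume (G n) = ENNReal.ofReal m := by
    rw [hG, ← (hE n).2]
    exact measure_preimage_add_right volume (a n) (E n)
  have hG0 (n : ℕ) : (0 : Eucl d) ∈ G n := by simpa [hG] using ha n
  have hGR (n : ℕ) : G n ⊆ Metric.closedBall 0 R :=
    subset_closedBall_of_connected hδ hN (hGc n) (hGv n) (hG0 n)
  have hGf (n : ℕ) : logFunctional Q (G n) ≤ logFunctional Q (E n) :=
    logFunctional_preimage_add_le (hE n).1.1.1.measurableSet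
      (isBounded_of_mem_connectedBallClass hδ (hE n).1 (hE n).2) Q _
  obtain ⟨φ, hφ, F, hF, hFR, hup, hlow, hae⟩ :=
    exists_subseq_ballClass hδ (fun n ↦ (hGc n).1) (fun n ↦ ⟨0, hG0 n⟩) hGR
  have hvol : volume F = ENNReal.ofReal m := by
    refine tendsto_nhds_unique (tendsto_measure_of_ae_tendsto_indicator atTop hF.1.measurableSet
      (fun n ↦ (hGc (φ n)).1.1.measurableSet) Metric.isClosed_closedBall.measurableSet
      (measure_closedBall_lt_top (x := (0 : Eucl d)) (r := R)).ne
      (Eventually.of_forall fun n ↦ hGR (φ n)) hae) ?_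
    simp_rw [hGv]
    exact tendsto_const_nhds
  have hsymm : Tendsto (fun n ↦ volume (symmDiff (G (φ n)) F)) atTop (𝓝 0) := by
    rw [← measure_empty (μ := (volume : Measure (Eucl d)))]
    refine tendsto_measure_of_ae_tendsto_indicator atTop MeasurableSet.empty
      (fun n ↦ (hGc (φ n)).1.1.measurableSet.symmDiff hF.1.measurableSet)
      Metric.isClosed_closedBall.measurableSet
      (measure_closedBall_lt_top (x := (0 : Eucl d)) (r := R)).ne
      (Eventually.of_forall fun n ↦ ?_) ?_
    · exact symmDiff_subset_union.trans (union_subset (hGR (φ n)) hFR)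
    · filter_upwards [hae] with x hx
      filter_upwards [hx] with n hn
      simp only [mem_symmDiff, hn]
      simp
  have hFcon : IsConnected F := by
    refine ⟨nonempty_of_measure_ne_zero (μ := volume) ?_, isPreconnected_of_forall_open
      (Metric.isCompact_of_isClosed_isBounded hF.1 (Metric.isBounded_closedBall.subset hFR))
      (fun n ↦ (hGc (φ n)).2.isPreconnected) (fun x hx W hW hxW ↦ ?_) hup⟩
    · rw [hvol]; simpa using hm
    · obtain ⟨ε, hε, hball⟩ := Metric.isOpen_iff.1 hW x hxW
      filter_upwards [(hlow x hx).eventually (gt_mem_nhds hε)] with n hn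
      obtain ⟨y, hy, hxy⟩ := (Metric.infDist_lt_iff ⟨0, hG0 (φ n)⟩).1 hn
      exact ⟨y, hy, hball (Metric.mem_ball'.2 hxy)⟩
  refine ⟨F, ⟨⟨hF, hFcon⟩, hvol⟩, ?_⟩
  -- Compactness of `EReal` lets perimeters and energies converge separately. Neither `p` nor `Q² l`
  -- is `⊥`, so addition is continuous at the pair of limits.
  obtain ⟨⟨p, l⟩, -, ψ, hψ, hpl⟩ := isCompact_univ.tendsto_subseq
    (x := fun n ↦ (perimeter (G (φ n)), Ilog (G (φ n)))) fun _ ↦ mem_univ _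
  have hp : Tendsto (fun n ↦ perimeter (G (φ (ψ n)))) atTop (𝓝 p) := (continuous_fst.tendsto _).comp hpl
  have hl : Tendsto (fun n ↦ Ilog (G (φ (ψ n)))) atTop (𝓝 l) := (continuous_snd.tendsto _).comp hpl
  have hpF : perimeter F ≤ p := by
    rw [perimeter_eq_tv hF.1.measurableSet]
    have h1 := tv_indicator_le_liminf hF.1.measurableSet
      (fun n ↦ (hGc (φ (ψ n))).1.1.measurableSet) (hsymm.comp hψ.tendsto_atTop)
    have hp' : Tendsto (fun n ↦ (tv ((G (φ (ψ n))).indicator 1) : EReal).toENNReal) atTop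
        (𝓝 p.toENNReal) := by
      refine (EReal.continuous_toENNReal.tendsto p).comp (hp.congr fun n ↦ ?_)
      exact perimeter_eq_tv (hGc _).1.1.measurableSet
    simp only [EReal.toENNReal_coe] at hp'
    rw [hp'.liminf_eq] at h1
    have hp0 : 0 ≤ p := ge_of_tendsto' hp fun n ↦ by
      rw [perimeter_eq_tv (hGc _).1.1.measurableSet]
      exact EReal.coe_ennreal_nonneg _
    rw [← EReal.coe_toENNReal hp0]
    exact_mod_cast h1
  have hlF : Ilog F ≤ l := by
    refine le_of_forall_gt_imp_ge_of_dense fun b hb ↦ ?_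
    obtain ⟨n₀, hn₀⟩ := eventually_atTop.1 (hl.eventually (gt_mem_nhds hb))
    refine Ilog_le_of_forall_open hF.1 hFR (F := fun n ↦ G (φ (ψ (n + n₀))))
      (fun n ↦ (hGc _).1.1) (fun n ↦ hGR _) (fun W hW hFW ↦ ?_) fun n ↦ hn₀ _ (Nat.le_add_left _ _)
    exact ((hψ.tendsto_atTop.comp (tendsto_add_atTop_nat n₀))).eventually (hup W hW hFW)
  have hp0 : p ≠ ⊥ := by
    refine ne_of_gt (EReal.bot_lt_zero.trans_le (ge_of_tendsto' hp fun n ↦ ?_))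
    rw [perimeter_eq_tv (hGc _).1.1.measurableSet]
    exact EReal.coe_ennreal_nonneg _
  have hl0 : l ≠ ⊥ := by
    have hbd : ((-(max 0 (2 * R)) : ℝ) : EReal) ≤ l := by
      refine ge_of_tendsto' hl fun n ↦ neg_le_Ilog (le_max_left _ _) ?_
      rw [(hGc _).1.1.closure_eq]
      intro x hx y hy
      have e1 := mem_closedBall_zero_iff.1 (hGR _ hx)
      have e2 := mem_closedBall_zero_iff.1 (hGR _ hy)
      have h3 := norm_sub_le x y
      have h4 := Real.add_one_le_exp (max 0 (2 * R))
      have h5 := le_max_right 0 (2 * R)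
      linarith
    exact ne_of_gt ((EReal.bot_lt_coe _).trans_le hbd)
  have hQ2 : ((Q ^ 2 : ℝ) : EReal) * l ≠ ⊥ := by
    rw [Ne, EReal.mul_eq_bot]
    rintro (⟨h, -⟩ | ⟨-, h⟩ | ⟨h, -⟩ | ⟨h, -⟩)
    · exact EReal.coe_ne_bot _ h
    · exact hl0 h
    · exact EReal.coe_ne_top _ h
    · exact absurd h (not_lt.2 (by exact_mod_cast sq_nonneg Q))
  have hlimG : Tendsto (fun n ↦ logFunctional Q (G (φ (ψ n)))) atTop
      (𝓝 (p + ((Q ^ 2 : ℝ) : EReal) * l)) := by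
    have h1 := EReal.Tendsto.const_mul (a := ((Q ^ 2 : ℝ) : EReal)) hl
      (Or.inl (EReal.coe_ne_bot _)) (Or.inl (EReal.coe_ne_top _))
    exact (EReal.continuousAt_add (p := (p, _)) (Or.inr hQ2) (Or.inl hp0)).tendsto.comp
      (hp.prodMk_nhds h1)
  calc logFunctional Q F ≤ p + ((Q ^ 2 : ℝ) : EReal) * l := by
        refine add_le_add hpF (mul_le_mul_of_nonneg_left hlF ?_)
        exact_mod_cast sq_nonneg Q
    _ ≤ i := le_of_tendsto_of_tendsto' hlimG
        (hlim.comp (hφ.tendsto_atTop.comp hψ.tendsto_atTop)) fun n ↦ hGf _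

theorem exists_isMinOn_connectedBallClass {δ m : ℝ} (Q : ℝ) (hδ : 0 < δ)
    (hm : unitBallVolume d * δ ^ d < m) :
    ∃ E ∈ {E | E ∈ connectedBallClass d δ ∧ volume E = ENNReal.ofReal m},
      IsMinOn (logFunctional Q) {E | E ∈ connectedBallClass d δ ∧ volume E = ENNReal.ofReal m} E := by
  have hω := unitBallVolume_pos (d := d)
  have hm0 : 0 < m := lt_of_le_of_lt (by positivity) hm
  obtain ⟨r, hr, hrm⟩ := exists_radius (d := d) hm0
  have hδr : δ ≤ r := by
    refine (lt_of_pow_lt_pow_left₀ d hr.le (lt_of_mul_lt_mul_right ?_ hω.le)).le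
    rw [hrm]; linarith
  set S := {E : Set (Eucl d) | E ∈ connectedBallClass d δ ∧ volume E = ENNReal.ofReal m} with hS
  have hne : S.Nonempty := by
    refine ⟨Metric.closedBall 0 r, ⟨?_, ?_⟩, ?_⟩
    -- A single ball of volume `m` is a competitor, since its radius is at least `δ`.
    · simpa using two_closedBalls_mem_ballClass hδ hδr (a := (0 : Eucl d)) (Or.inl rfl)
    · exact ⟨⟨0, Metric.mem_closedBall_self hr.le⟩, (convex_closedBall _ _).isPreconnected⟩
    · rw [volume_closedBall_eq_ball, volume_ball_eq _ hr.le, hrm]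
  obtain ⟨u, -, hu, huS⟩ := exists_seq_tendsto_sInf (hne.image (logFunctional Q)) (OrderBot.bddBelow _)
  choose E hE hEu using huS
  obtain ⟨F, hF, hFi⟩ := exists_logFunctional_le_of_tendsto (Q := Q) hδ hm0 hE
    (hu.congr fun n ↦ (hEu n).symm)
  exact ⟨F, hF, fun A hA ↦ hFi.trans (sInf_le (mem_image_of_mem _ hA))⟩

end Minimizer

end ChargedDrop

/-! ### Inward fields on smooth domains, finite perimeter, and pushing charges inside. -/

namespace ChargedDrop
open Filter Topology
open scoped ENNReal NNReal

variable {d : ℕ}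

/-- The vector `u` points strictly into `Ω` at all points of `closure Ω` near `x`. -/
def PointsInto (Ω : Set (Eucl d)) (x u : Eucl d) : Prop :=
  ∀ᶠ q : ℝ × Eucl d × Eucl d in 𝓝 (0, u, x),
    0 < q.1 → q.2.2 ∈ closure Ω → q.2.2 + q.1 • q.2.1 ∈ Ω

namespace PointsInto

variable {Ω : Set (Eucl d)} {x u u' : Eucl d}

lemma of_mem (hΩ : IsOpen Ω) (hx : x ∈ Ω) (u : Eucl d) : PointsInto Ω x u := by
  have hc : Continuous fun q : ℝ × Eucl d × Eucl d ↦ q.2.2 + q.1 • q.2.1 := by fun_prop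
  filter_upwards [hc.continuousAt.preimage_mem_nhds (hΩ.mem_nhds (by simpa using hx))]
    with q hq _ _ using hq

lemma smul {a : ℝ} (ha : 0 < a) (h : PointsInto Ω x u) : PointsInto Ω x (a • u) := by
  have hc : Continuous fun q : ℝ × Eucl d × Eucl d ↦ (a * q.1, a⁻¹ • q.2.1, q.2.2) := by fun_prop
  have ht : Tendsto (fun q : ℝ × Eucl d × Eucl d ↦ (a * q.1, a⁻¹ • q.2.1, q.2.2))
      (𝓝 (0, a • u, x)) (𝓝 (0, u, x)) := by
    simpa [smul_smul, inv_mul_cancel₀ ha.ne'] using hc.tendsto (0, a • u, x)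
  filter_upwards [ht.eventually h] with q hq h0 hcl
  have := hq (mul_pos ha h0) hcl
  rwa [smul_smul, mul_right_comm, mul_inv_cancel₀ ha.ne', one_mul] at this

/-- Move along `u` first, then along the rest of the direction; the intermediate point is already in
`Ω`. Together with `smul`, inward directions form a convex cone, so local choices can be summed. -/
lemma add (h : PointsInto Ω x u) (h' : PointsInto Ω x u') : PointsInto Ω x (u + u') := by
  have hc : Continuous fun q : ℝ × Eucl d × Eucl d ↦ (q.1, u, q.2.2) := by fun_prop
  have hc' : Continuous fun q : ℝ × Eucl d × Eucl d ↦ (q.1, q.2.1 - u, q.2.2 + q.1 • u) := by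
    fun_prop
  have ht : Tendsto (fun q : ℝ × Eucl d × Eucl d ↦ (q.1, u, q.2.2))
      (𝓝 (0, u + u', x)) (𝓝 (0, u, x)) := hc.tendsto (0, u + u', x)
  have ht' : Tendsto (fun q : ℝ × Eucl d × Eucl d ↦ (q.1, q.2.1 - u, q.2.2 + q.1 • u))
      (𝓝 (0, u + u', x)) (𝓝 (0, u', x)) := by
    simpa using hc'.tendsto (0, u + u', x)
  filter_upwards [ht.eventually h, ht'.eventually h'] with q hq hq' h0 hcl
  have := hq' h0 (subset_closure (hq h0 hcl))
  rwa [add_assoc, ← smul_add, add_sub_cancel] at this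

lemma eventually (h : PointsInto Ω x u) : ∀ᶠ z in 𝓝 x, PointsInto Ω z u := by
  have hc : Continuous fun z : Eucl d ↦ ((0 : ℝ), u, z) := by fun_prop
  exact (hc.tendsto x).eventually h.eventually_nhds

/-- Directions of decrease of a local defining function point into the domain. -/
lemma of_fderiv_neg {U : Set (Eucl d)} (hU : IsOpen U) (hx : x ∈ U) {g : Eucl d → ℝ}
    (hg : ContDiff ℝ 1 g) (hΩU : Ω ∩ U = {z | g z < 0} ∩ U) (hu : fderiv ℝ g x u < 0) :
    PointsInto Ω x u := by
  -- The tolerance makes the first-order error at most a quarter of the slope, while nearby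
  -- directions keep at least half of it. Strict differentiability provides this uniformly in the
  -- base point.
  set η : ℝ := -fderiv ℝ g x u / (4 * (‖u‖ + 1)) with hη
  have hη0 : 0 < η := div_pos (neg_pos.2 hu) (by positivity)
  have hs := (hg.contDiffAt (x := x)).hasStrictFDerivAt one_ne_zero
  have ho := hs.isLittleO.bound hη0
  have hc : Continuous fun q : ℝ × Eucl d × Eucl d ↦ q.2.2 + q.1 • q.2.1 := by fun_prop
  have ht1 : Tendsto (fun q : ℝ × Eucl d × Eucl d ↦ q.2.2 + q.1 • q.2.1) (𝓝 (0, u, x)) (𝓝 x) := by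
    simpa using hc.tendsto (0, u, x)
  have ht2 : Tendsto (fun q : ℝ × Eucl d × Eucl d ↦ q.2.2) (𝓝 (0, u, x)) (𝓝 x) :=
    (by fun_prop : Continuous fun q : ℝ × Eucl d × Eucl d ↦ q.2.2).tendsto (0, u, x)
  have ht3 : Tendsto (fun q : ℝ × Eucl d × Eucl d ↦ fderiv ℝ g x q.2.1) (𝓝 (0, u, x))
      (𝓝 (fderiv ℝ g x u)) :=
    (by fun_prop : Continuous fun q : ℝ × Eucl d × Eucl d ↦ fderiv ℝ g x q.2.1).tendsto (0, u, x)
  have ht4 : Tendsto (fun q : ℝ × Eucl d × Eucl d ↦ ‖q.2.1‖) (𝓝 (0, u, x)) (𝓝 ‖u‖) :=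
    (by fun_prop : Continuous fun q : ℝ × Eucl d × Eucl d ↦ ‖q.2.1‖).tendsto (0, u, x)
  filter_upwards [(ht1.prodMk_nhds ht2).eventually ho, ht1.eventually (hU.mem_nhds hx),
    ht2.eventually (hU.mem_nhds hx), ht3.eventually (gt_mem_nhds (by linarith :
      fderiv ℝ g x u < fderiv ℝ g x u / 2)), ht4.eventually (gt_mem_nhds (lt_add_one ‖u‖))]
    with q h1 h2 h3 h4 h5 h0 hcl
  have hz : g q.2.2 ≤ 0 := by
    have hmem : q.2.2 ∈ closure (U ∩ Ω) := hU.inter_closure ⟨h3, hcl⟩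
    rw [inter_comm, hΩU] at hmem
    have hsub : closure ({z | g z < 0} ∩ U) ⊆ {z | g z ≤ 0} :=
      closure_minimal (fun z hz ↦ (show g z < 0 from hz.1).le)
        (isClosed_le hg.continuous continuous_const)
    exact hsub hmem
  rw [add_sub_cancel_left, map_smul, smul_eq_mul, norm_smul, Real.norm_eq_abs, Real.norm_eq_abs,
    abs_of_pos h0] at h1
  have h6 := (abs_le.1 h1).2
  have h7 : η * (q.1 * ‖q.2.1‖) ≤ q.1 * (-fderiv ℝ g x u / 4) := by
    have : η * ‖q.2.1‖ ≤ η * (‖u‖ + 1) := by gcongr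
    have e : η * (‖u‖ + 1) = -fderiv ℝ g x u / 4 := by rw [hη]; field_simp
    nlinarith
  have h8 : q.1 * fderiv ℝ g x q.2.1 ≤ q.1 * (fderiv ℝ g x u / 2) := by gcongr
  have hlt : g (q.2.2 + q.1 • q.2.1) < 0 := by nlinarith [mul_pos h0 (neg_pos.2 hu)]
  have : q.2.2 + q.1 • q.2.1 ∈ Ω ∩ U := by rw [hΩU]; exact ⟨hlt, h2⟩
  exact this.1

end PointsInto

/-- Patching of finitely many constant directions to a Lipschitz vector field. -/
lemma exists_lipschitz_patch (t : Finset (Eucl d)) (r : Eucl d → ℝ)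
    (n : Eucl d → Eucl d) : ∃ (v : Eucl d → Eucl d) (L : ℝ≥0), LipschitzWith L v ∧
      ∀ Ω : Set (Eucl d), ∀ x, (∀ p ∈ t, x ∈ Metric.ball p (r p) → PointsInto Ω x (n p)) →
        ((∀ p ∈ t, x ∉ Metric.ball p (r p)) ∧ v x = 0) ∨ PointsInto Ω x (v x) := by
  classical
  induction t using Finset.induction_on with
  | empty => exact ⟨0, 0, LipschitzWith.const 0, fun Ω x _ ↦ Or.inl ⟨by simp, rfl⟩⟩
  | insert p t hp ih =>
    obtain ⟨v, L, hL, hv⟩ := ih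
    -- A tent function, positive exactly on the ball. Adding `χ • n p` preserves inwardness where
    -- `v` is already inward, by the cone property, and creates it where `v` vanished.
    let χ : Eucl d → ℝ := fun z ↦ max (r p - dist z p) 0
    have hχ : LipschitzWith 1 χ := by
      refine LipschitzWith.of_dist_le_mul fun x y ↦ ?_
      have h1 := dist_triangle x y p
      have h2 := dist_triangle_left y p x
      rw [NNReal.coe_one, one_mul, Real.dist_eq]
      refine (abs_max_sub_max_le_abs _ _ _).trans ?_
      rw [abs_le]
      constructor <;> linarith
    have hχn : LipschitzWith ‖n p‖₊ fun z ↦ χ z • n p := by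
      refine LipschitzWith.of_dist_le_mul fun x y ↦ ?_
      have := hχ.dist_le_mul x y
      rw [dist_eq_norm, ← sub_smul, norm_smul, mul_comm, ← dist_eq_norm]
      rw [NNReal.coe_one, one_mul] at this
      gcongr
      exact le_rfl
    refine ⟨_, _, hL.add hχn, fun Ω x hx ↦ ?_⟩
    have hx' := hv Ω x fun q hq ↦ hx q (Finset.mem_insert_of_mem hq)
    by_cases hxp : x ∈ Metric.ball p (r p)
    · have hpos : 0 < χ x := lt_max_of_lt_left (sub_pos.2 (Metric.mem_ball.1 hxp))
      have hin := (hx p (Finset.mem_insert_self _ _) hxp).smul hpos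
      right
      rcases hx' with ⟨-, h0⟩ | h
      · simpa only [h0, zero_add] using hin
      · exact h.add hin
    · have h0 : χ x = 0 := max_eq_right (sub_nonpos.2 (not_lt.1 hxp))
      simp only [h0, zero_smul, add_zero]
      refine hx'.imp_left fun h ↦ ⟨fun q hq ↦ ?_, h.2⟩
      rcases Finset.mem_insert.1 hq with rfl | hq
      · exact hxp
      · exact h.1 q hq

/-- A smooth bounded domain admits a Lipschitz field moving its closure uniformly inwards. -/
theorem exists_inward_field {Ω : Set (Eucl d)} (hΩ : IsBoundedSmoothDomain Ω) :
    ∃ (v : Eucl d → Eucl d) (L : ℝ≥0) (c : ℝ), 0 < c ∧ LipschitzWith L v ∧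
      ∀ t, 0 < t → t < c → ∀ x ∈ closure Ω, Metric.ball (x + t • v x) (c * t) ⊆ Ω := by
  obtain ⟨ho, -, hb, hs⟩ := hΩ
  have hK : IsCompact (closure Ω) := hb.isCompact_closure
  have hloc : ∀ p, ∃ (r : ℝ) (n : Eucl d), 0 < r ∧
      (p ∈ frontier Ω → ∀ x ∈ Metric.ball p r, PointsInto Ω x n) := by
    intro p
    by_cases hp : p ∈ frontier Ω
    · obtain ⟨U, hU, hpU, g, hg, hgd, hΩU⟩ := hs p hp
      obtain ⟨u, hu⟩ : ∃ u, fderiv ℝ g p u < 0 := by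
        obtain ⟨w, hw⟩ := DFunLike.ne_iff.1 (hgd p hpU)
        rcases lt_or_gt_of_ne hw with h | h
        · exact ⟨w, h⟩
        · exact ⟨-w, by rw [map_neg]; exact neg_neg_of_pos h⟩
      have hg1 : ContDiff ℝ 1 g := hg.of_le (by exact_mod_cast le_top)
      obtain ⟨r, hr, h⟩ := Metric.eventually_nhds_iff_ball.1
        (PointsInto.of_fderiv_neg hU hpU hg1 hΩU hu).eventually
      exact ⟨r, u, hr, fun _ ↦ h⟩
    · exact ⟨1, 0, one_pos, fun h ↦ absurd h hp⟩
  choose r n hr hn using hloc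
  obtain ⟨t, htf, hcov⟩ := (hK.of_isClosed_subset isClosed_frontier
    frontier_subset_closure).elim_nhds_subcover (fun p ↦ Metric.ball p (r p))
    fun p _ ↦ Metric.ball_mem_nhds _ (hr p)
  obtain ⟨v, L, hL, hv⟩ := exists_lipschitz_patch t r n
  -- At points of the open set `Ω` every direction is admissible; only the frontier constrains the
  -- field.
  have hin : ∀ x ∈ closure Ω, PointsInto Ω x (v x) := by
    intro x hx
    by_cases hxΩ : x ∈ Ω
    · exact PointsInto.of_mem ho hxΩ _
    · refine (hv Ω x fun p hp hxp ↦ hn p (htf p hp) x hxp).resolve_left fun h ↦ ?_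
      have hxf : x ∈ frontier Ω := by rw [ho.frontier_eq]; exact ⟨hx, hxΩ⟩
      obtain ⟨p, hp, hxp⟩ := mem_iUnion₂.1 (hcov hxf)
      exact h.1 p hp hxp
  -- `PointsInto` is open in the time, the direction and the base point, so compactness makes it
  -- uniform. Perturbing the direction by less than `c` sweeps out the whole ball of radius `c t`.
  have hunif : ∀ᶠ q : ℝ × Eucl d in 𝓝 (0, 0), ∀ x ∈ closure Ω, x ∈ closure Ω →
      0 < q.1 → x + q.1 • (v x + q.2) ∈ Ω := by
    refine hK.eventually_forall_of_forall_eventually fun x hx ↦ ?_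
    have hc : Continuous fun q : (ℝ × Eucl d) × Eucl d ↦ (q.1.1, v q.2 + q.1.2, q.2) :=
      (continuous_fst.comp continuous_fst).prodMk
        (((hL.continuous.comp continuous_snd).add (continuous_snd.comp continuous_fst)).prodMk
          continuous_snd)
    have ht : Tendsto (fun q : (ℝ × Eucl d) × Eucl d ↦ (q.1.1, v q.2 + q.1.2, q.2))
        (𝓝 ((0, 0), x)) (𝓝 (0, v x, x)) := by
      simpa using hc.tendsto ((0, 0), x)
    filter_upwards [ht.eventually (hin x hx)] with q hq h1 h2 using hq h2 h1
  obtain ⟨c, hc, h⟩ := Metric.eventually_nhds_iff_ball.1 hunif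
  refine ⟨v, L, c, hc, hL, fun s hs0 hsc x hx y hy ↦ ?_⟩
  have hmem : (s, s⁻¹ • (y - (x + s • v x))) ∈ Metric.ball ((0 : ℝ), (0 : Eucl d)) c := by
    rw [Metric.mem_ball, dist_eq_norm] at hy
    rw [← ball_prod_same, mem_prod, mem_ball_zero_iff, mem_ball_zero_iff, Real.norm_eq_abs,
      abs_of_pos hs0, norm_smul, norm_inv, Real.norm_eq_abs, abs_of_pos hs0]
    exact ⟨hsc, by rwa [inv_mul_lt_iff₀ hs0, mul_comm]⟩
  have := h _ hmem x hx hx hs0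
  rwa [smul_add, smul_smul, mul_inv_cancel₀ hs0.ne', one_smul, ← add_assoc, add_sub_cancel] at this

/-- Expanding maps do not decrease the volume by more than the expected factor. -/
lemma volume_le_of_antilipschitz {T : Eucl d → Eucl d} {K : ℝ≥0} (hT : AntilipschitzWith K T)
    (s : Set (Eucl d)) : volume s ≤ (K : ℝ≥0∞) ^ d * volume (T '' s) := by
  -- Volume is a multiple of Hausdorff measure, for which an antilipschitz bound on images is
  -- available for arbitrary sets.
  have hH : (Measure.hausdorffMeasure d : Measure (Eucl d)).IsAddHaarMeasure := by
    simpa using isAddHaarMeasure_hausdorffMeasure (E := Eucl d)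
  have hv := Measure.isAddLeftInvariant_eq_smul (volume : Measure (Eucl d))
    (Measure.hausdorffMeasure d)
  rw [hv, Measure.smul_apply, Measure.smul_apply, ENNReal.smul_def, ENNReal.smul_def,
    smul_eq_mul, smul_eq_mul, mul_left_comm]
  gcongr
  simpa using hT.le_hausdorffMeasure_image d.cast_nonneg s

section Domain

variable {Ω : Set (Eucl d)} {v : Eucl d → Eucl d} {L : ℝ≥0}

lemma mul_norm_le_of_lipschitz (hL : LipschitzWith L v) {t : ℝ} (ht : 0 ≤ t) (x y : Eucl d) :
    (1 - t * L) * ‖x - y‖ ≤ ‖(x + t • v x) - (y + t • v y)‖ := by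
  have h1 := hL.norm_sub_le x y
  have h2 := norm_sub_norm_le (x - y) (t • (v y - v x))
  rw [norm_smul, Real.norm_eq_abs, abs_of_nonneg ht, norm_sub_rev (v y)] at h2
  have h3 : x - y - t • (v y - v x) = (x + t • v x) - (y + t • v y) := by module
  rw [h3] at h2
  nlinarith

lemma antilipschitz_of_lipschitz (hL : LipschitzWith L v) {t : ℝ} (ht : 0 ≤ t) (h1 : t * L < 1) :
    AntilipschitzWith (1 - t * L)⁻¹.toNNReal fun x ↦ x + t • v x := by
  have hpos : 0 < 1 - t * L := sub_pos.2 h1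
  refine AntilipschitzWith.of_le_mul_dist fun x y ↦ ?_
  rw [Real.coe_toNNReal _ (inv_nonneg.2 hpos.le), dist_eq_norm, dist_eq_norm,
    le_inv_mul_iff₀ hpos]
  exact mul_norm_le_of_lipschitz hL ht x y

/-- The map `T = id + t v` keeps `closure Ω` at distance at least `c t` from the complement, so the
boundary layer of that width lies in `Ω \ T (closure Ω)`. Since `T` shrinks volume by at most the
factor `(1 - t L) ^ d`, the layer has volume at most `d t L |Ω|`, and the Minkowski bound applies.
-/
theorem tv_smoothDomain_ne_top [NeZero d] (hΩ : IsBoundedSmoothDomain Ω) :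
    tv (Ω.indicator 1) ≠ ⊤ := by
  obtain ⟨v, L, c, hc, hL, hv⟩ := exists_inward_field hΩ
  have hb := hΩ.2.2.1
  set V := volume.real Ω
  set h : ℕ → ℝ := fun n ↦ min (c / 2) (1 / (2 * (L + 1))) * (1 / ((n : ℝ) + 1)) with hh
  have hm0 : 0 < min (c / 2) (1 / (2 * ((L : ℝ) + 1))) := lt_min (by positivity) (by positivity)
  have hpos (n : ℕ) : 0 < h n := by positivity
  have hle (n : ℕ) : h n ≤ min (c / 2) (1 / (2 * (L + 1))) := by
    refine mul_le_of_le_one_right hm0.le ?_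
    rw [div_le_one (by positivity)]
    linarith [(Nat.cast_nonneg n : (0 : ℝ) ≤ n)]
  have hlim : Tendsto h atTop (𝓝 0) := by
    have := tendsto_one_div_add_atTop_nhds_zero_nat.const_mul (min (c / 2) (1 / (2 * ((L : ℝ) + 1))))
    rwa [mul_zero] at this
  refine ne_top_of_le_ne_top (ENNReal.ofReal_ne_top (r := V * (d * L / c)))
    (tv_indicator_le_minkowski hΩ.1 (nonempty_compl_of_isBounded hb) (h := fun n ↦ c * h n)
    (fun n ↦ mul_pos hc (hpos n)) (by simpa using hlim.const_mul c) fun n ↦ ?_)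
  set t := h n with ht
  have ht0 : 0 < t := hpos n
  have htc : t < c := by linarith [(hle n).trans (min_le_left _ _)]
  have htL : t * L < 1 := by
    have h1 := (hle n).trans (min_le_right _ _)
    rw [le_div_iff₀ (by positivity)] at h1
    nlinarith
  set T : Eucl d → Eucl d := fun x ↦ x + t • v x with hT
  have hTc : Continuous T := continuous_id.add (hL.continuous.const_smul t)
  have hTK : IsCompact (T '' closure Ω) := hb.isCompact_closure.image hTc
  have hsub : T '' closure Ω ⊆ Ω := by
    rintro _ ⟨x, hx, rfl⟩
    exact hv t ht0 htc x hx (Metric.mem_ball_self (mul_pos hc ht0))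
  have hfin : volume Ω ≠ ⊤ := hb.measure_lt_top.ne
  have hlow : (1 - t * L) ^ d * V ≤ volume.real (T '' closure Ω) := by
    have h1 := (measure_mono (subset_closure (s := Ω))).trans
      (volume_le_of_antilipschitz (antilipschitz_of_lipschitz hL ht0.le htL) (closure Ω))
    have hpos' : 0 < 1 - t * L := sub_pos.2 htL
    have h2 := ENNReal.toReal_mono (ENNReal.mul_ne_top (by simp) hTK.measure_lt_top.ne) h1
    rw [ENNReal.toReal_mul, ENNReal.toReal_pow, ENNReal.coe_toReal,
      Real.coe_toNNReal _ (inv_nonneg.2 hpos'.le), inv_pow, ← div_eq_inv_mul,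
      le_div_iff₀ (by positivity), mul_comm] at h2
    exact h2
  have hset : {x | 0 < Metric.infDist x Ωᶜ ∧ Metric.infDist x Ωᶜ < c * t} ⊆
      Ω \ T '' closure Ω := by
    rintro y ⟨h1, h2⟩
    refine ⟨?_, ?_⟩
    · by_contra hy
      rw [Metric.infDist_zero_of_mem (by exact hy)] at h1
      exact lt_irrefl _ h1
    · rintro ⟨x, hx, rfl⟩
      obtain ⟨z, hz, hlt⟩ := (Metric.infDist_lt_iff (nonempty_compl_of_isBounded hb)).1 h2
      exact hz (hv t ht0 htc x hx (Metric.mem_ball'.2 hlt))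
  refine (measure_mono hset).trans ?_
  rw [← ENNReal.ofReal_mul (by positivity), ← ofReal_measureReal (s := Ω \ T '' closure Ω)
    (measure_ne_top_of_subset sdiff_subset hfin),
    measureReal_sdiff hsub hTK.measurableSet]
  apply ENNReal.ofReal_le_ofReal
  have hB := one_add_mul_le_pow (a := -(t * L)) (by linarith) d
  have hV : 0 ≤ V := measureReal_nonneg
  have h5 : (1 - d * (t * L)) * V ≤ (1 - t * L) ^ d * V := by
    refine mul_le_mul_of_nonneg_right ?_ hV
    calc _ = 1 + (d : ℝ) * -(t * L) := by ring
      _ ≤ _ := by rw [sub_eq_add_neg]; exact hB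
  calc _ ≤ V - (1 - d * (t * L)) * V := by linarith
    _ = _ := by field_simp; ring

/-- Measures of almost minimal energy can be pushed inside a smooth domain. -/
theorem exists_compact_mutualEnergy_lt (hΩ : IsBoundedSmoothDomain Ω) {c : ℝ} (hc : 0 ≤ c)
    (hdiam : ∀ x ∈ closure Ω, ∀ y ∈ closure Ω, ‖x - y‖ ≤ Real.exp c) {a : EReal}
    (ha : Ilog Ω < a) :
    ∃ (μ : Measure (Eucl d)) (K : Set (Eucl d)), IsProbabilityMeasure μ ∧ IsCompact K ∧ K ⊆ Ω ∧
      (∀ᵐ x ∂μ, x ∈ K) ∧ ((mutualEnergy c μ μ : ℝ≥0∞) : EReal) - (c : EReal) < a := by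
  obtain ⟨v, L, ρ, hρ, hL, hv⟩ := exists_inward_field hΩ
  obtain ⟨μ, hμ, hμΩ, hlt⟩ := exists_mutualEnergy_lt hc hdiam ha
  -- Flowing for time `t` along the inward field costs at most `-log (1 - t L)` in energy, which
  -- vanishes with `t`.
  have hlim : Tendsto (fun t : ℝ ↦ mutualEnergy c μ μ + ENNReal.ofReal (-Real.log (1 - t * L)))
      (𝓝[>] 0) (𝓝 (mutualEnergy c μ μ + ENNReal.ofReal (-Real.log (1 - 0 * L)))) := by
    refine (tendsto_const_nhds.add (ENNReal.tendsto_ofReal ?_)).mono_left nhdsWithin_le_nhds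
    refine ((Real.continuousAt_log (by simp)).tendsto.comp ?_).neg
    exact (by fun_prop : Continuous fun t : ℝ ↦ 1 - t * (L : ℝ)).tendsto 0
  simp only [zero_mul, sub_zero, Real.log_one, neg_zero, ENNReal.ofReal_zero, add_zero] at hlim
  have hlim' : Tendsto (fun t : ℝ ↦ ((mutualEnergy c μ μ +
      ENNReal.ofReal (-Real.log (1 - t * L)) : ℝ≥0∞) : EReal) - (c : EReal)) (𝓝[>] 0)
      (𝓝 (((mutualEnergy c μ μ : ℝ≥0∞) : EReal) - (c : EReal))) := by
    simp_rw [sub_eq_add_neg]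
    exact (EReal.continuousAt_add (p := (_, _)) (Or.inr (by simp)) (Or.inr (by simp))).tendsto.comp
      (((continuous_coe_ennreal_ereal.tendsto _).comp hlim).prodMk_nhds tendsto_const_nhds)
  have hsmall : ∀ᶠ t : ℝ in 𝓝[>] 0, t * L < 1 := by
    refine nhdsWithin_le_nhds ((by fun_prop : Continuous fun t : ℝ ↦ t * (L : ℝ)).continuousAt.eventually
      (gt_mem_nhds (by simp)))
  obtain ⟨t, h1, h2, ht0, htρ⟩ := ((hlim'.eventually (gt_mem_nhds hlt)).and (hsmall.and
    (Ioo_mem_nhdsGT hρ))).exists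
  set T : Eucl d → Eucl d := fun x ↦ x + t • v x with hT
  have hTc : Continuous T := continuous_id.add (hL.continuous.const_smul t)
  have hTK : IsCompact (T '' closure Ω) := hΩ.2.2.1.isCompact_closure.image hTc
  refine ⟨μ.map T, T '' closure Ω, Measure.isProbabilityMeasure_map hTc.measurable.aemeasurable,
    hTK, ?_, ?_, ?_⟩
  · rintro _ ⟨x, hx, rfl⟩
    exact hv t ht0 htρ x hx (Metric.mem_ball_self (mul_pos hρ ht0))
  · have hms : MeasurableSet {x | x ∈ T '' closure Ω} := hTK.measurableSet
    rw [ae_map_iff hTc.measurable.aemeasurable hms]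
    filter_upwards [hμΩ] with x hx using mem_image_of_mem T hx
  · refine lt_of_le_of_lt (EReal.sub_le_sub ?_ le_rfl) h1
    exact_mod_cast mutualEnergy_map_le (sub_pos.2 h2) hμΩ hTc.measurable
      fun x _ y _ ↦ mul_norm_le_of_lipschitz hL ht0.le x y

end Domain

end ChargedDrop

/-! ### Replacing a charge by uniform charges on few tiny balls. -/

namespace ChargedDrop
open Filter Topology
open scoped ENNReal NNReal

variable {d : ℕ}

lemma measurable_mutualEnergy_ballMeasure (c r : ℝ) : Measurable fun p : Eucl d × Eucl d ↦
    mutualEnergy c (ballMeasure p.1 r) (ballMeasure p.2 r) := by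
  simp_rw [mutualEnergy_ballMeasure]
  refine Measurable.lintegral_prod_right' (f := fun q : (Eucl d × Eucl d) × Eucl d ↦
    ∫⁻ v, kern c (q.1.1 + r • q.2 - (q.1.2 + r • v)) ∂(unitBallMeasure d)) ?_
  refine Measurable.lintegral_prod_right' (f := fun q : ((Eucl d × Eucl d) × Eucl d) × Eucl d ↦
    kern c (q.1.1.1 + r • q.1.2 - (q.1.1.2 + r • q.2))) ?_
  exact (measurable_kern c).comp (by fun_prop)

/-- The average over `μ ⊗ μ` of the energies between balls of radius `r`. -/
noncomputable def ballAverage (c : ℝ) (μ : Measure (Eucl d)) (r : ℝ) : ℝ≥0∞ :=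
  ∫⁻ p, mutualEnergy c (ballMeasure p.1 r) (ballMeasure p.2 r) ∂(μ.prod μ)

/-- Off the diagonal the balls separate and their distance tends to `‖x - y‖`; on the diagonal the
bound is `⊤`. -/
lemma limsup_mutualEnergy_ballMeasure_le (c : ℝ) {r : ℕ → ℝ} (hr : ∀ n, 0 < r n)
    (hlim : Tendsto r atTop (𝓝 0)) (x y : Eucl d) :
    limsup (fun n ↦ mutualEnergy c (ballMeasure x (r n)) (ballMeasure y (r n))) atTop ≤
      kern c (x - y) := by
  by_cases hxy : x - y = 0
  · rw [hxy, kern_zero]; exact le_top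
  have hpos : 0 < ‖x - y‖ := norm_pos_iff.2 hxy
  rw [kern_of_ne c hxy]
  have h1 : Tendsto (fun n ↦ ‖x - y‖ - 2 * r n) atTop (𝓝 ‖x - y‖) := by
    simpa using (tendsto_const_nhds (x := ‖x - y‖)).sub (hlim.const_mul 2)
  have h2 : Tendsto (fun n ↦ ENNReal.ofReal (c - Real.log (‖x - y‖ - 2 * r n))) atTop
      (𝓝 (ENNReal.ofReal (c - Real.log ‖x - y‖))) :=
    ENNReal.tendsto_ofReal (tendsto_const_nhds.sub
      ((Real.continuousAt_log hpos.ne').tendsto.comp h1))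
  rw [← h2.limsup_eq]
  refine limsup_le_limsup ?_
  filter_upwards [h1.eventually (lt_mem_nhds hpos)] with n hn
  refine mutualEnergy_le_of_dist hn (fun z hz w hw ↦ ?_) (ae_ballMeasure x (hr n))
    (ae_ballMeasure y (hr n))
  rw [Metric.mem_ball] at hz hw
  have := dist_triangle4 x z w y
  rw [dist_comm x z] at this
  rw [← dist_eq_norm, ← dist_eq_norm]
  linarith

/-- Reverse Fatou: `mutualEnergy_ballMeasure_le` dominates by the kernel plus a constant, which is
integrable exactly because `μ` has finite energy. -/
lemma limsup_ballAverage_le [NeZero d] (c : ℝ) {μ : Measure (Eucl d)} [IsProbabilityMeasure μ]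
    (hμ : mutualEnergy c μ μ ≠ ⊤) {r : ℕ → ℝ} (hr : ∀ n, 0 < r n) (hlim : Tendsto r atTop (𝓝 0)) :
    limsup (fun n ↦ ballAverage c μ (r n)) atTop ≤ mutualEnergy c μ μ := by
  rw [mutualEnergy_eq_lintegral_prod] at hμ ⊢
  have hk : Measurable fun p : Eucl d × Eucl d ↦ kern c (p.1 - p.2) :=
    (measurable_kern c).comp (measurable_fst.sub measurable_snd)
  refine (limsup_lintegral_le
    (fun p ↦ kern c (p.1 - p.2) + 2 * (ENNReal.ofReal (Real.log 2) + ballConst d))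
    (fun n ↦ measurable_mutualEnergy_ballMeasure c (r n))
    (fun n ↦ Eventually.of_forall fun p ↦ mutualEnergy_ballMeasure_le c p.1 p.2 (hr n)) ?_).trans
    (lintegral_mono fun p ↦ limsup_mutualEnergy_ballMeasure_le c hr hlim p.1 p.2)
  rw [lintegral_add_right _ measurable_const, lintegral_const, measure_univ, mul_one]
  exact ENNReal.add_ne_top.2 ⟨hμ, ENNReal.mul_ne_top (by simp)
    (ENNReal.add_ne_top.2 ⟨ENNReal.ofReal_ne_top, ballConst_ne_top⟩)⟩

/-- Independent random points realize the average energy up to the diagonal contribution. -/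
lemma exists_points_sum_mutualEnergy_le {μ : Measure (Eucl d)} [IsProbabilityMeasure μ]
    {K : Set (Eucl d)} (hK : ∀ᵐ x ∂μ, x ∈ K) (c : ℝ) {r : ℝ} (hr : 0 < r) (N : ℕ) :
    ∃ x : Fin N → Eucl d, (∀ i, x i ∈ K) ∧
      ∑ i, ∑ j, mutualEnergy c (ballMeasure (x i) r) (ballMeasure (x j) r) ≤
        N * (N * ballAverage c μ r + (ENNReal.ofReal (c - Real.log r) + ballConst d)) := by
  set P : Measure (Fin N → Eucl d) := Measure.pi fun _ ↦ μ
  set M : Eucl d × Eucl d → ℝ≥0∞ := fun p ↦ mutualEnergy c (ballMeasure p.1 r) (ballMeasure p.2 r)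
  have hM : Measurable M := measurable_mutualEnergy_ballMeasure c r
  have hpair (i j : Fin N) : Measurable fun x : Fin N → Eucl d ↦ (x i, x j) :=
    (measurable_pi_apply i).prodMk (measurable_pi_apply j)
  have hMp (i j : Fin N) : Measurable fun x : Fin N → Eucl d ↦ M (x i, x j) := hM.comp (hpair i j)
  have hae : ∀ᵐ x ∂P, ∀ i, x i ∈ K := by
    rw [ae_all_iff]
    exact fun i ↦ (measurePreserving_eval (fun _ : Fin N ↦ μ) i).quasiMeasurePreserving.ae hK
  have hmeas : Measurable fun x : Fin N → Eucl d ↦ ∑ i, ∑ j, M (x i, x j) :=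
    Finset.measurable_sum _ fun i _ ↦ Finset.measurable_sum _ fun j _ ↦ hMp i j
  -- First-moment argument: some sample avoids the null set and has energy at most the expectation.
  obtain ⟨x, hx, hle⟩ := exists_notMem_null_le_lintegral hmeas.aemeasurable hae
  refine ⟨x, not_not.1 hx, hle.trans ?_⟩
  set S := ENNReal.ofReal (c - Real.log r) + ballConst d
  -- Distinct samples have joint law `μ.prod μ` and give `ballAverage`; only the `N` diagonal pairs
  -- pay the self-energy `S`.
  have hterm (i j : Fin N) : ∫⁻ x, M (x i, x j) ∂P ≤ ballAverage c μ r + if i = j then S else 0 := by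
    split_ifs with h
    · subst h
      refine le_add_left ?_
      calc _ ≤ ∫⁻ _, S ∂P := lintegral_mono fun x ↦ mutualEnergy_ballMeasure_self_le c _ hr
        _ = S := by simp
    · have hind : ProbabilityTheory.IndepFun (fun x : Fin N → Eucl d ↦ x i) (fun x ↦ x j) P :=
        (ProbabilityTheory.iIndepFun_pi (μ := fun _ : Fin N ↦ μ) (X := fun _ ↦ id)
          fun _ ↦ aemeasurable_id).indepFun h
      have hmap := (ProbabilityTheory.indepFun_iff_map_prod_eq_prod_map_map
        (measurable_pi_apply i).aemeasurable (measurable_pi_apply j).aemeasurable).1 hind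
      have hev (k : Fin N) : P.map (fun x ↦ x k) = μ :=
        (measurePreserving_eval (fun _ : Fin N ↦ μ) k).map_eq
      rw [hev, hev] at hmap
      rw [add_zero, ballAverage, ← hmap, lintegral_map hM (hpair i j)]
  rw [lintegral_finsetSum _ fun i _ ↦ Finset.measurable_sum _ fun j _ ↦ hMp i j]
  simp_rw [lintegral_finsetSum _ fun j _ ↦ hMp _ j]
  calc _ ≤ ∑ i : Fin N, ∑ j : Fin N, (ballAverage c μ r + if i = j then S else 0) :=
        Finset.sum_le_sum fun i _ ↦ Finset.sum_le_sum fun j _ ↦ hterm i j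
    _ = _ := by simp [Finset.sum_add_distrib, mul_add]

/-- The diagonal cost for `N = n + 1` balls of radius `N⁻²`: it is of order `(log N) / N`. -/
lemma tendsto_inv_mul_log_add (c : ℝ) (C : ℝ≥0∞) (hC : C ≠ ⊤) :
    Tendsto (fun n : ℕ ↦ ((n + 1 : ℕ) : ℝ≥0∞)⁻¹ *
      (ENNReal.ofReal (c - Real.log ((1 / ((n : ℝ) + 1)) ^ 2)) + C)) atTop (𝓝 0) := by
  have h1 : Tendsto (fun n : ℕ ↦ 1 / ((n : ℝ) + 1)) atTop (𝓝 0) :=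
    tendsto_one_div_add_atTop_nhds_zero_nat
  have h2 : Tendsto (fun n : ℕ ↦ Real.log ((n : ℝ) + 1) / ((n : ℝ) + 1)) atTop (𝓝 0) := by
    have := Real.isLittleO_log_id_atTop.tendsto_div_nhds_zero
    exact this.comp (tendsto_atTop_add_const_right _ 1 tendsto_natCast_atTop_atTop)
  have h3 : Tendsto (fun n : ℕ ↦ ENNReal.ofReal (1 / ((n : ℝ) + 1) * c +
      2 * (Real.log ((n : ℝ) + 1) / ((n : ℝ) + 1))) + ENNReal.ofReal (1 / ((n : ℝ) + 1)) * C)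
      atTop (𝓝 (ENNReal.ofReal (0 * c + 2 * 0) + ENNReal.ofReal 0 * C)) := by
    refine (ENNReal.tendsto_ofReal ((h1.mul_const c).add (h2.const_mul 2))).add ?_
    exact ENNReal.Tendsto.mul_const (ENNReal.tendsto_ofReal h1) (Or.inr hC)
  simp only [zero_mul, mul_zero, add_zero, ENNReal.ofReal_zero] at h3
  refine h3.congr fun n ↦ ?_
  have hn : (0 : ℝ) < (n : ℝ) + 1 := by positivity
  have hinv : ((n + 1 : ℕ) : ℝ≥0∞)⁻¹ = ENNReal.ofReal (1 / ((n : ℝ) + 1)) := by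
    rw [one_div, ENNReal.ofReal_inv_of_pos hn]
    congr 1
    rw [← ENNReal.ofReal_natCast]; push_cast; rfl
  rw [hinv, mul_add, ← ENNReal.ofReal_mul (by positivity)]
  congr 2
  rw [Real.log_pow, one_div, Real.log_inv]
  push_cast
  ring

/-- A measure of finite energy can be replaced by one concentrated on an open set of small volume
and perimeter. -/
theorem exists_small_open_of_mutualEnergy_lt (hd : 2 ≤ d) {c : ℝ} {μ : Measure (Eucl d)}
    [IsProbabilityMeasure μ] {K Ω : Set (Eucl d)} (hK : IsCompact K) (hΩ : IsOpen Ω)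
    (hKΩ : K ⊆ Ω) (hμ : ∀ᵐ x ∂μ, x ∈ K) {b : ℝ≥0∞} (hb : mutualEnergy c μ μ < b)
    {η : ℝ} (hη : 0 < η) :
    ∃ T : Set (Eucl d), IsOpen T ∧ T ⊆ Ω ∧ Bornology.IsBounded T ∧
      tv (T.indicator 1) ≤ ENNReal.ofReal η ∧
      volume T ≤ ENNReal.ofReal η ∧ ∃ ν : Measure (Eucl d), IsProbabilityMeasure ν ∧
        (∀ᵐ x ∂ν, x ∈ T) ∧ mutualEnergy c ν ν < b := by
  have : NeZero d := ⟨by omega⟩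
  have hω := (unitBallVolume_pos (d := d)).le
  obtain ⟨ε, hε, hth⟩ := hK.exists_thickening_subset_open hΩ hKΩ
  -- With `N = n + 1` balls the radius is `N⁻²`. Then `N r ^ (d - 1) ≤ 1 / N` because `d ≥ 2`, so
  -- perimeter and volume vanish, while `log (1 / r) = 2 log N` is still negligible against `N`.
  set r : ℕ → ℝ := fun n ↦ (1 / ((n : ℝ) + 1)) ^ 2 with hr
  have hr0 (n : ℕ) : 0 < r n := by positivity
  have h1 : Tendsto (fun n : ℕ ↦ 1 / ((n : ℝ) + 1)) atTop (𝓝 0) :=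
    tendsto_one_div_add_atTop_nhds_zero_nat
  have hrlim : Tendsto r atTop (𝓝 0) := by simpa [hr] using h1.pow 2
  obtain ⟨b', hb1, hb2⟩ := exists_between hb
  have hJ := eventually_lt_of_limsup_lt ((limsup_ballAverage_le c hb.ne_top hr0 hrlim).trans_lt hb1)
  have hS := (tendsto_inv_mul_log_add c (ballConst d) ballConst_ne_top).eventually
    (gt_mem_nhds (tsub_pos_iff_lt.2 hb2))
  have hP : ∀ᶠ n : ℕ in atTop, d * unitBallVolume d * (1 / ((n : ℝ) + 1)) < η :=
    (h1.const_mul (d * unitBallVolume d)).eventually (gt_mem_nhds (by simpa using hη))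
  have hV : ∀ᶠ n : ℕ in atTop, unitBallVolume d * (1 / ((n : ℝ) + 1)) < η :=
    (h1.const_mul (unitBallVolume d)).eventually (gt_mem_nhds (by simpa using hη))
  obtain ⟨n, hJn, hSn, hPn, hVn, hrn⟩ :=
    (hJ.and (hS.and (hP.and (hV.and (hrlim.eventually (gt_mem_nhds hε)))))).exists
  obtain ⟨x, hxK, hx⟩ := exists_points_sum_mutualEnergy_le hμ c (hr0 n) (n + 1)
  set a : ℝ := 1 / ((n : ℝ) + 1) with ha
  have ha0 : 0 < a := by positivity
  have ha1 : a ≤ 1 := by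
    rw [ha, div_le_one (by positivity)]
    linarith [(Nat.cast_nonneg n : (0 : ℝ) ≤ n)]
  have hra : r n = a ^ 2 := rfl
  have hna : ((n : ℝ) + 1) * a = 1 := by rw [ha]; field_simp
  have hpow {k : ℕ} (hk : 1 ≤ k) : r n ^ k ≤ a ^ 2 := by
    rw [hra]
    exact pow_le_of_le_one (by positivity) (pow_le_one₀ ha0.le ha1) (by omega)
  have hcast : ((n + 1 : ℕ) : ℝ≥0∞) = ENNReal.ofReal ((n : ℝ) + 1) := by
    rw [← ENNReal.ofReal_natCast]; push_cast; rfl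
  refine ⟨⋃ i, Metric.ball (x i) (r n), isOpen_iUnion fun _ ↦ Metric.isOpen_ball,
    iUnion_subset fun i ↦ ((Metric.ball_subset_ball hrn.le).trans
      (Metric.ball_subset_thickening (hxK i) ε)).trans hth,
    Bornology.isBounded_iUnion.2 fun _ ↦ Metric.isBounded_ball, ?_, ?_,
    multiBallMeasure x (r n), isProbabilityMeasure_multiBallMeasure n.succ_ne_zero x _,
    ae_multiBallMeasure x (hr0 n), ?_⟩
  · refine (tv_iUnion_ball_le x (hr0 n)).trans ?_
    rw [hcast, ← ENNReal.ofReal_mul (by positivity)]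
    refine ENNReal.ofReal_le_ofReal ?_
    calc _ ≤ ((n : ℝ) + 1) * (d * unitBallVolume d * a ^ 2) := by
          gcongr
          exact hpow (by omega)
      _ = (((n : ℝ) + 1) * a) * (d * unitBallVolume d * a) := by ring
      _ ≤ η := by rw [hna, one_mul]; exact hPn.le
  · refine (measure_iUnion_le _).trans ?_
    simp_rw [volume_ball_eq _ (hr0 n).le, tsum_fintype, Finset.sum_const, Finset.card_univ,
      Fintype.card_fin, nsmul_eq_mul]
    rw [hcast, ← ENNReal.ofReal_mul (by positivity)]
    refine ENNReal.ofReal_le_ofReal ?_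
    calc _ ≤ ((n : ℝ) + 1) * (a ^ 2 * unitBallVolume d) := by
          gcongr
          exact hpow (by omega)
      _ = (((n : ℝ) + 1) * a) * (unitBallVolume d * a) := by ring
      _ ≤ η := by rw [hna, one_mul]; exact hVn.le
  · rw [mutualEnergy_multiBallMeasure]
    set N : ℝ≥0∞ := ((n + 1 : ℕ) : ℝ≥0∞) with hN
    have hN0 : N ≠ 0 := by simp [hN]
    have hNt : N ≠ ⊤ := by simp [hN]
    calc _ ≤ N⁻¹ * (N⁻¹ * (N * (N * ballAverage c μ (r n) +
          (ENNReal.ofReal (c - Real.log (r n)) + ballConst d)))) := by gcongr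
      _ = ballAverage c μ (r n) + N⁻¹ * (ENNReal.ofReal (c - Real.log (r n)) + ballConst d) := by
          rw [← mul_assoc N⁻¹ N, ENNReal.inv_mul_cancel hN0 hNt, one_mul, mul_add, ← mul_assoc,
            ENNReal.inv_mul_cancel hN0 hNt, one_mul]
      _ < b' + (b - b') := ENNReal.add_lt_add hJn hSn
      _ = b := add_tsub_cancel_of_le hb2.le

end ChargedDrop

/-! ### Open approximations and competitors of prescribed volume. -/

namespace ChargedDrop
open Filter Topology
open scoped ENNReal NNReal

variable {d : ℕ}

/-- Chebyshev: for a level in `(θ, 1 - θ)`, the mollification differs from the indicator by at least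
`θ` on the symmetric difference. -/
lemma volume_symmDiff_superlevel_le (k : ℕ) {E : Set (Eucl d)} (hE : MeasurableSet E)
    (hb : Bornology.IsBounded E) {θ t : ℝ} (hθ : 0 < θ) (ht : t ∈ Ioo θ (1 - θ)) :
    volume (symmDiff {x | t < mollify k E x} E) ≤
      ENNReal.ofReal (((k : ℝ) + 1)⁻¹) * tv (E.indicator 1) / ENNReal.ofReal θ := by
  have hsub : symmDiff {x | t < mollify k E x} E ⊆
      {x | ENNReal.ofReal θ ≤ ‖mollify k E x - E.indicator 1 x‖ₑ} := by
    rintro x (⟨h1, h2⟩ | ⟨h1, h2⟩)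
    · have h1 : t < mollify k E x := h1
      rw [mem_ofPred_eq, indicator_of_notMem h2, sub_zero, Real.enorm_eq_ofReal_abs]
      exact ENNReal.ofReal_le_ofReal ((ht.1.trans h1).le.trans (le_abs_self _))
    · have h2 : mollify k E x ≤ t := not_lt.1 h2
      rw [mem_ofPred_eq, indicator_of_mem h1, Real.enorm_eq_ofReal_abs, abs_sub_comm]
      refine ENNReal.ofReal_le_ofReal (le_trans ?_ (le_abs_self _))
      rw [Pi.one_apply]
      linarith [ht.2]
  refine (measure_mono hsub).trans ((meas_ge_le_lintegral_div ?_ (by simpa using hθ)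
    ENNReal.ofReal_ne_top).trans ?_)
  · exact ((contDiff_mollify k hE (n := 1)).continuous.measurable.sub
      (measurable_one.indicator hE)).enorm.aemeasurable
  · exact ENNReal.div_le_div_right (lintegral_mollify_sub_le k hE hb) _

/-- Sets of finite perimeter in `Ω` are approximated by open subsets of `Ω`, with perimeters. -/
theorem exists_open_approx {Ω E : Set (Eucl d)} (hΩ : IsOpen Ω) (hb : Bornology.IsBounded Ω)
    (hP : tv (Ω.indicator 1) ≠ ⊤) (hE : MeasurableSet E) (hEΩ : E ⊆ Ω)
    (hEP : tv (E.indicator 1) ≠ ⊤) {η : ℝ} (hη : 0 < η) :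
    ∃ G : Set (Eucl d), IsOpen G ∧ G ⊆ Ω ∧
      tv (G.indicator 1) ≤ tv (E.indicator 1) + ENNReal.ofReal η ∧
      volume (symmDiff G E) ≤ ENNReal.ofReal η := by
  have hEb := hb.subset hEΩ
  set P := (tv (E.indicator 1)).toReal with hPdef
  have hP0 : 0 ≤ P := ENNReal.toReal_nonneg
  have hPE : tv (E.indicator 1) = ENNReal.ofReal P := (ENNReal.ofReal_toReal hEP).symm
  -- Chosen so that `P ≤ (1 - 2 θ) (P + η / 2)`: restricting levels to `(θ, 1 - θ)` costs at most `η
  -- / 2` of perimeter.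
  set θ : ℝ := η / (4 * (P + η)) with hθdef
  have hθ : 0 < θ := by positivity
  have hθ4 : θ * (4 * (P + η)) = η := by rw [hθdef]; field_simp
  have hθ1 : 0 < 1 - 2 * θ := by nlinarith
  have hlevel (k : ℕ) : ∃ t ∈ Ioo θ (1 - θ), ENNReal.ofReal (1 - θ - θ) *
      tv ({x | t < mollify k E x}.indicator 1) ≤ ∫⁻ x, ‖fderiv ℝ (mollify k E) x‖ₑ :=
    exists_tv_superlevel_le (contDiff_mollify k hE) (hasCompactSupport_mollify k hEb) (by linarith)
  choose t ht htv using hlevel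
  set F : ℕ → Set (Eucl d) := fun k ↦ {x | t k < mollify k E x} with hF
  have hFo (k : ℕ) : IsOpen (F k) :=
    isOpen_lt continuous_const (contDiff_mollify k hE (n := 1)).continuous
  have hFb (k : ℕ) : Bornology.IsBounded (F k) := by
    refine (hasCompactSupport_mollify k hEb).isBounded.subset fun x hx ↦ subset_tsupport _ ?_
    have : t k < mollify k E x := hx
    exact ne_of_gt ((hθ.trans (ht k).1).trans this)
  have hFtv (k : ℕ) : tv ((F k).indicator 1) ≤ ENNReal.ofReal (P + η / 2) := by
    have h1 := (htv k).trans (lintegral_fderiv_mollify_le k hE hEb)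
    have h2 : tv (E.indicator 1) ≤ ENNReal.ofReal (1 - θ - θ) * ENNReal.ofReal (P + η / 2) := by
      rw [hPE, ← ENNReal.ofReal_mul (by linarith)]
      exact ENNReal.ofReal_le_ofReal (by nlinarith)
    have h0 : ENNReal.ofReal (1 - θ - θ) ≠ 0 := by
      rw [Ne, ENNReal.ofReal_eq_zero, not_le]; linarith
    exact (ENNReal.mul_le_mul_iff_right h0 ENNReal.ofReal_ne_top).1 (h1.trans h2)
  have hvol : Tendsto (fun k ↦ volume (symmDiff (F k) E)) atTop (𝓝 0) := by
    have hlim : Tendsto (fun k : ℕ ↦ ENNReal.ofReal (((k : ℝ) + 1)⁻¹) * tv (E.indicator 1) /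
        ENNReal.ofReal θ) atTop (𝓝 (ENNReal.ofReal 0 * tv (E.indicator 1) / ENNReal.ofReal θ)) := by
      refine ENNReal.Tendsto.div_const (ENNReal.Tendsto.mul_const (ENNReal.tendsto_ofReal ?_)
        (Or.inr hEP)) (Or.inr (by simpa using hθ))
      simpa using tendsto_one_div_add_atTop_nhds_zero_nat (𝕜 := ℝ)
    rw [ENNReal.ofReal_zero, zero_mul, ENNReal.zero_div] at hlim
    exact tendsto_of_tendsto_of_tendsto_of_le_of_le tendsto_const_nhds hlim (fun _ ↦ zero_le)
      fun k ↦ volume_symmDiff_superlevel_le k hE hEb hθ (ht k)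
  -- The superlevel sets may leak out of `Ω`. Submodularity bounds the perimeter of `F ∩ Ω` by those
  -- of `F` and `Ω` minus that of `F ∪ Ω`. Since `F ∪ Ω` tends to `Ω` in measure, semicontinuity
  -- shows that cutting costs at most `η / 2`.
  have hlsc : tv (Ω.indicator 1) ≤ liminf (fun k ↦ tv ((F k ∪ Ω).indicator 1)) atTop := by
    refine tv_indicator_le_liminf hΩ.measurableSet (fun k ↦ ((hFo k).union hΩ).measurableSet) ?_
    refine tendsto_of_tendsto_of_tendsto_of_le_of_le tendsto_const_nhds hvol (fun _ ↦ zero_le)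
      fun k ↦ measure_mono ?_
    rintro x (⟨h1 | h1, h2⟩ | ⟨h1, h2⟩)
    · exact Or.inl ⟨h1, fun h ↦ h2 (hEΩ h)⟩
    · exact absurd h1 h2
    · exact absurd (Or.inr h1) h2
  have hev : ∀ᶠ k in atTop, tv (Ω.indicator 1) ≤ tv ((F k ∪ Ω).indicator 1) + ENNReal.ofReal (η / 2) := by
    by_cases h0 : tv (Ω.indicator 1) = 0
    · exact Eventually.of_forall fun k ↦ h0 ▸ zero_le
    · have hlt : tv (Ω.indicator 1) - ENNReal.ofReal (η / 2) < tv (Ω.indicator 1) :=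
        ENNReal.sub_lt_self hP h0 (by simpa using hη)
      filter_upwards [eventually_lt_of_lt_liminf (hlt.trans_le hlsc)] with k hk
      exact tsub_le_iff_right.1 hk.le
  obtain ⟨k, hk1, hk2⟩ := (hev.and (hvol.eventually (gt_mem_nhds (by simpa using hη :
    (0 : ℝ≥0∞) < ENNReal.ofReal η)))).exists
  refine ⟨F k ∩ Ω, (hFo k).inter hΩ, inter_subset_right, ?_, (measure_mono ?_).trans hk2.le⟩
  · have hsum := tv_inter_add_tv_union_le (hFo k).measurableSet hΩ.measurableSet (hFb k) hb
    have hfin : tv ((F k ∪ Ω).indicator 1) ≠ ⊤ := ne_top_of_le_ne_top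
      (ENNReal.add_ne_top.2 ⟨ne_top_of_le_ne_top ENNReal.ofReal_ne_top (hFtv k), hP⟩)
      (le_add_self.trans hsum)
    have h1 : tv ((F k ∩ Ω).indicator 1) + tv ((F k ∪ Ω).indicator 1) ≤
        (ENNReal.ofReal (P + η / 2) + ENNReal.ofReal (η / 2)) + tv ((F k ∪ Ω).indicator 1) := by
      refine hsum.trans ?_
      rw [add_assoc, add_comm (ENNReal.ofReal (η / 2))]
      exact add_le_add (hFtv k) hk1
    have h2 := (ENNReal.add_le_add_iff_right hfin).1 h1
    rw [← ENNReal.ofReal_add (by positivity) (by positivity), add_assoc, add_halves,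
      ENNReal.ofReal_add hP0 hη.le, ← hPE] at h2
    exact h2
  · rintro x (⟨h1, h2⟩ | ⟨h1, h2⟩)
    · exact Or.inl ⟨h1.1, h2⟩
    · exact Or.inr ⟨h1, fun h ↦ h2 ⟨h, hEΩ h1⟩⟩

lemma exists_forall_ball_inter_pos {E : Set (Eucl d)} (hE : volume E ≠ 0) :
    ∃ x ∈ E, ∀ ρ, 0 < ρ → 0 < volume (Metric.ball x ρ ∩ E) := by
  obtain ⟨x, hx, h⟩ := exists_mem_forall_mem_nhdsWithin_pos_measure hE
  exact ⟨x, hx, fun ρ hρ ↦ h _ (inter_mem (mem_nhdsWithin_of_mem_nhds (Metric.ball_mem_nhds x hρ))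
    self_mem_nhdsWithin)⟩

/-- Open competitors of prescribed volume containing a given small open set. -/
theorem exists_open_competitor (hd : 2 ≤ d) {Ω E₀ : Set (Eucl d)} (hΩ : IsOpen Ω)
    (hb : Bornology.IsBounded Ω) (hP : tv (Ω.indicator 1) ≠ ⊤) (hE : MeasurableSet E₀)
    (hEΩ : E₀ ⊆ Ω) (hEP : tv (E₀.indicator 1) ≠ ⊤) {m : ℝ} (hm : 0 < m)
    (hEm : volume E₀ = ENNReal.ofReal m) (hmΩ : ENNReal.ofReal m < volume Ω)
    {η : ℝ} (hη : 0 < η) :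
    ∃ τ : ℝ, 0 < τ ∧ ∀ T : Set (Eucl d), IsOpen T → T ⊆ Ω → tv (T.indicator 1) ≤ ENNReal.ofReal τ →
      volume T ≤ ENNReal.ofReal τ → ∃ E : Set (Eucl d), IsOpen E ∧ T ⊆ E ∧ E ⊆ Ω ∧
        volume E = ENNReal.ofReal m ∧
        tv (E.indicator 1) ≤ tv (E₀.indicator 1) + ENNReal.ofReal η := by
  have : NeZero d := ⟨by omega⟩
  have hω := unitBallVolume_pos (d := d)
  have hfinΩ : volume Ω ≠ ⊤ := hb.measure_lt_top.ne
  have hfin {S : Set (Eucl d)} (hS : S ⊆ Ω) : volume S ≠ ⊤ := measure_ne_top_of_subset hS hfinΩ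
  have hEmr : volume.real E₀ = m := by
    rw [measureReal_def, hEm, ENNReal.toReal_ofReal hm.le]
  -- Near `x₀` the set `E₀` has volume to remove; near `x₁`, found next, `Ω \ E₀` has room to add.
  obtain ⟨x₀, -, hx₀⟩ := exists_forall_ball_inter_pos (E := E₀) (by rw [hEm]; simpa using hm)
  obtain ⟨x₁, hx₁Ω, hx₁⟩ := exists_forall_ball_inter_pos (E := Ω \ E₀) (by
    rw [measure_sdiff hEΩ hE.nullMeasurableSet (hfin hEΩ), hEm]
    exact (tsub_pos_iff_lt.2 hmΩ).ne')
  have hper : ∀ᶠ r : ℝ in 𝓝[>] 0, d * unitBallVolume d * r ^ (d - 1) < η / 4 := by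
    refine nhdsWithin_le_nhds ((by fun_prop : Continuous fun r : ℝ ↦
      d * unitBallVolume d * r ^ (d - 1)).continuousAt.eventually (gt_mem_nhds ?_))
    beta_reduce
    rw [zero_pow (by omega), mul_zero]
    positivity
  obtain ⟨r₀, hr₀P, hr₀⟩ := (hper.and self_mem_nhdsWithin).exists
  have hr₀ : 0 < r₀ := hr₀
  set β₀ := volume.real (Metric.ball x₀ r₀ ∩ E₀) with hβ₀
  have hβ₀pos : 0 < β₀ := ENNReal.toReal_pos (hx₀ r₀ hr₀).ne'
    (hfin (inter_subset_right.trans hEΩ))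
  have hvolr : ∀ᶠ r : ℝ in 𝓝[>] 0, r ^ d * unitBallVolume d < β₀ / 3 := by
    refine nhdsWithin_le_nhds ((by fun_prop : Continuous fun r : ℝ ↦
      r ^ d * unitBallVolume d).continuousAt.eventually (gt_mem_nhds ?_))
    beta_reduce
    rw [zero_pow (by omega), zero_mul]
    positivity
  obtain ⟨ρ, hρ, hρΩ⟩ := Metric.isOpen_iff.1 hΩ x₁ hx₁Ω.1
  obtain ⟨r₁, hr₁P, hr₁V, hr₁⟩ := (hper.and (hvolr.and (Ioo_mem_nhdsGT hρ))).exists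
  set B := Metric.ball x₁ r₁ with hB
  have hBΩ : B ⊆ Ω := (Metric.ball_subset_ball hr₁.2.le).trans hρΩ
  have hBV : volume.real B < β₀ / 3 := by
    rwa [measureReal_def, hB, volume_ball_eq _ hr₁.1.le, ENNReal.toReal_ofReal
      (mul_nonneg (pow_nonneg hr₁.1.le _) hω.le)]
  set β₁ := volume.real (B ∩ (Ω \ E₀)) with hβ₁
  have hβ₁pos : 0 < β₁ := ENNReal.toReal_pos (hx₁ r₁ hr₁.1).ne' (hfin (inter_subset_left.trans hBΩ))
  -- The approximation error must not exceed the volume `β₁` gained by adding `B`, nor a third of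
  -- the volume `β₀` removable at `x₀`.
  set η' := min (η / 4) (min (β₀ / 3) β₁) with hη'
  have hη'pos : 0 < η' := lt_min (by positivity) (lt_min (by positivity) hβ₁pos)
  obtain ⟨G, hGo, hGΩ, hGP, hGV⟩ := exists_open_approx hΩ hb hP hE hEΩ hEP hη'pos
  have hη'1 : η' ≤ η / 4 := min_le_left _ _
  have hη'2 : η' ≤ β₀ / 3 := (min_le_right _ _).trans (min_le_left _ _)
  have hη'3 : η' ≤ β₁ := (min_le_right _ _).trans (min_le_right _ _)
  have hsymm {S : Set (Eucl d)} (hS : S ⊆ symmDiff G E₀) : volume.real S ≤ η' :=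
    ENNReal.toReal_le_of_le_ofReal hη'pos.le ((measure_mono hS).trans hGV)
  refine ⟨min (η / 4) (β₀ / 3), lt_min (by positivity) (by positivity), fun T hTo hTΩ hTP hTV ↦ ?_⟩
  have hTV' : volume.real T ≤ β₀ / 3 := (ENNReal.toReal_le_of_le_ofReal
    (le_min (by positivity) (by positivity)) hTV).trans (min_le_right _ _)
  have hTP' : tv (T.indicator 1) ≤ ENNReal.ofReal (η / 4) :=
    hTP.trans (ENNReal.ofReal_le_ofReal (min_le_left _ _))
  set A := G ∪ B with hA
  have hAΩ : A ⊆ Ω := union_subset hGΩ hBΩ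
  have hAo : IsOpen A := hGo.union Metric.isOpen_ball
  have hAlow : m ≤ volume.real A := by
    have h1 : volume.real (E₀ ∪ B ∩ (Ω \ E₀)) ≤ volume.real (A ∪ E₀ \ G) := by
      refine measureReal_mono ?_ (hfin (union_subset hAΩ (sdiff_subset.trans hEΩ)))
      rintro x (hx | hx)
      · by_cases hxG : x ∈ G
        · exact Or.inl (Or.inl hxG)
        · exact Or.inr ⟨hx, hxG⟩
      · exact Or.inl (Or.inr hx.1)
    rw [measureReal_union (disjoint_left.2 fun x hx h ↦ h.2.2 hx)
      (Metric.isOpen_ball.measurableSet.inter (hΩ.measurableSet.diff hE)) (hfin hEΩ)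
      (hfin (inter_subset_left.trans hBΩ)), hEmr] at h1
    have h2 := measureReal_union_le (μ := volume) A (E₀ \ G)
    have h3 := hsymm (S := E₀ \ G) subset_union_right
    linarith
  -- Removing the whole ball frees at least `β₀`; the approximation error, the added ball and `T`
  -- each take back at most `β₀ / 3`.
  have hAup : volume.real (A \ Metric.closedBall x₀ r₀) + volume.real T ≤ m := by
    have h1 : volume.real (A \ Metric.closedBall x₀ r₀) ≤
        volume.real ((E₀ \ (Metric.ball x₀ r₀ ∩ E₀)) ∪ (G \ E₀ ∪ B)) := by
      refine measureReal_mono ?_ (hfin (union_subset (sdiff_subset.trans hEΩ)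
        (union_subset (sdiff_subset.trans hGΩ) hBΩ)))
      rintro x ⟨hx | hx, hxb⟩
      · by_cases hxE : x ∈ E₀
        · exact Or.inl ⟨hxE, fun h ↦ hxb (Metric.ball_subset_closedBall h.1)⟩
        · exact Or.inr (Or.inl ⟨hx, hxE⟩)
      · exact Or.inr (Or.inr hx)
    have h2 := measureReal_union_le (μ := volume) (E₀ \ (Metric.ball x₀ r₀ ∩ E₀)) (G \ E₀ ∪ B)
    have h3 := measureReal_union_le (μ := volume) (G \ E₀) B
    have h4 := hsymm (S := G \ E₀) subset_union_left
    rw [measureReal_sdiff inter_subset_right (Metric.isOpen_ball.measurableSet.inter hE)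
      (hfin hEΩ), hEmr] at h2
    linarith
  have hTfin := hfin hTΩ
  -- The volume is tuned on `A \ T` with target `m - |T|`, so `T` itself is left intact.
  obtain ⟨s, hs, hsv⟩ := exists_volume_diff_closedBall_eq (A := A \ T)
    (hfin (sdiff_subset.trans hAΩ)) x₀ (s₁ := r₀) (m := m - volume.real T) hr₀.le (by
      have h1 : volume.real ((A \ T) \ Metric.closedBall x₀ r₀) ≤
          volume.real (A \ Metric.closedBall x₀ r₀) :=
        measureReal_mono (sdiff_subset_sdiff_left sdiff_subset) (hfin (sdiff_subset.trans hAΩ))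
      linarith) (by
      have h1 : volume.real A ≤ volume.real ((A \ T) ∪ T) :=
        measureReal_mono (by rw [sdiff_union_self]; exact subset_union_left)
          (hfin (union_subset (sdiff_subset.trans hAΩ) hTΩ))
      have h2 := measureReal_union_le (μ := volume) (A \ T) T
      linarith)
  have hbd {S : Set (Eucl d)} (hS : S ⊆ Ω) := hb.subset hS
  have hcb : tv ((Metric.closedBall x₀ s).indicator 1) ≤ ENNReal.ofReal (η / 4) := by
    rcases hs.1.eq_or_lt with h0 | h0
    · rw [← h0, Metric.closedBall_zero, tv_indicator_congr (F := ∅) (by simp), tv_empty]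
      exact zero_le
    · refine (tv_closedBall_le x₀ h0).trans (ENNReal.ofReal_le_ofReal (le_trans ?_ hr₀P.le))
      have := hs.2
      gcongr
  refine ⟨(A \ Metric.closedBall x₀ s) ∪ T,
    (hAo.sdiff Metric.isClosed_closedBall).union hTo, subset_union_right,
    union_subset (sdiff_subset.trans hAΩ) hTΩ, ?_, ?_⟩
  · have hset : (A \ Metric.closedBall x₀ s) ∪ T = ((A \ T) \ Metric.closedBall x₀ s) ∪ T := by
      ext x; simp only [mem_union, Set.mem_sdiff]; tauto
    have hv : volume.real ((A \ Metric.closedBall x₀ s) ∪ T) = m := by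
      rw [hset, measureReal_union (disjoint_left.2 fun x hx h ↦ hx.1.2 h) hTo.measurableSet
        (hfin (sdiff_subset.trans (sdiff_subset.trans hAΩ))) hTfin, hsv]
      ring
    rw [← hv, ofReal_measureReal (hfin (union_subset (sdiff_subset.trans hAΩ) hTΩ))]
  · have hcm : MeasurableSet (Metric.closedBall x₀ s) := Metric.isClosed_closedBall.measurableSet
    calc _ ≤ tv (G.indicator 1) + tv (B.indicator 1) + tv ((Metric.closedBall x₀ s).indicator 1) +
          tv (T.indicator 1) := by
          refine (tv_union_le (hAo.measurableSet.diff hcm) hTo.measurableSet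
            (hbd (sdiff_subset.trans hAΩ)) (hbd hTΩ)).trans (add_le_add_left ?_ _)
          refine (tv_diff_le hAo.measurableSet hcm (hbd hAΩ) Metric.isBounded_closedBall).trans
            (add_le_add_left ?_ _)
          exact tv_union_le hGo.measurableSet Metric.isOpen_ball.measurableSet (hbd hGΩ) (hbd hBΩ)
      _ ≤ (tv (E₀.indicator 1) + ENNReal.ofReal (η / 4)) + ENNReal.ofReal (η / 4) +
          ENNReal.ofReal (η / 4) + ENNReal.ofReal (η / 4) := by
          refine add_le_add (add_le_add (add_le_add ?_ ?_) hcb) hTP'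
          · exact hGP.trans (add_le_add le_rfl (ENNReal.ofReal_le_ofReal hη'1))
          · exact (tv_ball_le x₁ hr₁.1).trans (ENNReal.ofReal_le_ofReal hr₁P.le)
      _ = _ := by
          have h4 : 0 ≤ η / 4 := by positivity
          rw [add_assoc, add_assoc, add_assoc, ← ENNReal.ofReal_add h4 h4,
            ← ENNReal.ofReal_add h4 (by positivity), ← ENNReal.ofReal_add h4 (by positivity)]
          congr 2
          ring

end ChargedDrop

/-! ### Decoupling of perimeter and energy in a smooth domain. -/

namespace ChargedDrop
open Filter Topology
open scoped ENNReal NNReal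

variable {d : ℕ}

lemma perimeter_ne_bot {E : Set (Eucl d)} (hE : MeasurableSet E) : perimeter E ≠ ⊥ := by
  rw [perimeter_eq_tv hE]; simp

lemma exists_forall_norm_sub_le_exp {S : Set (Eucl d)} (hS : Bornology.IsBounded S) :
    ∃ c : ℝ, 0 ≤ c ∧ ∀ x ∈ closure S, ∀ y ∈ closure S, ‖x - y‖ ≤ Real.exp c := by
  obtain ⟨C, hC⟩ := hS.closure.exists_norm_le
  refine ⟨max 0 (2 * C), le_max_left _ _, fun x hx y hy ↦ ?_⟩
  have h1 := hC x hx
  have h2 := hC y hy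
  have h3 := norm_sub_le x y
  have h4 := Real.add_one_le_exp (max 0 (2 * C))
  have h5 := le_max_right 0 (2 * C)
  linarith

/-- Open sets in a smooth domain with almost optimal perimeter and almost optimal energy. -/
theorem exists_open_almost_optimal (hd : 2 ≤ d) {Ω E₀ : Set (Eucl d)}
    (hΩ : IsBoundedSmoothDomain Ω) {m : ℝ} (hm : 0 < m) (hmΩ : ENNReal.ofReal m < volume Ω)
    (hE : MeasurableSet E₀) (hEΩ : E₀ ⊆ Ω) (hEm : volume E₀ = ENNReal.ofReal m)
    (hEP : tv (E₀.indicator 1) ≠ ⊤) {a : EReal} (ha : Ilog Ω < a) {η : ℝ} (hη : 0 < η) :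
    ∃ E : Set (Eucl d), IsOpen E ∧ E ⊆ Ω ∧ volume E = ENNReal.ofReal m ∧
      tv (E.indicator 1) ≤ tv (E₀.indicator 1) + ENNReal.ofReal η ∧ Ilog E ≤ a := by
  have : NeZero d := ⟨by omega⟩
  obtain ⟨c, hc, hdiam⟩ := exists_forall_norm_sub_le_exp hΩ.2.2.1
  -- The tolerance `τ` depends on `E₀` and `η` but not on the charged set, so it can be fixed before
  -- `T` is built.
  obtain ⟨τ, hτ, hcomp⟩ := exists_open_competitor hd hΩ.1 hΩ.2.2.1 (tv_smoothDomain_ne_top hΩ)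
    hE hEΩ hEP hm hEm hmΩ hη
  obtain ⟨μ, K, hμ, hK, hKΩ, hμK, hlt⟩ := exists_compact_mutualEnergy_lt hΩ hc hdiam ha
  obtain ⟨b, hb1, hb2⟩ := EReal.lt_iff_exists_real_btwn.1 hlt
  have hμb : mutualEnergy c μ μ < ENNReal.ofReal (b + c) := by
    have h1 : ((mutualEnergy c μ μ : ℝ≥0∞) : EReal) < (b : EReal) + (c : EReal) :=
      (EReal.sub_lt_iff (Or.inl (EReal.coe_ne_bot c)) (Or.inl (EReal.coe_ne_top c))).1 hb1
    rw [← EReal.coe_add] at h1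
    have h0 : 0 ≤ b + c := by exact_mod_cast (EReal.coe_ennreal_nonneg _).trans h1.le
    rw [← EReal.coe_ennreal_lt_coe_ennreal_iff, EReal.coe_ennreal_ofReal, max_eq_left h0]
    exact h1
  obtain ⟨T, hTo, hTΩ, -, hTP, hTV, ν, hν, hνT, hνb⟩ :=
    exists_small_open_of_mutualEnergy_lt hd hK hΩ.1 hKΩ hμK hμb hτ
  obtain ⟨E, hEo, hTE, hEsub, hEvol, hEtv⟩ := hcomp T hTo hTΩ hTP hTV
  refine ⟨E, hEo, hEsub, hEvol, hEtv, ?_⟩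
  have hcl : closure E ⊆ closure Ω := closure_mono hEsub
  refine (Ilog_le_mutualEnergy (μ := ν) hc (fun x hx y hy ↦ hdiam x (hcl hx) y (hcl hy))
    (hνT.mono fun x hx ↦ subset_closure (hTE hx))).trans (le_trans ?_ hb2.le)
  rw [EReal.sub_le_iff_le_add (Or.inl (EReal.coe_ne_bot c)) (Or.inl (EReal.coe_ne_top c)),
    ← EReal.coe_add]
  have h0 : 0 ≤ b + c := by
    by_contra! h
    rw [ENNReal.ofReal_of_nonpos h.le] at hνb
    exact not_lt_zero hνb
  have := EReal.coe_ennreal_le_coe_ennreal_iff.2 hνb.le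
  rwa [EReal.coe_ennreal_ofReal, max_eq_left h0] at this

/-- The relaxed problem in a smooth domain decouples perimeter and energy. -/
theorem iInf_logFunctional_smoothDomain (hd : 2 ≤ d) {Q m : ℝ} (hQ : 0 < Q) (hm : 0 < m)
    {Ω E₀ : Set (Eucl d)} (hΩ : IsBoundedSmoothDomain Ω) (hmΩ : ENNReal.ofReal m < volume Ω)
    (hE₀ : IsIsoperimetricSolution Ω m E₀) :
    (⨅ E ∈ {E : Set (Eucl d) | IsOpen E ∧ E ⊆ Ω ∧ volume E = ENNReal.ofReal m},
      logFunctional Q E) = perimeter E₀ + ((Q ^ 2 : ℝ) : EReal) * Ilog Ω := by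
  obtain ⟨⟨hE, hEΩ, hEm⟩, hmin⟩ := hE₀
  have hQ2 : (0 : EReal) ≤ ((Q ^ 2 : ℝ) : EReal) := by exact_mod_cast sq_nonneg Q
  -- The lower bound is immediate: `E₀` minimizes perimeter, and a smaller closure admits fewer
  -- charges.
  refine le_antisymm ?_ (le_iInf₂ fun E hE ↦ add_le_add
    (hmin ⟨hE.1.measurableSet, hE.2⟩)
    (mul_le_mul_of_nonneg_left (Ilog_anti (closure_mono hE.2.1)) hQ2))
  have hPbot := perimeter_ne_bot hE
  obtain ⟨c, hc, hdiam⟩ := exists_forall_norm_sub_le_exp hΩ.2.2.1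
  have hIbot : Ilog Ω ≠ ⊥ := ne_of_gt ((EReal.bot_lt_coe _).trans_le (neg_le_Ilog hc hdiam))
  by_cases hItop : Ilog Ω = ⊤
  · rw [hItop, EReal.coe_mul_top_of_pos (by positivity), EReal.add_top_of_ne_bot hPbot]
    exact le_top
  rw [perimeter_eq_tv hE]
  by_cases hP : tv (E₀.indicator 1) = ⊤
  · rw [hP, EReal.coe_ennreal_top, EReal.top_add_of_ne_bot]
    · exact le_top
    · lift Ilog Ω to ℝ using ⟨hItop, hIbot⟩ with I
      rw [← EReal.coe_mul]
      exact EReal.coe_ne_bot _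
  lift Ilog Ω to ℝ using ⟨hItop, hIbot⟩ with I hI
  set p := (tv (E₀.indicator 1)).toReal with hp
  have hp0 : 0 ≤ p := ENNReal.toReal_nonneg
  have htv : tv (E₀.indicator 1) = ENNReal.ofReal p := (ENNReal.ofReal_toReal hP).symm
  rw [htv, EReal.coe_ennreal_ofReal, max_eq_left hp0, ← EReal.coe_mul, ← EReal.coe_add]
  refine EReal.le_of_forall_lt_iff_le.1 fun z hz ↦ ?_
  rw [EReal.coe_lt_coe_iff] at hz
  -- The slack below `z` is shared so that `η` of perimeter and `η` of energy, weighted by `Q ^ 2`,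
  -- add up to it exactly.
  set η : ℝ := (z - (p + Q ^ 2 * I)) / (1 + Q ^ 2) with hη
  have hη0 : 0 < η := div_pos (sub_pos.2 hz) (by positivity)
  have hηz : p + η + Q ^ 2 * (I + η) = z := by rw [hη]; field_simp; ring
  have ha : Ilog Ω < ((I + η : ℝ) : EReal) := by
    rw [← hI]; exact_mod_cast lt_add_of_pos_right I hη0
  obtain ⟨E, hEo, hEsub, hEvol, hEtv, hEI⟩ :=
    exists_open_almost_optimal hd hΩ hm hmΩ hE hEΩ hEm hP ha hη0
  refine (iInf₂_le (f := fun E _ ↦ logFunctional Q E) E ⟨hEo, hEsub, hEvol⟩).trans ?_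
  rw [← hηz]
  refine logFunctional_le ?_ hEI
  rw [perimeter_eq_tv hEo.measurableSet]
  rw [htv, ← ENNReal.ofReal_add hp0 hη0.le] at hEtv
  have := EReal.coe_ennreal_le_coe_ennreal_iff.2 hEtv
  rwa [EReal.coe_ennreal_ofReal, max_eq_left (by positivity)] at this

end ChargedDrop

theorem mainTheorem9 (d : ℕ) (hd : 2 ≤ d) (Q m : ℝ) (hQ : 0 < Q) (hm : 0 < m) :
    -- (i)
    (⨅ E ∈ {E : Set (EuclideanSpace ℝ (Fin d)) |
        IsOpen E ∧ Bornology.IsBounded E ∧ volume E = ENNReal.ofReal m},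
      logFunctional Q E) = ⊥ ∧
    -- (ii)
    (∀ δ : ℝ, 0 < δ → 2 * unitBallVolume d * δ ^ d < m →
      (⨅ E ∈ {E | E ∈ ballClass d δ ∧ volume E = ENNReal.ofReal m}, logFunctional Q E) = ⊥) ∧
    -- (iii)
    (∀ δ : ℝ, 0 < δ → unitBallVolume d * δ ^ d < m →
      ∃ E ∈ {E | E ∈ connectedBallClass d δ ∧ volume E = ENNReal.ofReal m},
        IsMinOn (logFunctional Q)
          {E | E ∈ connectedBallClass d δ ∧ volume E = ENNReal.ofReal m} E) ∧
    -- (iv)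
    (∀ Ω : Set (EuclideanSpace ℝ (Fin d)), IsBoundedSmoothDomain Ω →
      ENNReal.ofReal m < volume Ω →
      (∃ E₀, IsIsoperimetricSolution Ω m E₀) ∧
      ∀ E₀, IsIsoperimetricSolution Ω m E₀ →
        (⨅ E ∈ {E : Set (EuclideanSpace ℝ (Fin d)) |
            IsOpen E ∧ E ⊆ Ω ∧ volume E = ENNReal.ofReal m},
          logFunctional Q E) = perimeter E₀ + ((Q ^ 2 : ℝ) : EReal) * Ilog Ω) := by
  have : NeZero d := ⟨by omega⟩
  refine ⟨iInf_open_eq_bot hQ hm, fun δ hδ h ↦ iInf_ballClass_eq_bot hQ hδ h,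
    fun δ hδ h ↦ exists_isMinOn_connectedBallClass Q hδ h, fun Ω hΩ hmΩ ↦
      ⟨exists_isIsoperimetricSolution hΩ.1.measurableSet hΩ.2.2.1 hm.le hmΩ.le,
        fun E₀ hE₀ ↦ iInf_logFunctional_smoothDomain hd hQ hm hΩ hmΩ hE₀⟩⟩
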